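/- A \emph{flow} $\mathbb{R}\curvearrowright(Z,\eta)$ is a nonsingular action of $\mathbb{R}$ on a $\sigma$-finite standard measure space, i.e. a continuous homomorphism from $\mathbb{R}$ to the Polish group of nonsingular automorphisms of $(Z,\eta)$; it acts on $L^\infty(Z,\eta)$ by $(t\cdot F)(z)=F((-t)\cdot z)$. Let $(\mu_n)_{n\ge 1}$ be a sequence of probability measures on $\mathbb{R}$. Put $(\Omega,\mu)=\prod_{k\ge 1}(\mathbb{R},\mu_k)$ and $(\Omega_n,\tilde\mu_n)=\prod_{k>n}(\mathbb{R},\mu_k)$, equip $\mathbb{R}$ with the Lebesgue measure class, and let $\pi_n:\mathbb{R}\times\Omega\to\mathbb{R}\times\Omega_n$ be given by $\pi_n(t,\omega)=(t+\omega_1+\cdots+\omega_n,\omega_{n+1},\omega_{n+2},\ldots)$. The \emph{tail boundary} is $A=\bigcap_{n\ge 0}\{g\circ\pi_n : g\in L^\infty(\mathbb{R}\times\Omega_n)\}\subset L^\infty(\mathbb{R}\times\Omega)$, and the \emph{tail boundary flow} of $(\mu_n)$ is the action of $\mathbb{R}$ on $A$ by translation in the first variable, $(t\cdot F)(s,\omega)=F(s-t,\omega)$.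 A flow $\mathbb{R}\curvearrowright (Z,\eta)$ is the tail boundary flow of $(\mu_n)$ if there is an $\mathbb{R}$-equivariant $*$-isomorphism $L^\infty(Z,\eta)\cong A$; two tail boundary flows are isomorphic if there is an $\mathbb{R}$-equivariant $*$-isomorphism between the tail boundaries. For a finite positive measure $m$ on $\mathbb{R}$, the \emph{compound Poisson distribution} is $\mathcal{E}(m)=e^{-m(\mathbb{R})}\bigl(\delta_0+\sum_{k\ge 1}\frac{1}{k!}m^{*k}\bigr)$. An ergodic flow is a \emph{Poisson flow} if it is the tail boundary flow of a sequence of compound Poisson distributions, and a \emph{Poisson flow of positive type} if these compound Poisson distributions can be chosen with support in $[0,+\infty)$. \textbf{Proposition.} (1) A flow is a Poisson flow if and only if it is the tail boundary flow of a sequence $(\mu_n)$ of probability measures such that the support of every $\mu_n$ consists of exactly two points and $\sup_n \operatorname{Var}\mu_n<+\infty$. (2) A flow is a Poisson flow of positive type if and only if it is the tail boundary flow of a sequence $(\mu_n)$ of probability measures such that the support of every $\mu_n$ is $\{a_n,b_n\}$ with $a_n<b_n$ and $\mu_n(\{a_n\})\ge\mu_n(\{b_n\})$, and $\sup_n\operatorname{Var}\mu_n<+\infty$.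 The same holds for the actions on the tail boundary algebras themselves: the tail boundary flow of every sequence of compound Poisson distributions (respectively, compound Poisson distributions with support in $[0,+\infty)$) is isomorphic to the tail boundary flow of a sequence as in (1) (respectively, as in (2)), and conversely the tail boundary flow of every sequence as in (1) (respectively, as in (2)) is isomorphic to the tail boundary flow of a sequence of compound Poisson distributions (respectively, compound Poisson distributions with support in $[0,+\infty)$). -/

import Mathlib

open MeasureTheory ProbabilityTheory Filter Topology

noncomputable section

namespace TailFlow

/-! ### The von Neumann algebra `L^∞` of complex-valued functions, as a `*`-algebra -/

section AlgebraOfClasses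

variable {X : Type*} [MeasurableSpace X] {m : Measure X}

/-- Almost everywhere classes of measurable complex functions form a commutative ring. -/
instance : CommRing (X →ₘ[m] ℂ) :=
  { (inferInstance : AddCommGroup (X →ₘ[m] ℂ)), (inferInstance : CommMonoid (X →ₘ[m] ℂ)) with
    left_distrib := fun a b c => by
      apply AEEqFun.ext
      filter_upwards [AEEqFun.coeFn_mul a (b + c), AEEqFun.coeFn_add b c,
        AEEqFun.coeFn_add (a * b) (a * c), AEEqFun.coeFn_mul a b, AEEqFun.coeFn_mul a c]
        with x h1 h2 h3 h4 h5
      rw [h1, h3]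
      simp only [Pi.mul_apply, Pi.add_apply, h2, h4, h5, mul_add]
    right_distrib := fun a b c => by
      apply AEEqFun.ext
      filter_upwards [AEEqFun.coeFn_mul (a + b) c, AEEqFun.coeFn_add a b,
        AEEqFun.coeFn_add (a * c) (b * c), AEEqFun.coeFn_mul a c, AEEqFun.coeFn_mul b c]
        with x h1 h2 h3 h4 h5
      rw [h1, h3]
      simp only [Pi.mul_apply, Pi.add_apply, h2, h4, h5, add_mul]
    zero_mul := fun a => by
      apply AEEqFun.ext
      filter_upwards [AEEqFun.coeFn_mul 0 a, AEEqFun.coeFn_zero (α := X) (μ := m) (β := ℂ)]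
        with x h1 h2
      simp only [h1, h2, Pi.mul_apply, Pi.zero_apply, zero_mul]
    mul_zero := fun a => by
      apply AEEqFun.ext
      filter_upwards [AEEqFun.coeFn_mul a 0, AEEqFun.coeFn_zero (α := X) (μ := m) (β := ℂ)]
        with x h1 h2
      simp only [h1, h2, Pi.mul_apply, Pi.zero_apply, mul_zero] }

instance : Algebra ℂ (X →ₘ[m] ℂ) :=
  Algebra.ofModule
    (fun r a b => by
      apply AEEqFun.ext
      filter_upwards [AEEqFun.coeFn_mul (r • a) b, AEEqFun.coeFn_smul r a,
        AEEqFun.coeFn_smul r (a * b), AEEqFun.coeFn_mul a b] with x h1 h2 h3 h4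
      rw [h1, h3]
      simp only [Pi.mul_apply, Pi.smul_apply, h2, h4, smul_mul_assoc])
    (fun r a b => by
      apply AEEqFun.ext
      filter_upwards [AEEqFun.coeFn_mul a (r • b), AEEqFun.coeFn_smul r b,
        AEEqFun.coeFn_smul r (a * b), AEEqFun.coeFn_mul a b] with x h1 h2 h3 h4
      rw [h1, h3]
      simp only [Pi.mul_apply, Pi.smul_apply, h2, h4, mul_smul_comm])

instance : StarRing (X →ₘ[m] ℂ) where
  star_mul a b := by
    apply AEEqFun.ext
    filter_upwards [AEEqFun.coeFn_star (a * b), AEEqFun.coeFn_mul a b,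
      AEEqFun.coeFn_mul (star b) (star a), AEEqFun.coeFn_star a, AEEqFun.coeFn_star b]
      with x h1 h2 h3 h4 h5
    rw [h1, h3]
    simp only [Pi.mul_apply, Pi.star_apply, h2, h4, h5, star_mul]
  star_add a b := by
    apply AEEqFun.ext
    filter_upwards [AEEqFun.coeFn_star (a + b), AEEqFun.coeFn_add a b,
      AEEqFun.coeFn_add (star a) (star b), AEEqFun.coeFn_star a, AEEqFun.coeFn_star b]
      with x h1 h2 h3 h4 h5
    rw [h1, h3]
    simp only [Pi.add_apply, Pi.star_apply, h2, h4, h5, star_add]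

instance : StarModule ℂ (X →ₘ[m] ℂ) where
  star_smul r a := by
    apply AEEqFun.ext
    filter_upwards [AEEqFun.coeFn_star (r • a), AEEqFun.coeFn_smul r a,
      AEEqFun.coeFn_smul (star r) (star a), AEEqFun.coeFn_star a] with x h1 h2 h3 h4
    rw [h1, h3]
    simp only [Pi.smul_apply, Pi.star_apply, h2, h4, star_smul]

theorem coeFn_algebraMap (r : ℂ) :
    (algebraMap ℂ (X →ₘ[m] ℂ) r : X → ℂ) =ᵐ[m] fun _ => r := by
  rw [Algebra.algebraMap_eq_smul_one]
  filter_upwards [AEEqFun.coeFn_smul r (1 : X →ₘ[m] ℂ), AEEqFun.coeFn_one (α := X) (μ := m) (β := ℂ)]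
    with x h1 h2
  simp [h1, h2]

/-- `L^∞(X, m)`, the essentially bounded classes. -/
def Linfty (m : Measure X) : StarSubalgebra ℂ (X →ₘ[m] ℂ) where
  carrier := {F | ∃ C : ℝ, ∀ᵐ x ∂m, ‖F x‖ ≤ C}
  mul_mem' := by
    rintro a b ⟨C, hC⟩ ⟨D, hD⟩
    refine ⟨C * D, ?_⟩
    filter_upwards [AEEqFun.coeFn_mul a b, hC, hD] with x h1 h2 h3
    rw [h1, Pi.mul_apply, norm_mul]
    exact mul_le_mul h2 h3 (norm_nonneg _) ((norm_nonneg _).trans h2)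
  add_mem' := by
    rintro a b ⟨C, hC⟩ ⟨D, hD⟩
    refine ⟨C + D, ?_⟩
    filter_upwards [AEEqFun.coeFn_add a b, hC, hD] with x h1 h2 h3
    rw [h1, Pi.add_apply]
    exact (norm_add_le _ _).trans (add_le_add h2 h3)
  algebraMap_mem' r := by
    refine ⟨‖r‖, ?_⟩
    filter_upwards [coeFn_algebraMap (m := m) r] with x h1
    rw [h1]
  star_mem' := by
    rintro a ⟨C, hC⟩
    refine ⟨C, ?_⟩
    filter_upwards [AEEqFun.coeFn_star a, hC] with x h1 h2
    simpa [h1] using h2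

end AlgebraOfClasses

/-- Two families of maps indexed by `ℝ` on `*`-algebras are conjugate (the actions are isomorphic)
if a `*`-isomorphism intertwines them. -/
def Conjugate {A B : Type*} [Semiring A] [Algebra ℂ A] [Star A] [Semiring B] [Algebra ℂ B] [Star B]
    (a : ℝ → A → A) (b : ℝ → B → B) : Prop :=
  ∃ Φ : A ≃⋆ₐ[ℂ] B, ∀ (t : ℝ) (F : A), Φ (a t F) = b t (Φ F)

/-! ### Flows -/

/-- A flow on `(Z, η)`: a nonsingular action of `ℝ`, that is, a continuous homomorphism from `ℝ` to
the group of nonsingular automorphisms of `(Z, η)` modulo equality almost everywhere. As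
`map (-t)` is inverse to `map t` almost everywhere, `quasi` says that `map t` carries `η` to an
equivalent measure. In `continuous_zero` the topology on the automorphism group is the canonical
one, given by norm convergence on the predual `L¹(Z, η)`. -/
structure Flow {Z : Type*} [MeasurableSpace Z] (η : Measure Z) where
  map : ℝ → Z → Z
  quasi : ∀ t, Measure.QuasiMeasurePreserving (map t) η η
  map_zero : map 0 =ᵐ[η] id
  map_add : ∀ s t, map (s + t) =ᵐ[η] map s ∘ map t
  continuous_zero : ∀ ρ : Measure Z, IsFiniteMeasure ρ → ρ ≪ η → ∀ ε : ℝ, 0 < ε →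
    ∀ᶠ t in 𝓝 (0 : ℝ), ∀ U : Set Z, MeasurableSet U →
      |(ρ.map (map t)).real U - ρ.real U| ≤ ε

namespace Flow

variable {Z : Type*} [MeasurableSpace Z] {η : Measure Z}

/-- The induced action on `L^∞(Z, η)`, `(t · F)(z) = F((-t) · z)`. -/
def act (α : Flow η) (t : ℝ) (F : Linfty η) : Linfty η :=
  ⟨(F : Z →ₘ[η] ℂ).compQuasiMeasurePreserving (α.map (-t)) (α.quasi (-t)), by
    obtain ⟨C, hC⟩ := F.2
    refine ⟨C, ?_⟩
    filter_upwards [AEEqFun.coeFn_compQuasiMeasurePreserving (F : Z →ₘ[η] ℂ) (α.quasi (-t)),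
      (α.quasi (-t)).ae hC] with z h1 h2
    rw [h1]
    exact h2⟩

/-- Ergodicity: every invariant measurable set is null or conull. -/
def IsErgodic (α : Flow η) : Prop :=
  ∀ U : Set Z, MeasurableSet U → (∀ t, α.map t ⁻¹' U =ᵐ[η] U) → η U = 0 ∨ η Uᶜ = 0

end Flow

/-! ### The tail boundary flow of a sequence of probability measures on `ℝ`

The sequence `μ₁, μ₂, …` is indexed from `0` here: `μ k` is the law of the step number `k + 1`. -/

/-- The measure on `ℝ × Ω`, where `Ω` is the infinite product of the `(ℝ, μ k)`. The first factor
carries the Lebesgue measure, whose measure class is all that matters for `L^∞`. -/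
def pathMeasure (μ : ℕ → ProbabilityMeasure ℝ) : Measure (ℝ × (ℕ → ℝ)) :=
  (volume : Measure ℝ).prod (Measure.infinitePi fun k => (μ k : Measure ℝ))

/-- `π_n (t, ω) = (t + ω₁ + ⋯ + ω_n, ω_{n+1}, ω_{n+2}, …)`. -/
def walk (n : ℕ) (x : ℝ × (ℕ → ℝ)) : ℝ × (ℕ → ℝ) :=
  (x.1 + ∑ i ∈ Finset.range n, x.2 i, fun k => x.2 (n + k))

/-- The tail boundary `⋂ n, A_n` in `L^∞(ℝ × Ω)`, where `A_n` consists of the classes of the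
functions `g ∘ π_n` with `g` a bounded measurable function on `ℝ × Ω_n`. -/
def tailBoundary (μ : ℕ → ProbabilityMeasure ℝ) :
    StarSubalgebra ℂ (ℝ × (ℕ → ℝ) →ₘ[pathMeasure μ] ℂ) where
  carrier := {F | ∀ n : ℕ, ∃ g : ℝ × (ℕ → ℝ) → ℂ, Measurable g ∧ (∃ C : ℝ, ∀ x, ‖g x‖ ≤ C) ∧
    F =ᵐ[pathMeasure μ] g ∘ walk n}
  mul_mem' := by
    intro a b ha hb n
    obtain ⟨f, hf, ⟨C, hC⟩, hfa⟩ := ha n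
    obtain ⟨g, hg, ⟨D, hD⟩, hgb⟩ := hb n
    refine ⟨f * g, hf.mul hg, ⟨C * D, fun x => ?_⟩, ?_⟩
    · rw [Pi.mul_apply, norm_mul]
      exact mul_le_mul (hC x) (hD x) (norm_nonneg _) ((norm_nonneg _).trans (hC x))
    · filter_upwards [AEEqFun.coeFn_mul a b, hfa, hgb] with x h1 h2 h3
      simp [h1, h2, h3]
  add_mem' := by
    intro a b ha hb n
    obtain ⟨f, hf, ⟨C, hC⟩, hfa⟩ := ha n
    obtain ⟨g, hg, ⟨D, hD⟩, hgb⟩ := hb n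
    refine ⟨f + g, hf.add hg, ⟨C + D, fun x => ?_⟩, ?_⟩
    · exact (norm_add_le _ _).trans (add_le_add (hC x) (hD x))
    · filter_upwards [AEEqFun.coeFn_add a b, hfa, hgb] with x h1 h2 h3
      simp [h1, h2, h3]
  algebraMap_mem' r n := by
    refine ⟨fun _ => r, measurable_const, ⟨‖r‖, fun _ => le_rfl⟩, ?_⟩
    filter_upwards [coeFn_algebraMap (m := pathMeasure μ) r] with x h1
    rw [h1]
    rfl
  star_mem' := by
    intro a ha n
    obtain ⟨f, hf, ⟨C, hC⟩, hfa⟩ := ha n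
    refine ⟨fun x => star (f x), (continuous_star.measurable.comp hf), ⟨C, fun x => ?_⟩, ?_⟩
    · simpa using hC x
    · filter_upwards [AEEqFun.coeFn_star a, hfa] with x h1 h2
      simp [h1, h2]

/-- The translation of `ℝ × Ω` in the first variable, `t · (s, ω) = (s + t, ω)`. -/
def translate (t : ℝ) (x : ℝ × (ℕ → ℝ)) : ℝ × (ℕ → ℝ) := (x.1 + t, x.2)

theorem translate_measurePreserving (μ : ℕ → ProbabilityMeasure ℝ) (t : ℝ) :
    MeasurePreserving (translate t) (pathMeasure μ) (pathMeasure μ) :=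
  (measurePreserving_add_right (volume : Measure ℝ) t).prod (MeasurePreserving.id _)

/-- The action of `ℝ` on the tail boundary by translation in the first variable,
`(t · F)(s, ω) = F(s - t, ω)`. -/
def tailAct (μ : ℕ → ProbabilityMeasure ℝ) (t : ℝ) (F : tailBoundary μ) : tailBoundary μ :=
  ⟨(F : ℝ × (ℕ → ℝ) →ₘ[pathMeasure μ] ℂ).compQuasiMeasurePreserving (translate (-t))
      (translate_measurePreserving μ (-t)).quasiMeasurePreserving, by
    intro n
    obtain ⟨g, hg, ⟨C, hC⟩, hF⟩ := F.2 n
    refine ⟨g ∘ translate (-t), hg.comp (translate_measurePreserving μ (-t)).measurable,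
      ⟨C, fun x => hC _⟩, ?_⟩
    filter_upwards [AEEqFun.coeFn_compQuasiMeasurePreserving
      (F : ℝ × (ℕ → ℝ) →ₘ[pathMeasure μ] ℂ)
      (translate_measurePreserving μ (-t)).quasiMeasurePreserving,
      (translate_measurePreserving μ (-t)).quasiMeasurePreserving.ae hF] with x h1 h2
    rw [h1, Function.comp_apply, h2]
    simp only [Function.comp_apply, walk, translate]
    congr 2
    ring⟩

/-- The flow `α` is (isomorphic with) the tail boundary flow of the sequence `μ`. -/
def IsTailBoundaryFlow {Z : Type*} [MeasurableSpace Z] {η : Measure Z} (α : Flow η)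
    (μ : ℕ → ProbabilityMeasure ℝ) : Prop :=
  Conjugate α.act (tailAct μ)

/-! ### Poisson flows -/

/-- The convolution powers `m^{*k}`, with `m^{*0} = δ₀`. -/
def convPow (m : Measure ℝ) : ℕ → Measure ℝ
  | 0 => Measure.dirac 0
  | k + 1 => (convPow m k).conv m

/-- The compound Poisson distribution `exp(-m(ℝ)) ∑ₖ m^{*k} / k!` of a finite measure `m`. -/
def compoundPoisson (m : Measure ℝ) : Measure ℝ :=
  ENNReal.ofReal (Real.exp (-(m.real Set.univ))) •
    Measure.sum fun k : ℕ => ((k.factorial : ENNReal)⁻¹) • convPow m k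

def IsCompoundPoisson (p : ProbabilityMeasure ℝ) : Prop :=
  ∃ m : Measure ℝ, IsFiniteMeasure m ∧ (p : Measure ℝ) = compoundPoisson m

/-- An ergodic flow that is the tail boundary flow of a sequence of compound Poisson
distributions. -/
def IsPoissonFlow {Z : Type*} [MeasurableSpace Z] {η : Measure Z} (α : Flow η) : Prop :=
  α.IsErgodic ∧ ∃ μ : ℕ → ProbabilityMeasure ℝ,
    (∀ n, IsCompoundPoisson (μ n)) ∧ IsTailBoundaryFlow α μ

/-- A Poisson flow for which the compound Poisson distributions can be chosen with support
in `[0, ∞)`. -/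
def IsPoissonFlowOfPositiveType {Z : Type*} [MeasurableSpace Z] {η : Measure Z} (α : Flow η) :
    Prop :=
  α.IsErgodic ∧ ∃ μ : ℕ → ProbabilityMeasure ℝ,
    (∀ n, IsCompoundPoisson (μ n) ∧ (μ n : Measure ℝ).support ⊆ Set.Ici 0) ∧
      IsTailBoundaryFlow α μ

/-! ### Two-point measures -/

/-- All the measures are supported on two points, and their variances are uniformly bounded. -/
def IsTwoPointSequence (μ : ℕ → ProbabilityMeasure ℝ) : Prop :=
  (∀ n, ∃ a b : ℝ, a < b ∧ (μ n : Measure ℝ).support = {a, b}) ∧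
    BddAbove (Set.range fun n => variance id (μ n : Measure ℝ))

/-- In addition, the left atom has at least the mass of the right atom. -/
def IsLeftHeavyTwoPointSequence (μ : ℕ → ProbabilityMeasure ℝ) : Prop :=
  (∀ n, ∃ a b : ℝ, a < b ∧ (μ n : Measure ℝ).support = {a, b} ∧
      (μ n : Measure ℝ) {b} ≤ (μ n : Measure ℝ) {a}) ∧
    BddAbove (Set.range fun n => variance id (μ n : Measure ℝ))

end TailFlow

end

/-! By Lévy's upward theorem an element of the tail boundary is the almost sure limit of functions
`G n` of the position t + S_n, and every bounded limit of this kind is a tail element. Tail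
boundaries can therefore be compared by putting two walks on one probability space
(`conjugate_of_isWalkLimit`). The flow does not change when independent steps are reordered or
merged in finite blocks (`conjugate_of_regroup`), nor when they are replaced by coupled steps whose
differences, minus constants and modulo a countable group of common periods, form an almost surely
convergent series (`conjugate_of_coupling`). Convergence comes from a summable coupling cost or from
summable variances.

From Poisson to two points: E(m) is the convolution of the E(m_i) when m is the sum of the m_i. Cut
m into pieces of tiny mass, each nearly concentrated at a point d_i. Up to an error of second order
in the mass, a step of law E(m_i) is 0 or a single jump close to d_i, and with enough pieces the
total cost of replacing it by a two-point step is summable.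

From two points to Poisson: up to constants, step k is a jump d_k with probability p_k ≤ 1/2, and
p_k d_k² is bounded. The periods of the tail boundary form a closed subgroup: ℝ, d₀ℤ or 0. The main
tool is a mirror coupling. Two copies of the walk use a fair coin of mass q, hidden in a step
between points at distance e, with opposite outcomes, so that their distance performs a symmetric
walk. If the e_k are bounded and Σ q_k e_k² diverges, a gambler's ruin estimate yields a positive
period not exceeding the bound (`CoinFamily.exists_isPeriod`). With periods ℝ or d₀ℤ, the steps can
be moved into a countable group of periods, and the flow is that of an explicit Poisson sequence.
Without periods, jumps with |d_k| < 1 can be suppressed, and the others are classified by ⌊d_k⌋ and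
by the dyadic size of p_k. Pairing small with large jumps inside a class shows that all its jumps
may be replaced by their median. The number of jumps in a class is then a sum of Bernoulli
variables, which is Poisson up to an ℓ¹ error of 384 times the largest parameter, whatever the
number of terms (`tsum_abs_bernoulliPoly_sub_poissonWeight_le`). The bound on p_k d_k² makes these
errors summable over the classes.

The signs of the jumps survive in both directions, which gives the positive type. Ergodicity is
automatic, because invariant tail elements are constant. -/

namespace TailFlow

/-! ### Lévy's upward theorem for functions of a walk and its future -/

section Upward

variable {Ω 𝒳 𝒲 : Type*} [mΩ : MeasurableSpace Ω] [MeasurableSpace 𝒳] [MeasurableSpace 𝒲]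
  {P : Measure Ω} [IsProbabilityMeasure P]

/-- Freezing: by independence the joint law of `X` and `W` is a product, and Fubini integrates `W`
out. -/
theorem condExp_comap_indep {X : Ω → 𝒳} {W : Ω → 𝒲} (hX : Measurable X) (hW : Measurable W)
    (hind : IndepFun X W P) {h : 𝒳 × 𝒲 → ℝ} (hh : Measurable h) {C : ℝ} (hC : ∀ z, ‖h z‖ ≤ C)
    {f : Ω → ℝ} (hf : f =ᵐ[P] fun y => h (X y, W y)) :
    (fun y => ∫ y', h (X y, W y') ∂P) =ᵐ[P] P[f | MeasurableSpace.comap X inferInstance] := by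
  have hle : MeasurableSpace.comap X inferInstance ≤ mΩ := hX.comap_le
  have hint : Integrable (fun y => h (X y, W y)) P :=
    Integrable.of_bound (hh.comp (hX.prodMk hW)).aestronglyMeasurable C (ae_of_all _ fun y => hC _)
  have hm : Measurable fun x => ∫ y', h (x, W y') ∂P := by
    have : StronglyMeasurable (Function.uncurry fun x y' => h (x, W y')) :=
      (hh.comp (measurable_fst.prodMk (hW.comp measurable_snd))).stronglyMeasurable
    exact this.integral_prod_right.measurable
  have hbd : ∀ x, ‖∫ y', h (x, W y') ∂P‖ ≤ C := fun x => by
    simpa using norm_integral_le_of_norm_le_const (μ := P) (ae_of_all _ fun y' => hC (x, W y'))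
  refine ae_eq_condExp_of_forall_setIntegral_eq hle (hint.congr hf.symm) ?_ ?_ ?_
  · intro s _ _
    exact (Integrable.of_bound (hm.comp hX).aestronglyMeasurable C
      (ae_of_all _ fun y => hbd _)).integrableOn
  · rintro s ⟨B, hB, rfl⟩ -
    rw [setIntegral_congr_ae (g := fun y => h (X y, W y)) (hX hB) (hf.mono fun _ h _ => h)]
    have hmap := (indepFun_iff_map_prod_eq_prod_map_map hX.aemeasurable hW.aemeasurable).1 hind
    have : IsProbabilityMeasure (P.map X) := Measure.isProbabilityMeasure_map hX.aemeasurable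
    have : IsProbabilityMeasure (P.map W) := Measure.isProbabilityMeasure_map hW.aemeasurable
    have hBm : MeasurableSet (B ×ˢ (Set.univ : Set 𝒲)) := hB.prod .univ
    have h1 : ∫ y in X ⁻¹' B, h (X y, W y) ∂P
        = ∫ z in B ×ˢ Set.univ, h z ∂((P.map X).prod (P.map W)) := by
      rw [← hmap, setIntegral_map hBm hh.aestronglyMeasurable (hX.prodMk hW).aemeasurable]
      congr 2
      ext y
      simp
    rw [h1, setIntegral_prod _ (Integrable.of_bound hh.aestronglyMeasurable C
      (ae_of_all _ hC)).integrableOn, setIntegral_map hB ?_ hX.aemeasurable]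
    · refine setIntegral_congr_fun (hX hB) fun y _ => ?_
      simp only [Measure.restrict_univ]
      rw [integral_map hW.aemeasurable]
      exact (hh.comp (measurable_const.prodMk measurable_id)).aestronglyMeasurable
    · exact (hh.stronglyMeasurable.integral_prod_right'
        (ν := (P.map W).restrict Set.univ)).aestronglyMeasurable
  · exact ((hm.comp (comap_measurable X)).stronglyMeasurable).aestronglyMeasurable

/-- The same `f` is a function of `(X n, W n)` for every `n`, so the frozen integrals are its
conditional expectations along one filtration. As the filtration generates everything, Lévy's
theorem returns `f` itself. -/
theorem ae_tendsto_integral_real {X : ℕ → Ω → 𝒳} {W : ℕ → Ω → 𝒲} (hX : ∀ n, Measurable (X n))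
    (hW : ∀ n, Measurable (W n)) (hind : ∀ n, IndepFun (X n) (W n) P)
    (hmono : Monotone fun n => MeasurableSpace.comap (X n) inferInstance)
    (hgen : mΩ ≤ ⨆ n, MeasurableSpace.comap (X n) inferInstance)
    {h : ℕ → 𝒳 × 𝒲 → ℝ} (hh : ∀ n, Measurable (h n)) {C : ℝ} (hC : ∀ n z, ‖h n z‖ ≤ C)
    {f : Ω → ℝ} (hfm : Measurable f) (hf : ∀ n, f =ᵐ[P] fun y => h n (X n y, W n y)) :
    ∀ᵐ y ∂P, Tendsto (fun n => ∫ y', h n (X n y, W n y') ∂P) atTop (𝓝 (f y)) := by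
  let ℱ : Filtration ℕ mΩ := ⟨fun n => MeasurableSpace.comap (X n) inferInstance, hmono,
    fun n => (hX n).comap_le⟩
  have hint : Integrable f P := by
    refine Integrable.of_bound hfm.aestronglyMeasurable C ?_
    filter_upwards [hf 0] with y hy
    rw [hy]
    exact hC _ _
  have hle : (⨆ n, ℱ n) = mΩ := le_antisymm (iSup_le fun n => ℱ.le n) hgen
  have key := hint.tendsto_ae_condExp (ℱ := ℱ) (by rw [hle]; exact hfm.stronglyMeasurable)
  have hce : ∀ n, (fun y => ∫ y', h n (X n y, W n y') ∂P) =ᵐ[P] P[f | ℱ n] := fun n =>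
    condExp_comap_indep (hX n) (hW n) (hind n) (hh n) (hC n) (hf n)
  filter_upwards [key, ae_all_iff.2 hce] with y hy hy'
  simpa only [hy'] using hy

/-- The starting point carries an infinite measure, so it is fixed by Fubini and the real statement
is applied on `P` to the real and imaginary parts. -/
theorem ae_tendsto_integral_walk {X : ℕ → Ω → 𝒳} {W : ℕ → Ω → 𝒲} (hX : ∀ n, Measurable (X n))
    (hW : ∀ n, Measurable (W n)) (hind : ∀ n, IndepFun (X n) (W n) P)
    (hmono : Monotone fun n => MeasurableSpace.comap (X n) inferInstance)
    (hgen : mΩ ≤ ⨆ n, MeasurableSpace.comap (X n) inferInstance)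
    {s : ℕ → 𝒳 → ℝ} (hs : ∀ n, Measurable (s n))
    {g : ℕ → ℝ × 𝒲 → ℂ} (hg : ∀ n, Measurable (g n)) {C : ℝ} (hC : ∀ n z, ‖g n z‖ ≤ C)
    {F : ℝ × Ω → ℂ} (hF : Measurable F)
    (hFg : ∀ n, ∀ᵐ z ∂((volume : Measure ℝ).prod P), F z = g n (z.1 + s n (X n z.2), W n z.2)) :
    ∀ᵐ z ∂((volume : Measure ℝ).prod P),
      Tendsto (fun n => ∫ y, g n (z.1 + s n (X n z.2), W n y) ∂P) atTop (𝓝 (F z)) := by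
  have hm : ∀ n, Measurable fun x : ℝ => ∫ y, g n (x, W n y) ∂P := fun n => by
    have : StronglyMeasurable (Function.uncurry fun (x : ℝ) y' => g n (x, W n y')) :=
      ((hg n).comp (measurable_fst.prodMk ((hW n).comp measurable_snd))).stronglyMeasurable
    exact this.integral_prod_right.measurable
  have hsX : ∀ n, Measurable fun z : ℝ × Ω => z.1 + s n (X n z.2) := fun n =>
    measurable_fst.add ((hs n).comp ((hX n).comp measurable_snd))
  have hms : MeasurableSet {z : ℝ × Ω |
      Tendsto (fun n => ∫ y, g n (z.1 + s n (X n z.2), W n y) ∂P) atTop (𝓝 (F z))} :=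
    measurableSet_tendsto_fun (fun n => (hm n).comp (hsX n)) hF
  rw [Measure.ae_prod_iff_ae_ae hms]
  have hFg' : ∀ᵐ t : ℝ, ∀ n, ∀ᵐ y ∂P, F (t, y) = g n (t + s n (X n y), W n y) := by
    rw [ae_all_iff]
    exact fun n => Measure.ae_ae_of_ae_prod (hFg n)
  filter_upwards [hFg'] with t ht
  have hcomp : ∀ n, Measurable fun z : 𝒳 × 𝒲 => g n (t + s n z.1, z.2) := fun n =>
    (hg n).comp (((measurable_const.add ((hs n).comp measurable_fst))).prodMk measurable_snd)
  have hFt : Measurable fun y => F (t, y) := hF.comp (measurable_const.prodMk measurable_id)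
  have hre := ae_tendsto_integral_real hX hW hind hmono hgen
    (h := fun n z => (g n (t + s n z.1, z.2)).re) (fun n => Complex.measurable_re.comp (hcomp n))
    (C := C) (fun n z => (Complex.abs_re_le_norm _).trans (hC _ _))
    (f := fun y => (F (t, y)).re) (Complex.measurable_re.comp hFt)
    (fun n => (ht n).mono fun y hy => by simp only [hy])
  have him := ae_tendsto_integral_real hX hW hind hmono hgen
    (h := fun n z => (g n (t + s n z.1, z.2)).im) (fun n => Complex.measurable_im.comp (hcomp n))
    (C := C) (fun n z => (Complex.abs_im_le_norm _).trans (hC _ _))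
    (f := fun y => (F (t, y)).im) (Complex.measurable_im.comp hFt)
    (fun n => (ht n).mono fun y hy => by simp only [hy])
  filter_upwards [hre, him] with y h1 h2
  have hint : ∀ n, Integrable (fun y' => g n (t + s n (X n y), W n y')) P := fun n =>
    Integrable.of_bound ((hg n).comp (measurable_const.prodMk (hW n))).aestronglyMeasurable C
      (ae_of_all _ fun y => hC _ _)
  have hsum := ((Complex.continuous_ofReal.tendsto _).comp h1).add
    (((Complex.continuous_ofReal.tendsto _).comp h2).mul_const Complex.I)
  rw [Complex.re_add_im] at hsum
  refine hsum.congr fun n => ?_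
  exact integral_re_add_im (𝕜 := ℂ) (hint n)

end Upward

end TailFlow

namespace TailFlow

/-! ### Walk limits and elements of the tail boundary -/

theorem measurePreserving_shear {Ω Ω' : Type*} [MeasurableSpace Ω] [MeasurableSpace Ω']
    {P : Measure Ω} {P' : Measure Ω'} [SFinite P] [SFinite P'] {τ : Ω → ℝ} (hτ : Measurable τ)
    {f : Ω → Ω'} (hf : MeasurePreserving f P P') :
    MeasurePreserving (fun z : ℝ × Ω => (z.1 + τ z.2, f z.2)) ((volume : Measure ℝ).prod P)
      ((volume : Measure ℝ).prod P') := by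
  have h := hf.skew_product (μc := (volume : Measure ℝ)) (μd := (volume : Measure ℝ))
    (g := fun y t => t + τ y) (measurable_snd.add (hτ.comp measurable_fst))
    (ae_of_all _ fun y => (measurePreserving_add_right (volume : Measure ℝ) (τ y)).map_eq)
  exact (Measure.measurePreserving_swap.comp h).comp Measure.measurePreserving_swap

theorem measurePreserving_shift (μ : ℕ → ProbabilityMeasure ℝ) (n : ℕ) :
    MeasurePreserving (fun (ω : ℕ → ℝ) k => ω (n + k))
      (Measure.infinitePi fun k => (μ k : Measure ℝ))
      (Measure.infinitePi fun k => (μ (n + k) : Measure ℝ)) :=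
  ⟨by fun_prop, Measure.map_infinitePi_infinitePi_of_inj (add_right_injective n)⟩

theorem measurePreserving_walk (μ : ℕ → ProbabilityMeasure ℝ) (n : ℕ) :
    MeasurePreserving (walk n) (pathMeasure μ) (pathMeasure fun k => μ (n + k)) :=
  measurePreserving_shear (τ := fun ω : ℕ → ℝ => ∑ i ∈ Finset.range n, ω i) (by fun_prop)
    (measurePreserving_shift μ n)

/-- The definition allows a bound depending on `n`. Since all the `g n ∘ walk n` agree almost
everywhere with `F`, cutting off at the bound of `g 0` changes none of these classes and gives a
uniform bound. -/
theorem tailBoundary.exists_factor {μ : ℕ → ProbabilityMeasure ℝ} (F : tailBoundary μ) :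
    ∃ (C : ℝ) (g : ℕ → ℝ × (ℕ → ℝ) → ℂ), (∀ n, Measurable (g n)) ∧ (∀ n z, ‖g n z‖ ≤ C) ∧
      ∀ n, (F : ℝ × (ℕ → ℝ) →ₘ[pathMeasure μ] ℂ) =ᵐ[pathMeasure μ] g n ∘ walk n := by
  have hF := F.2
  choose g hg hb hFg using hF
  obtain ⟨C, hC⟩ := hb 0
  have hC0 : 0 ≤ C := (norm_nonneg _).trans (hC (0, 0))
  refine ⟨C, fun n z => if ‖g n z‖ ≤ C then g n z else 0, fun n => ?_, fun n z => ?_, fun n => ?_⟩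
  · exact Measurable.ite (measurableSet_le (hg n).norm measurable_const) (hg n) measurable_const
  · beta_reduce
    split_ifs with h
    · exact h
    · simpa using hC0
  · filter_upwards [hFg n, hFg 0] with z h1 h2
    have : ‖g n (walk n z)‖ ≤ C := by
      rw [← Function.comp_apply (f := g n), ← h1, h2]
      exact hC _
    simp [h1, this]

/-- `F` is the limit almost everywhere of a bounded sequence of functions of `t + S n`. -/
def IsWalkLimit {Ω : Type*} [MeasurableSpace Ω] (P : Measure Ω) (S : ℕ → Ω → ℝ) (F : ℝ × Ω → ℂ) :
    Prop :=
  ∃ G : ℕ → ℝ → ℂ, (∀ n, Measurable (G n)) ∧ (∃ C : ℝ, ∀ n x, ‖G n x‖ ≤ C) ∧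
    ∀ᵐ z ∂((volume : Measure ℝ).prod P), Tendsto (fun n => G n (z.1 + S n z.2)) atTop (𝓝 (F z))

/-- The limit of `G` along the walk that starts at time `n`, cut off at the bound `C`. -/
noncomputable def walkLim (C : ℝ) (G : ℕ → ℝ → ℂ) (n : ℕ) (z : ℝ × (ℕ → ℝ)) : ℂ :=
  let l := limUnder atTop fun m => G (m + n) (z.1 + ∑ i ∈ Finset.range m, z.2 i)
  if ‖l‖ ≤ C then l else 0

theorem measurable_walkLim {C : ℝ} {G : ℕ → ℝ → ℂ} (hG : ∀ n, Measurable (G n)) (n : ℕ) :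
    Measurable (walkLim C G n) := by
  have : Measurable fun z : ℝ × (ℕ → ℝ) =>
      limUnder atTop fun m => G (m + n) (z.1 + ∑ i ∈ Finset.range m, z.2 i) := by
    refine (StronglyMeasurable.limUnder fun m => ((hG _).comp ?_).stronglyMeasurable).measurable
    fun_prop
  exact Measurable.ite (measurableSet_le this.norm measurable_const) this measurable_const

theorem norm_walkLim_le {C : ℝ} (hC : 0 ≤ C) (G : ℕ → ℝ → ℂ) (n : ℕ) (z : ℝ × (ℕ → ℝ)) :
    ‖walkLim C G n z‖ ≤ C := by
  unfold walkLim
  dsimp only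
  split_ifs with h
  · exact h
  · simpa using hC

/-- A limit ignores the first `n` terms, and position `m` of the walk restarted at time `n` is
position `m + n` of the original one. The identity holds at every point, which makes `walkLim C G 0`
a tail element for any `μ`. -/
theorem walkLim_walk (C : ℝ) (G : ℕ → ℝ → ℂ) (n : ℕ) (z : ℝ × (ℕ → ℝ)) :
    walkLim C G n (walk n z) = walkLim C G 0 z := by
  have : (limUnder atTop fun m => G (m + n)
      ((walk n z).1 + ∑ i ∈ Finset.range m, (walk n z).2 i))
      = limUnder atTop fun m => G (m + 0) (z.1 + ∑ i ∈ Finset.range m, z.2 i) := by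
    unfold limUnder
    congr 1
    conv_rhs => rw [← map_add_atTop_eq_nat n]
    rw [Filter.map_map]
    congr 1
    ext m
    simp only [walk, Function.comp_apply, add_zero]
    congr 1
    rw [add_comm m n, Finset.sum_range_add]
    ring
  unfold walkLim
  rw [this]

/-- `walkLim` is defined on the path space alone, so a limit observed on an auxiliary space `Ω`
descends to the tail boundary. A representative `f` is left free so that the class can be evaluated
along `X`. -/
theorem exists_tailBoundary_of_isWalkLimit {Ω : Type*} [MeasurableSpace Ω] {P : Measure Ω}
    [IsProbabilityMeasure P] {μ : ℕ → ProbabilityMeasure ℝ} {X : Ω → ℕ → ℝ} {F : ℝ × Ω → ℂ}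
    (hF : IsWalkLimit P (fun n y => ∑ i ∈ Finset.range n, X y i) F) :
    ∃ F' : tailBoundary μ, ∀ f : ℝ × (ℕ → ℝ) → ℂ, Measurable f →
      (F' : ℝ × (ℕ → ℝ) →ₘ[pathMeasure μ] ℂ) =ᵐ[pathMeasure μ] f →
      MeasurePreserving X P (Measure.infinitePi fun k => (μ k : Measure ℝ)) →
      ∀ᵐ z ∂((volume : Measure ℝ).prod P), F z = f (z.1, X z.2) := by
  obtain ⟨G, hG, ⟨C, hC⟩, hlim⟩ := hF
  have hC0 : 0 ≤ C := (norm_nonneg _).trans (hC 0 0)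
  refine ⟨⟨AEEqFun.mk (walkLim C G 0) (measurable_walkLim hG 0).aestronglyMeasurable, fun n =>
    ⟨walkLim C G n, measurable_walkLim hG n, ⟨C, norm_walkLim_le hC0 G n⟩, ?_⟩⟩, ?_⟩
  · filter_upwards [AEEqFun.coeFn_mk (walkLim C G 0)
      (measurable_walkLim hG 0).aestronglyMeasurable] with z hz
    rw [hz, Function.comp_apply, walkLim_walk]
  · intro f hf hFf hX
    have h1 : walkLim C G 0 =ᵐ[pathMeasure μ] f := (AEEqFun.coeFn_mk (walkLim C G 0)
      (measurable_walkLim hG 0).aestronglyMeasurable).symm.trans hFf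
    have hmp := measurePreserving_shear (measurable_const (a := (0 : ℝ))) hX
    filter_upwards [hlim, hmp.quasiMeasurePreserving.ae h1] with z hz h2
    simp only [add_zero] at h2
    rw [← h2]
    have h3 : limUnder atTop (fun m => G (m + 0) (z.1 + ∑ i ∈ Finset.range m, X z.2 i)) = F z :=
      Tendsto.limUnder_eq hz
    have h4 : ‖F z‖ ≤ C := le_of_tendsto hz.norm (Eventually.of_forall fun n => hC _ _)
    unfold walkLim
    simp only [h3, h4, if_true]

/-! ### A criterion for conjugacy of tail boundary flows -/

theorem tailAct_ae {μ : ℕ → ProbabilityMeasure ℝ} (t : ℝ) (F : tailBoundary μ) :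
    (tailAct μ t F : ℝ × (ℕ → ℝ) →ₘ[pathMeasure μ] ℂ) =ᵐ[pathMeasure μ]
      fun z => (F : ℝ × (ℕ → ℝ) →ₘ[pathMeasure μ] ℂ) (z.1 - t, z.2) := by
  filter_upwards [AEEqFun.coeFn_compQuasiMeasurePreserving
      (F : ℝ × (ℕ → ℝ) →ₘ[pathMeasure μ] ℂ)
      (translate_measurePreserving μ (-t)).quasiMeasurePreserving] with z hz
  exact hz

section Criterion

variable {Ω : Type*} [MeasurableSpace Ω] {P : Measure Ω} [IsProbabilityMeasure P]
  {μ ν : ℕ → ProbabilityMeasure ℝ} {X X' : Ω → ℕ → ℝ} {c c' : Ω → ℝ}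

theorem tailBoundary.ext_of_shear
    (hX : MeasurePreserving X P (Measure.infinitePi fun k => (μ k : Measure ℝ)))
    (hc : Measurable c) {F F' : tailBoundary μ}
    (h : ∀ᵐ z ∂((volume : Measure ℝ).prod P),
      (F : ℝ × (ℕ → ℝ) →ₘ[pathMeasure μ] ℂ) (z.1 + c z.2, X z.2) =
      (F' : ℝ × (ℕ → ℝ) →ₘ[pathMeasure μ] ℂ) (z.1 + c z.2, X z.2)) : F = F' := by
  have hmp : MeasurePreserving (fun z : ℝ × Ω => (z.1 + c z.2, X z.2)) _ (pathMeasure μ) :=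
    measurePreserving_shear hc hX
  have key : ∀ f f' : ℝ × (ℕ → ℝ) → ℂ, Measurable f → Measurable f' →
      (∀ᵐ z ∂((volume : Measure ℝ).prod P), f (z.1 + c z.2, X z.2) = f' (z.1 + c z.2, X z.2)) →
      f =ᵐ[pathMeasure μ] f' := fun f f' hf hf' h => by
    rw [← hmp.map_eq]
    exact (ae_map_iff hmp.measurable.aemeasurable (measurableSet_eq_fun hf hf')).2 h
  exact Subtype.ext (AEEqFun.ext (key _ _ (AEEqFun.stronglyMeasurable _).measurable
    (AEEqFun.stronglyMeasurable _).measurable h))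

/-- If two walks live on one space, differ by a time-independent shift `c`, and the elements of each
tail boundary are walk limits for the other walk, then the two tail boundary flows are conjugate. -/
theorem conjugate_of_isWalkLimit
    (hX : MeasurePreserving X P (Measure.infinitePi fun k => (μ k : Measure ℝ)))
    (hX' : MeasurePreserving X' P (Measure.infinitePi fun k => (ν k : Measure ℝ)))
    (hc : Measurable c)
    (h1 : ∀ F : tailBoundary μ, IsWalkLimit P (fun n y => ∑ i ∈ Finset.range n, X' y i)
      fun z => (F : ℝ × (ℕ → ℝ) →ₘ[pathMeasure μ] ℂ) (z.1 + c z.2, X z.2))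
    (h2 : ∀ F : tailBoundary ν, IsWalkLimit P (fun n y => ∑ i ∈ Finset.range n, X y i)
      fun z => (F : ℝ × (ℕ → ℝ) →ₘ[pathMeasure ν] ℂ) (z.1 - c z.2, X' z.2)) :
    Conjugate (tailAct μ) (tailAct ν) := by
  -- `R F F'` says that `F` and `F'` become the same function on the common space. It is total on
  -- both sides by the walk limits, single-valued on both sides by `tailBoundary.ext_of_shear`, and
  -- compatible with all operations, so it is the graph of the isomorphism.
  let R : tailBoundary μ → tailBoundary ν → Prop := fun F F' =>
    ∀ᵐ z ∂((volume : Measure ℝ).prod P),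
      (F : ℝ × (ℕ → ℝ) →ₘ[pathMeasure μ] ℂ) (z.1 + c z.2, X z.2) =
      (F' : ℝ × (ℕ → ℝ) →ₘ[pathMeasure ν] ℂ) (z.1, X' z.2)
  have hq1 := (measurePreserving_shear hc hX).quasiMeasurePreserving
  have hq2 := (measurePreserving_shear (measurable_const (a := (0 : ℝ))) hX').quasiMeasurePreserving
  simp only [add_zero] at hq2
  have ex1 : ∀ F, ∃ F', R F F' := fun F => by
    obtain ⟨F', hF'⟩ := exists_tailBoundary_of_isWalkLimit (μ := ν) (h1 F)
    exact ⟨F', hF' _ (AEEqFun.stronglyMeasurable _).measurable (ae_eq_refl _) hX'⟩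
  have ex2 : ∀ F', ∃ F, R F F' := fun F' => by
    obtain ⟨F, hF⟩ := exists_tailBoundary_of_isWalkLimit (μ := μ) (h2 F')
    have h := hF _ (AEEqFun.stronglyMeasurable _).measurable (ae_eq_refl _) hX
    refine ⟨F, ?_⟩
    -- The identity obtained at time `t` is wanted at time `t + c`, and this substitution preserves
    -- null sets.
    filter_upwards [(measurePreserving_shear hc (MeasurePreserving.id P)).quasiMeasurePreserving.ae h]
      with z hz
    simp only [id_eq, add_sub_cancel_right] at hz
    exact hz.symm
  have un1 : ∀ F F₁ F₂, R F F₁ → R F F₂ → F₁ = F₂ := fun F F₁ F₂ ha hb => by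
    refine tailBoundary.ext_of_shear hX' (measurable_const (a := (0 : ℝ))) ?_
    filter_upwards [ha, hb] with z hza hzb
    simp only [add_zero]
    rw [← hza, hzb]
  have un2 : ∀ F₁ F₂ F, R F₁ F → R F₂ F → F₁ = F₂ := fun F F₁ F₂ ha hb => by
    refine tailBoundary.ext_of_shear hX hc ?_
    filter_upwards [ha, hb] with z hza hzb
    rw [hza, hzb]
  have Radd : ∀ {a b a' b'}, R a a' → R b b' → R (a + b) (a' + b') := fun {a b a' b'} ha hb => by
    filter_upwards [ha, hb, hq1.ae (AEEqFun.coeFn_add (a : ℝ × (ℕ → ℝ) →ₘ[pathMeasure μ] ℂ) b),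
      hq2.ae (AEEqFun.coeFn_add (a' : ℝ × (ℕ → ℝ) →ₘ[pathMeasure ν] ℂ) b')] with z h1 h2 h3 h4
    refine h3.trans (Eq.trans ?_ h4.symm)
    simp [h1, h2]
  have Rmul : ∀ {a b a' b'}, R a a' → R b b' → R (a * b) (a' * b') := fun {a b a' b'} ha hb => by
    filter_upwards [ha, hb, hq1.ae (AEEqFun.coeFn_mul (a : ℝ × (ℕ → ℝ) →ₘ[pathMeasure μ] ℂ) b),
      hq2.ae (AEEqFun.coeFn_mul (a' : ℝ × (ℕ → ℝ) →ₘ[pathMeasure ν] ℂ) b')] with z h1 h2 h3 h4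
    refine h3.trans (Eq.trans ?_ h4.symm)
    simp [h1, h2]
  have Rsmul : ∀ {r : ℂ} {a a'}, R a a' → R (r • a) (r • a') := fun {r a a'} ha => by
    filter_upwards [ha, hq1.ae (AEEqFun.coeFn_smul r (a : ℝ × (ℕ → ℝ) →ₘ[pathMeasure μ] ℂ)),
      hq2.ae (AEEqFun.coeFn_smul r (a' : ℝ × (ℕ → ℝ) →ₘ[pathMeasure ν] ℂ))] with z h1 h3 h4
    refine h3.trans (Eq.trans ?_ h4.symm)
    simp [h1]
  have Rstar : ∀ {a a'}, R a a' → R (star a) (star a') := fun {a a'} ha => by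
    filter_upwards [ha, hq1.ae (AEEqFun.coeFn_star (a : ℝ × (ℕ → ℝ) →ₘ[pathMeasure μ] ℂ)),
      hq2.ae (AEEqFun.coeFn_star (a' : ℝ × (ℕ → ℝ) →ₘ[pathMeasure ν] ℂ))] with z h1 h3 h4
    refine h3.trans (Eq.trans ?_ h4.symm)
    simp [h1]
  have Ract : ∀ {t a a'}, R a a' → R (tailAct μ t a) (tailAct ν t a') := fun {t a a'} ha => by
    have hq3 := (measurePreserving_shear (measurable_const (a := -t))
      (MeasurePreserving.id P)).quasiMeasurePreserving
    filter_upwards [hq3.ae ha, hq1.ae (tailAct_ae t a), hq2.ae (tailAct_ae t a')] with z h1 h3 h4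
    rw [h3, h4]
    simp only [id_eq] at h1
    rw [← sub_eq_add_neg] at h1
    rw [← h1]
    congr 2
    ring
  choose φ hφ using ex1
  choose ψ hψ using ex2
  exact ⟨{ toFun := φ
           invFun := ψ
           left_inv := fun F => un2 _ _ _ (hψ _) (hφ F)
           right_inv := fun F => un1 _ _ _ (hφ _) (hψ F)
           map_mul' := fun a b => un1 _ _ _ (hφ _) (Rmul (hφ a) (hφ b))
           map_add' := fun a b => un1 _ _ _ (hφ _) (Radd (hφ a) (hφ b))
           map_star' := fun a => un1 _ _ _ (hφ _) (Rstar (hφ a))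
           map_smul' := fun r a => un1 _ _ _ (hφ _) (Rsmul (hφ a)) },
    fun t F => un1 _ _ _ (hφ _) (Ract (hφ F))⟩

end Criterion

theorem Conjugate.symm {A B : Type*} [Semiring A] [Algebra ℂ A] [Star A] [Semiring B]
    [Algebra ℂ B] [Star B] {a : ℝ → A → A} {b : ℝ → B → B} (h : Conjugate a b) :
    Conjugate b a := by
  obtain ⟨Φ, hΦ⟩ := h
  refine ⟨Φ.symm, fun t F => ?_⟩
  have := hΦ t (Φ.symm F)
  rw [StarAlgEquiv.apply_symm_apply] at this
  rw [← this, StarAlgEquiv.symm_apply_apply]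

theorem Conjugate.trans {A B C : Type*} [Semiring A] [Algebra ℂ A] [Star A] [Semiring B]
    [Algebra ℂ B] [Star B] [Semiring C] [Algebra ℂ C] [Star C] {a : ℝ → A → A} {b : ℝ → B → B}
    {d : ℝ → C → C} (h : Conjugate a b) (h' : Conjugate b d) : Conjugate a d := by
  obtain ⟨Φ, hΦ⟩ := h
  obtain ⟨Ψ, hΨ⟩ := h'
  exact ⟨Φ.trans Ψ, fun t F => by simp [hΦ, hΨ]⟩

end TailFlow

namespace TailFlow

/-! ### Past and future in a product space -/

section PastFuture

variable {ι Y : Type*} [Zero Y] (β : ι → ℕ)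

/-- The coordinates with `β i < n`; the others are set to `0`. -/
def past (n : ℕ) (y : ι → Y) (i : ι) : Y := if β i < n then y i else 0

/-- The coordinates with `n ≤ β i`; the others are set to `0`. -/
def future (n : ℕ) (y : ι → Y) (i : ι) : Y := if β i < n then 0 else y i

theorem past_past {m n : ℕ} (h : m ≤ n) (y : ι → Y) : past β m (past β n y) = past β m y := by
  ext i
  unfold past
  split_ifs with h1 h2
  · rfl
  · omega
  · rfl

variable [MeasurableSpace Y]

theorem measurable_past (n : ℕ) : Measurable (past β n : (ι → Y) → ι → Y) := by
  refine measurable_pi_lambda _ fun i => ?_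
  unfold past
  split_ifs <;> fun_prop

theorem measurable_future (n : ℕ) : Measurable (future β n : (ι → Y) → ι → Y) := by
  refine measurable_pi_lambda _ fun i => ?_
  unfold future
  split_ifs <;> fun_prop

theorem indepFun_past_future (γ : ι → Measure Y) [∀ i, IsProbabilityMeasure (γ i)] (n : ℕ) :
    IndepFun (past β n) (future β n) (Measure.infinitePi γ) := by
  have h : iIndepFun (fun i (y : ι → Y) => y i) (Measure.infinitePi γ) :=
    iIndepFun_infinitePi (X := fun _ y => y) fun _ => measurable_id
  have hd : Disjoint {i | β i < n} {i | n ≤ β i} :=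
    Set.disjoint_left.2 fun _ h1 h2 => (not_lt.2 h2 : ¬ _ < n) h1
  have key := indep_iSup_of_disjoint (fun i => (measurable_pi_apply i).comap_le) h.iIndep hd
  rw [IndepFun_iff_Indep]
  refine indep_of_indep_of_le_left (indep_of_indep_of_le_right key ?_) ?_
  · rw [← measurable_iff_comap_le]
    refine @measurable_pi_lambda _ _ _ (_) _ _ fun i => ?_
    unfold future
    split_ifs with hi
    · exact measurable_const
    · exact measurable_iff_comap_le.2
        (le_iSup₂_of_le (f := fun j _ => MeasurableSpace.comap (fun y : ι → Y => y j) inferInstance)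
          i (not_lt.1 hi) le_rfl)
  · rw [← measurable_iff_comap_le]
    refine @measurable_pi_lambda _ _ _ (_) _ _ fun i => ?_
    unfold past
    split_ifs with hi
    · exact measurable_iff_comap_le.2
        (le_iSup₂_of_le (f := fun j _ => MeasurableSpace.comap (fun y : ι → Y => y j) inferInstance)
          i hi le_rfl)
    · exact measurable_const

theorem monotone_comap_past :
    Monotone fun n => MeasurableSpace.comap (past β n : (ι → Y) → ι → Y) inferInstance := by
  intro m n h
  have : (past β m : (ι → Y) → ι → Y) = past β m ∘ past β n :=
    funext fun y => (past_past β h y).symm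
  change MeasurableSpace.comap (past β m) _ ≤ _
  rw [this, ← MeasurableSpace.comap_comp]
  exact MeasurableSpace.comap_mono (measurable_past β m).comap_le

theorem le_iSup_comap_past : (inferInstance : MeasurableSpace (ι → Y)) ≤
    ⨆ n, MeasurableSpace.comap (past β n : (ι → Y) → ι → Y) inferInstance := by
  refine iSup_le fun i => ?_
  refine le_trans ?_ (le_iSup _ (β i + 1))
  have : (fun y : ι → Y => y i) = (fun y => y i) ∘ past β (β i + 1) := by
    ext y
    simp [past]
  change MeasurableSpace.comap (fun y : ι → Y => y i) _ ≤ _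
  rw [this, ← MeasurableSpace.comap_comp]
  exact MeasurableSpace.comap_mono (measurable_pi_apply i).comap_le

/-- Here `β i` is the time at which coordinate `i` is revealed. The witness `G n` averages `g n`
over the future; independence of past and future makes this a conditional expectation. -/
theorem isWalkLimit_of_factor (γ : ι → Measure Y) [∀ i, IsProbabilityMeasure (γ i)]
    {s : ℕ → (ι → Y) → ℝ} (hs : ∀ n, Measurable (s n)) (hsp : ∀ n y, s n (past β n y) = s n y)
    {g : ℕ → ℝ × (ι → Y) → ℂ} (hg : ∀ n, Measurable (g n)) {C : ℝ} (hC : ∀ n z, ‖g n z‖ ≤ C)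
    {F : ℝ × (ι → Y) → ℂ} (hF : Measurable F)
    (hFg : ∀ n, ∀ᵐ z ∂((volume : Measure ℝ).prod (Measure.infinitePi γ)),
      F z = g n (z.1 + s n z.2, future β n z.2)) :
    IsWalkLimit (Measure.infinitePi γ) s F := by
  refine ⟨fun n x => ∫ y, g n (x, future β n y) ∂(Measure.infinitePi γ), fun n => ?_, ⟨C, fun n x => ?_⟩, ?_⟩
  · have : StronglyMeasurable (Function.uncurry fun (x : ℝ) y => g n (x, future β n y)) :=
      ((hg n).comp (measurable_fst.prodMk
        ((measurable_future β n).comp measurable_snd))).stronglyMeasurable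
    exact this.integral_prod_right.measurable
  · simpa using norm_integral_le_of_norm_le_const (μ := Measure.infinitePi γ)
      (ae_of_all _ fun y => hC n (x, future β n y))
  · have := ae_tendsto_integral_walk (P := Measure.infinitePi γ) (measurable_past β)
      (measurable_future β) (indepFun_past_future β γ) (monotone_comap_past β)
      (le_iSup_comap_past β) hs hg hC hF (fun n => by simpa only [hsp] using hFg n)
    simpa only [hsp] using this

end PastFuture

/-! ### Regrouping the steps -/

section Regroup

variable {ι : Type*} {β β' : ι → ℕ}

/-- Currying the product along the fibres of `β` makes the blocks independent. The law of each block
sum is recognised by its characteristic function, so that no order has to be chosen in a finite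
convolution. -/
theorem measurePreserving_blockSum (μ : ι → ProbabilityMeasure ℝ)
    (hβ : ∀ k, (β ⁻¹' {k}).Finite) {ν : ℕ → ProbabilityMeasure ℝ}
    (hν : ∀ k t, charFun (ν k : Measure ℝ) t =
      ∏ i ∈ (hβ k).toFinset, charFun (μ i : Measure ℝ) t) :
    MeasurePreserving (fun (y : ι → ℝ) k => ∑ i ∈ (hβ k).toFinset, y i)
      (Measure.infinitePi fun i => (μ i : Measure ℝ))
      (Measure.infinitePi fun k => (ν k : Measure ℝ)) := by
  refine ⟨by fun_prop, ?_⟩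
  have : ∀ k, Fintype {i // β i = k} := fun k => (hβ k).fintype
  have hsum : ∀ (k : ℕ) {M : Type} [AddCommMonoid M] (f : ι → M),
      ∑ i ∈ (hβ k).toFinset, f i = ∑ i : {i // β i = k}, f i := fun k M _ f =>
    Finset.sum_subtype _ (fun i => by simp) f
  have hprod : ∀ (k : ℕ) {M : Type} [CommMonoid M] (f : ι → M),
      ∏ i ∈ (hβ k).toFinset, f i = ∏ i : {i // β i = k}, f i := fun k M _ f =>
    Finset.prod_subtype _ (fun i => by simp) f
  have h1 := Measure.map_infinitePi_infinitePi_of_inj (P := fun i => (μ i : Measure ℝ))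
    (f := fun p : (k : ℕ) × {i // β i = k} => (p.2 : ι)) (Equiv.sigmaFiberEquiv β).injective
  have h2 := Measure.infinitePi_map_piCurry
    (fun (k : ℕ) (j : {i // β i = k}) => (μ j : Measure ℝ))
  have h3 := Measure.infinitePi_map_pi
    (fun k : ℕ => Measure.infinitePi fun j : {i // β i = k} => (μ j : Measure ℝ))
    (f := fun k u => ∑ j, u j) (fun k => by fun_prop)
  have h4 : ∀ k, (Measure.infinitePi fun j : {i // β i = k} => (μ j : Measure ℝ)).map
      (fun u => ∑ j, u j) = ν k := fun k => by
    have : IsProbabilityMeasure ((Measure.infinitePi fun j : {i // β i = k} =>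
      (μ j : Measure ℝ)).map (fun u => ∑ j, u j)) :=
        Measure.isProbabilityMeasure_map (by fun_prop)
    refine Measure.ext_of_charFun ?_
    ext t
    rw [Measure.infinitePi_eq_pi, charFun_map_sum_pi_eq_prod, hν, hprod]
    simp
  simp only [h4] at h3
  rw [← h3, ← h2, ← h1, Measure.map_map (by fun_prop) (by fun_prop),
    Measure.map_map (by fun_prop) (by fun_prop)]
  congr 1
  ext y k
  simp only [hsum, Function.comp_apply]
  rfl

theorem sum_blockSum (hβ : ∀ k, (β ⁻¹' {k}).Finite) (n : ℕ) :
    ∃ B : Finset ι, (∀ i, i ∈ B ↔ β i < n) ∧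
      ∀ y : ι → ℝ, ∑ k ∈ Finset.range n, ∑ i ∈ (hβ k).toFinset, y i = ∑ i ∈ B, y i := by
  classical
  refine ⟨(Finset.range n).biUnion fun k => (hβ k).toFinset, fun i => by simp, fun y => ?_⟩
  rw [Finset.sum_biUnion]
  intro k _ l _ hkl
  rw [Function.onFun, Finset.disjoint_left]
  intro i hi hi'
  simp only [Set.Finite.mem_toFinset, Set.mem_preimage, Set.mem_singleton_iff] at hi hi'
  exact hkl (hi ▸ hi')

/-- If every coordinate revealed before `n` for `β'` is revealed before `m` for `β`, then the
position at time `m` of the `β`-walk is the position at time `n` of the `β'`-walk plus steps in the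
`β'`-future. So the factorisation of `F` at level `m` is one at level `n` for the other arrangement.
-/
theorem isWalkLimit_regroup (μ : ι → ProbabilityMeasure ℝ)
    (hβ : ∀ k, (β ⁻¹' {k}).Finite) (hβ' : ∀ k, (β' ⁻¹' {k}).Finite)
    {ν : ℕ → ProbabilityMeasure ℝ}
    (hν : ∀ k t, charFun (ν k : Measure ℝ) t =
      ∏ i ∈ (hβ k).toFinset, charFun (μ i : Measure ℝ) t) (F : tailBoundary ν) :
    IsWalkLimit (Measure.infinitePi fun i => (μ i : Measure ℝ))
      (fun n y => ∑ k ∈ Finset.range n, ∑ i ∈ (hβ' k).toFinset, y i)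
      (fun z => (F : ℝ × (ℕ → ℝ) →ₘ[pathMeasure ν] ℂ)
        (z.1, fun k => ∑ i ∈ (hβ k).toFinset, z.2 i)) := by
  obtain ⟨C, g, hg, hC, hFg⟩ := tailBoundary.exists_factor F
  -- Finiteness of the blocks of `β'` enters here: only finitely many `i` have `β' i < n`.
  have hm : ∀ n, ∃ m, ∀ i, β' i < n → β i < m := fun n => by
    obtain ⟨B, hB, -⟩ := sum_blockSum hβ' n
    obtain ⟨m, hm⟩ := (B.image β).exists_nat_subset_range
    exact ⟨m, fun i hi => Finset.mem_range.1 (hm (Finset.mem_image_of_mem β ((hB i).2 hi)))⟩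
  choose m hm using hm
  have hmp := measurePreserving_blockSum μ hβ hν
  refine isWalkLimit_of_factor β' _ (fun n => by fun_prop) ?_
    (g := fun n z => g (m n) (z.1 + ∑ k ∈ Finset.range (m n), ∑ i ∈ (hβ k).toFinset, z.2 i,
      fun k => ∑ i ∈ (hβ (m n + k)).toFinset, z.2 i)) (fun n => (hg _).comp (by fun_prop))
    (fun n z => hC _ _) ?_ ?_
  · intro n y
    obtain ⟨B, hB, hBs⟩ := sum_blockSum hβ' n
    rw [hBs, hBs]
    exact Finset.sum_congr rfl fun i hi => if_pos ((hB i).1 hi)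
  · exact (AEEqFun.stronglyMeasurable _).measurable.comp (by fun_prop)
  · intro n
    have hq := (measurePreserving_shear (measurable_const (a := (0 : ℝ))) hmp).quasiMeasurePreserving
    filter_upwards [hq.ae (hFg (m n))] with z hz
    simp only [add_zero] at hz
    rw [hz]
    simp only [Function.comp_apply, walk]
    congr 2
    · rw [add_assoc]
      congr 1
      obtain ⟨B, hB, hBs⟩ := sum_blockSum hβ' n
      obtain ⟨B', hB', hBs'⟩ := sum_blockSum hβ (m n)
      rw [hBs, hBs', hBs']
      have hsub : B ⊆ B' := fun i hi => (hB' i).2 (hm n i ((hB i).1 hi))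
      classical
      have e1 : ∑ i ∈ B, z.2 i = ∑ i ∈ B', past β' n z.2 i := by
        rw [← Finset.sum_subset hsub]
        · exact Finset.sum_congr rfl fun i hi => (if_pos ((hB i).1 hi)).symm
        · exact fun i _ hi => if_neg fun h => hi ((hB i).2 h)
      rw [e1, ← Finset.sum_add_distrib]
      refine Finset.sum_congr rfl fun i _ => ?_
      unfold past future
      split_ifs <;> simp
    · ext k
      refine Finset.sum_congr rfl fun i hi => ?_
      unfold future
      rw [if_neg]
      intro h
      have h1 := hm n i h
      simp only [Set.Finite.mem_toFinset, Set.mem_preimage, Set.mem_singleton_iff] at hi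
      omega

/-- The tail boundary flow of a countable family of independent steps does not depend on the order
of the steps, nor on their arrangement in finite blocks. -/
theorem conjugate_of_regroup (μ : ι → ProbabilityMeasure ℝ)
    (hβ : ∀ k, (β ⁻¹' {k}).Finite) (hβ' : ∀ k, (β' ⁻¹' {k}).Finite)
    {ν ν' : ℕ → ProbabilityMeasure ℝ}
    (hν : ∀ k t, charFun (ν k : Measure ℝ) t =
      ∏ i ∈ (hβ k).toFinset, charFun (μ i : Measure ℝ) t)
    (hν' : ∀ k t, charFun (ν' k : Measure ℝ) t =
      ∏ i ∈ (hβ' k).toFinset, charFun (μ i : Measure ℝ) t) :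
    Conjugate (tailAct ν) (tailAct ν') := by
  refine conjugate_of_isWalkLimit (c := fun _ => 0) (measurePreserving_blockSum μ hβ hν)
    (measurePreserving_blockSum μ hβ' hν') measurable_const (fun F => ?_) (fun F => ?_)
  · simpa only [add_zero] using isWalkLimit_regroup μ hβ hβ' hν F
  · simpa only [sub_zero] using isWalkLimit_regroup μ hβ' hβ hν' F

end Regroup

/-! ### Coupling the steps -/

/-- `e` is a period of the tail boundary if the translation by `e` acts trivially. -/
def IsPeriod (μ : ℕ → ProbabilityMeasure ℝ) (e : ℝ) : Prop :=
  ∀ F : tailBoundary μ, tailAct μ e F = F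

section Coupling

variable {Y : Type*} [MeasurableSpace Y] [Zero Y] {γ : ℕ → Measure Y}
  [∀ k, IsProbabilityMeasure (γ k)] {ξ ξ' ζ : ℕ → Y → ℝ} {a : ℕ → ℝ} {H : AddSubgroup ℝ}
  {μ : ℕ → ProbabilityMeasure ℝ} {c : (ℕ → Y) → ℝ}

/-- With `c` the sum of the `ζ`-series, t + c + Σ ξ over the first `n` steps equals t + Σ ξ' - Σ a +
(tail of the `ζ`-series), up to an element of `H`. The constants can be absorbed in a function
depending on `n`, the tail belongs to the future, and the element of `H` is invisible to `F`. -/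
theorem isWalkLimit_coupling (hξ : ∀ k, Measurable (ξ k)) (hξ' : ∀ k, Measurable (ξ' k))
    (hζ : ∀ k, Measurable (ζ k)) (hH : (H : Set ℝ).Countable)
    (hγ : ∀ k, ∀ᵐ y ∂(γ k), ξ' k y - ξ k y - a k - ζ k y ∈ H) (hc : Measurable c)
    (hlim : ∀ᵐ y ∂(Measure.infinitePi γ),
      Tendsto (fun n => ∑ i ∈ Finset.range n, ζ i (y i)) atTop (𝓝 (c y)))
    (hμ : ∀ k, (γ k).map (ξ k) = μ k) (hper : ∀ h ∈ H, IsPeriod μ h) (F : tailBoundary μ) :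
    IsWalkLimit (Measure.infinitePi γ) (fun n y => ∑ i ∈ Finset.range n, ξ' i (y i))
      (fun z => (F : ℝ × (ℕ → ℝ) →ₘ[pathMeasure μ] ℂ) (z.1 + c z.2, fun k => ξ k (z.2 k))) := by
  obtain ⟨C, g, hg, hC, hFg⟩ := tailBoundary.exists_factor F
  have hX : MeasurePreserving (fun (y : ℕ → Y) k => ξ k (y k)) (Measure.infinitePi γ)
      (Measure.infinitePi fun k => (μ k : Measure ℝ)) :=
    ⟨by fun_prop, by rw [Measure.infinitePi_map_pi γ hξ]; simp only [hμ]⟩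
  -- The tail of the series is defined by a limit of its own, not as `c` minus a partial sum, so
  -- that it visibly depends on the future coordinates only.
  let τ : ℕ → (ℕ → Y) → ℝ := fun n w =>
    limUnder atTop fun m => ∑ i ∈ Finset.range m, ζ (i + n) (w (i + n))
  have hτ : ∀ n, Measurable (τ n) := fun n =>
    (StronglyMeasurable.limUnder fun m => by
      refine Measurable.stronglyMeasurable ?_
      fun_prop).measurable
  have hτf : ∀ n w, τ n (future (fun k => k) n w) = τ n w := fun n w => by
    unfold τ
    congr 1
    ext m
    refine Finset.sum_congr rfl fun i _ => ?_
    simp [future]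
  have hcτ : ∀ n, ∀ᵐ y ∂(Measure.infinitePi γ),
      c y = ∑ i ∈ Finset.range n, ζ i (y i) + τ n y := fun n => by
    filter_upwards [hlim] with y hy
    have h1 := ((tendsto_add_atTop_iff_nat n).2 hy).sub_const (∑ i ∈ Finset.range n, ζ i (y i))
    have h2 : τ n y = c y - ∑ i ∈ Finset.range n, ζ i (y i) := by
      refine Tendsto.limUnder_eq (h1.congr fun m => ?_)
      rw [add_comm m n, Finset.sum_range_add]
      simp [add_comm]
    rw [h2]
    ring
  have hin : ∀ᵐ y ∂(Measure.infinitePi γ), ∀ k, ξ' k (y k) - ξ k (y k) - a k - ζ k (y k) ∈ H := by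
    rw [ae_all_iff]
    exact fun k => (measurePreserving_eval_infinitePi γ k).quasiMeasurePreserving.ae (hγ k)
  refine isWalkLimit_of_factor (fun k => k) γ (fun n => by fun_prop) ?_
    (g := fun n z => g n (z.1 - ∑ i ∈ Finset.range n, a i + τ n z.2, fun k => ξ (n + k) (z.2 (n + k))))
    (fun n => (hg _).comp ?_) (fun n z => hC _ _) ?_ ?_
  · intro n y
    refine Finset.sum_congr rfl fun i hi => ?_
    rw [past, if_pos (Finset.mem_range.1 hi)]
  · have := hτ n
    fun_prop
  · exact (AEEqFun.stronglyMeasurable _).measurable.comp (by fun_prop)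
  · intro n
    have hq := (measurePreserving_shear hc hX).quasiMeasurePreserving
    have hτn := hτ n
    have hq' := (measurePreserving_shear (τ := fun y => ∑ i ∈ Finset.range n, ξ' i (y i) -
      ∑ i ∈ Finset.range n, a i + τ n y - ∑ i ∈ Finset.range n, ξ i (y i)) (by fun_prop)
      hX).quasiMeasurePreserving
    have hcnt : Countable H := hH
    -- The shift by an element of `H` will be random, so one null set must serve all `h`. This is
    -- why `H` has to be countable.
    have hg' : ∀ᵐ z ∂(pathMeasure μ), ∀ h : H, g n (walk n (z.1 - h, z.2)) = g n (walk n z) := by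
      rw [ae_all_iff]
      intro h
      have h1 := tailAct_ae (h : ℝ) F
      rw [hper h h.2] at h1
      have hqt := (translate_measurePreserving μ (-(h : ℝ))).quasiMeasurePreserving
      filter_upwards [h1, hqt.ae (hFg n), hFg n] with z e1 e2 e3
      simp only [Function.comp_apply] at e2 e3
      rw [← e3, e1]
      exact e2.symm
    filter_upwards [hq.ae (hFg n), hq'.ae hg', Measure.quasiMeasurePreserving_snd.ae (hcτ n),
      Measure.quasiMeasurePreserving_snd.ae hin] with z e1 e2 e3 e4
    rw [e1]
    have hh : ∑ i ∈ Finset.range n, (ξ' i (z.2 i) - ξ i (z.2 i) - a i - ζ i (z.2 i)) ∈ H :=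
      AddSubgroup.sum_mem _ fun i _ => e4 i
    have e5 := e2 ⟨_, hh⟩
    simp only [Finset.sum_sub_distrib] at e5
    simp only [Function.comp_apply]
    convert e5 using 2
    · simp only [walk, Prod.mk.injEq, and_true]
      rw [e3]
      ring
    · simp only [walk, hτf, Prod.mk.injEq]
      refine ⟨by ring, ?_⟩
      ext k
      simp [future]

/-- Tail boundary flows are conjugate when their steps can be coupled so that the differences of the
steps, after subtraction of constants and modulo common periods, form a convergent series. -/
theorem conjugate_of_coupling {ν : ℕ → ProbabilityMeasure ℝ} (hξ : ∀ k, Measurable (ξ k))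
    (hξ' : ∀ k, Measurable (ξ' k)) (hζ : ∀ k, Measurable (ζ k)) (hH : (H : Set ℝ).Countable)
    (hγ : ∀ k, ∀ᵐ y ∂(γ k), ξ' k y - ξ k y - a k - ζ k y ∈ H)
    (hlim : ∀ᵐ y ∂(Measure.infinitePi γ),
      ∃ l, Tendsto (fun n => ∑ i ∈ Finset.range n, ζ i (y i)) atTop (𝓝 l))
    (hμ : ∀ k, (γ k).map (ξ k) = μ k) (hν : ∀ k, (γ k).map (ξ' k) = ν k)
    (hperμ : ∀ h ∈ H, IsPeriod μ h) (hperν : ∀ h ∈ H, IsPeriod ν h) :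
    Conjugate (tailAct μ) (tailAct ν) := by
  let c : (ℕ → Y) → ℝ := fun y => limUnder atTop fun n => ∑ i ∈ Finset.range n, ζ i (y i)
  have hc : Measurable c := (StronglyMeasurable.limUnder fun m => by
      refine Measurable.stronglyMeasurable ?_
      fun_prop).measurable
  have hlim' : ∀ᵐ y ∂(Measure.infinitePi γ),
      Tendsto (fun n => ∑ i ∈ Finset.range n, ζ i (y i)) atTop (𝓝 (c y)) := by
    filter_upwards [hlim] with y hy
    exact tendsto_nhds_limUnder hy
  have hX : MeasurePreserving (fun (y : ℕ → Y) k => ξ k (y k)) (Measure.infinitePi γ)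
      (Measure.infinitePi fun k => (μ k : Measure ℝ)) :=
    ⟨by fun_prop, by rw [Measure.infinitePi_map_pi γ hξ]; simp only [hμ]⟩
  have hX' : MeasurePreserving (fun (y : ℕ → Y) k => ξ' k (y k)) (Measure.infinitePi γ)
      (Measure.infinitePi fun k => (ν k : Measure ℝ)) :=
    ⟨by fun_prop, by rw [Measure.infinitePi_map_pi γ hξ']; simp only [hν]⟩
  refine conjugate_of_isWalkLimit hX hX' hc (fun F => ?_) (fun F => ?_)
  · exact isWalkLimit_coupling hξ hξ' hζ hH hγ hc hlim' hμ hperμ F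
  -- The hypotheses are symmetric: exchanging the walks changes the signs of `ζ`, `a` and `c`.
  · have h := isWalkLimit_coupling (ξ := ξ') (ξ' := ξ) (ζ := fun k y => -ζ k y)
      (a := fun k => -a k) (c := fun y => -c y) hξ' hξ (fun k => (hζ k).neg) hH
      (fun k => (hγ k).mono fun y hy => by
        have := H.neg_mem hy
        convert this using 1
        ring) hc.neg
      (by
        filter_upwards [hlim'] with y hy
        simpa [Finset.sum_neg_distrib] using hy.neg) hν hperν F
    simpa only [sub_eq_add_neg] using h

end Coupling

end TailFlow

namespace TailFlow

/-! ### Random series -/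

section Series

variable {Y : Type*} [MeasurableSpace Y] {γ : ℕ → Measure Y}
  [∀ k, IsProbabilityMeasure (γ k)] {ζ : ℕ → Y → ℝ}

/-- The expected sum of the truncated terms is finite, so almost surely this sum is finite. Then
only finitely many terms are really truncated, and the series converges absolutely. -/
theorem ae_exists_tendsto_sum_of_min (hζ : ∀ k, Measurable (ζ k))
    (hs : ∑' k, ∫⁻ y, ENNReal.ofReal (min 1 |ζ k y|) ∂(γ k) ≠ ⊤) :
    ∀ᵐ y ∂(Measure.infinitePi γ),
      ∃ l, Tendsto (fun n => ∑ i ∈ Finset.range n, ζ i (y i)) atTop (𝓝 l) := by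
  have hmp : ∀ i, MeasurePreserving (fun y : ℕ → Y => y i) (Measure.infinitePi γ) (γ i) :=
    measurePreserving_eval_infinitePi γ
  have hm : ∀ k, Measurable fun y : Y => ENNReal.ofReal (min 1 |ζ k y|) := fun k =>
    (measurable_const.min (measurable_abs.comp (hζ k))).ennreal_ofReal
  have h1 : ∀ k, ∫⁻ y, ENNReal.ofReal (min 1 |ζ k (y k)|) ∂(Measure.infinitePi γ) =
      ∫⁻ y, ENNReal.ofReal (min 1 |ζ k y|) ∂(γ k) := fun k => (hmp k).lintegral_comp (hm k)
  simp only [← h1] at hs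
  have hmk : ∀ k, Measurable fun y : ℕ → Y => ENNReal.ofReal (min 1 |ζ k (y k)|) := fun k =>
    (hm k).comp (measurable_pi_apply k)
  rw [← lintegral_tsum fun k => (hmk k).aemeasurable] at hs
  have h2 := ae_lt_top (Measurable.tsum hmk) hs
  filter_upwards [h2] with y hy
  have h3 : Summable fun k => min 1 |ζ k (y k)| := by
    have := ENNReal.summable_toReal hy.ne
    refine this.congr fun k => ENNReal.toReal_ofReal ?_
    exact le_min zero_le_one (abs_nonneg _)
  have h4 : Summable fun k => |ζ k (y k)| := by
    refine h3.congr_cofinite ?_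
    have := h3.tendsto_cofinite_zero.eventually (gt_mem_nhds zero_lt_one)
    filter_upwards [this] with k hk
    rcases min_lt_iff.1 hk with h | h
    · exact absurd h (lt_irrefl _)
    · exact min_eq_right h.le
  exact ⟨_, (Summable.of_abs h4).hasSum.tendsto_sum_nat⟩

variable [Zero Y]

/-- The partial sums are a martingale whose second moments are bounded by the sum of the variances,
hence bounded in L¹ because |x| ≤ 1 + x². Martingale convergence applies. -/
theorem ae_exists_tendsto_sum_of_sq (hζ : ∀ k, Measurable (ζ k)) (hL2 : ∀ k, MemLp (ζ k) 2 (γ k))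
    (h0 : ∀ k, ∫ y, ζ k y ∂(γ k) = 0) (hs : Summable fun k => ∫ y, ζ k y ^ 2 ∂(γ k)) :
    ∀ᵐ y ∂(Measure.infinitePi γ),
      ∃ l, Tendsto (fun n => ∑ i ∈ Finset.range n, ζ i (y i)) atTop (𝓝 l) := by
  let P := Measure.infinitePi γ
  let ℱ : Filtration ℕ (inferInstance : MeasurableSpace (ℕ → Y)) :=
    ⟨fun n => MeasurableSpace.comap (past (fun k => k) n) inferInstance,
      monotone_comap_past (fun k => k), fun n => (measurable_past (fun k => k) n).comap_le⟩
  have hmp : ∀ i, MeasurePreserving (fun y : ℕ → Y => y i) P (γ i) :=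
    measurePreserving_eval_infinitePi γ
  have hL : ∀ i, MemLp (fun y : ℕ → Y => ζ i (y i)) 2 P := fun i =>
    (hL2 i).comp_measurePreserving (hmp i)
  have hint0 : ∀ i, ∫ y, ζ i (y i) ∂P = 0 := fun i => by
    rw [← h0 i, ← (hmp i).map_eq, integral_map (hmp i).measurable.aemeasurable
      (hζ i).aestronglyMeasurable]
  have hint2 : ∀ i, ∫ y, ζ i (y i) ^ 2 ∂P = ∫ y, ζ i y ^ 2 ∂(γ i) := fun i => by
    rw [← (hmp i).map_eq, integral_map (hmp i).measurable.aemeasurable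
      ((hζ i).pow_const 2).aestronglyMeasurable]
  let M : ℕ → (ℕ → Y) → ℝ := fun n y => ∑ i ∈ Finset.range n, ζ i (y i)
  have hML : ∀ n, MemLp (M n) 2 P := fun n => memLp_finsetSum _ fun i _ => hL i
  have hMi : ∀ n, Integrable (M n) P := fun n => (hML n).integrable (by norm_num)
  have hmart : Martingale M ℱ P := by
    refine martingale_of_condExp_sub_eq_zero_nat (fun n => ?_) hMi fun n => ?_
    · have : M n = M n ∘ past (fun k => k) n := by
        ext y
        refine Finset.sum_congr rfl fun i hi => ?_
        rw [past, if_pos (Finset.mem_range.1 hi)]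
      rw [this]
      refine Measurable.stronglyMeasurable ?_
      exact Measurable.comp (by fun_prop) (comap_measurable _)
    · have h1 : M (n + 1) - M n = fun y => ζ n (y n) := by
        ext y
        simp [M, Finset.sum_range_succ]
      rw [h1]
      have h2 := condExp_indep_eq (μ := P) (f := fun y : ℕ → Y => ζ n (y n))
        (m₁ := MeasurableSpace.comap (future (fun k => k) n) inferInstance)
        (measurable_future (fun k => k) n).comap_le (ℱ.le n) (by
          have : (fun y : ℕ → Y => ζ n (y n)) = (fun y => ζ n (y n)) ∘ future (fun k => k) n := by
            ext y
            simp [future]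
          rw [this]
          refine Measurable.stronglyMeasurable ?_
          exact Measurable.comp (by fun_prop) (comap_measurable _))
        ((IndepFun_iff_Indep _ _ _).1 (indepFun_past_future (fun k => k) γ n)).symm
      filter_upwards [h2] with y hy
      rw [hy, hint0]
      rfl
  have hvar : ∀ n, ∫ y, M n y ^ 2 ∂P ≤ ∑' k, ∫ y, ζ k y ^ 2 ∂(γ k) := fun n => by
    have hind : iIndepFun (fun i (y : ℕ → Y) => ζ i (y i)) P := iIndepFun_infinitePi hζ
    have h1 := IndepFun.variance_sum (X := fun i (y : ℕ → Y) => ζ i (y i)) (s := Finset.range n)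
      (fun i _ => hL i) (fun i _ j _ hij => hind.indepFun hij)
    have h2 : (∑ i ∈ Finset.range n, fun y : ℕ → Y => ζ i (y i)) = M n := by
      ext y
      simp [M]
    have h3 : ∫ y, M n y ∂P = 0 := by
      unfold M
      rw [integral_finsetSum _ fun i _ => (hL i).integrable (by norm_num)]
      simp [hint0]
    rw [h2, variance_of_integral_eq_zero (hML n).aemeasurable h3] at h1
    rw [h1]
    refine le_trans (le_of_eq (Finset.sum_congr rfl fun i _ => ?_))
      (hs.sum_le_tsum (Finset.range n) fun i _ => integral_nonneg fun y => sq_nonneg _)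
    rw [variance_of_integral_eq_zero (hL i).aemeasurable (hint0 i), hint2]
  have hbdd : ∀ n, eLpNorm (M n) 1 P ≤
      ((1 + ∑' k, ∫ y, ζ k y ^ 2 ∂(γ k)).toNNReal : ENNReal) := fun n => by
    rw [eLpNorm_one_eq_lintegral_enorm, ← ofReal_integral_norm_eq_lintegral_enorm (hMi n)]
    refine ENNReal.ofReal_le_ofReal ?_
    have h1 : ∫ y, ‖M n y‖ ∂P ≤ ∫ y, (1 + M n y ^ 2) ∂P := by
      refine integral_mono (hMi n).norm ((integrable_const 1).add (hML n).integrable_sq) fun y => ?_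
      rw [Real.norm_eq_abs, ← sq_abs]
      nlinarith [sq_nonneg (|M n y| - 1), abs_nonneg (M n y)]
    rw [integral_add (integrable_const 1) (hML n).integrable_sq] at h1
    simp only [integral_const, probReal_univ, smul_eq_mul, mul_one] at h1
    linarith [hvar n]
  filter_upwards [hmart.submartingale.ae_tendsto_limitProcess hbdd] with y hy
  exact ⟨_, hy⟩

end Series

/-! ### Conjugacy from couplings -/

theorem isPeriod_zero (μ : ℕ → ProbabilityMeasure ℝ) : IsPeriod μ 0 := fun F => by
  apply Subtype.ext
  apply AEEqFun.ext
  filter_upwards [tailAct_ae 0 F] with z hz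
  rw [hz]
  simp

/-- The cost `∫ min(1, |y - x|)` of a coupling, or of a part of a coupling. -/
noncomputable def couplingCost (π : Measure (ℝ × ℝ)) : ENNReal :=
  ∫⁻ y, ENNReal.ofReal (min 1 |y.2 - y.1|) ∂π

theorem couplingCost_le (π : Measure (ℝ × ℝ)) : couplingCost π ≤ π Set.univ := by
  rw [← lintegral_one]
  refine lintegral_mono fun y => ?_
  rw [← ENNReal.ofReal_one]
  exact ENNReal.ofReal_le_ofReal (min_le_left _ _)

/-- A partial coupling is completed by a multiple of the product of the leftover marginals. The cost
is at most 1 per unit of mass, so the completion costs at most the missing mass. -/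
theorem exists_coupling_of_le {μ ν : Measure ℝ} [IsProbabilityMeasure μ] [IsProbabilityMeasure ν]
    {π : Measure (ℝ × ℝ)} (h1 : π.map Prod.fst ≤ μ) (h2 : π.map Prod.snd ≤ ν) :
    ∃ γ : Measure (ℝ × ℝ), γ.map Prod.fst = μ ∧ γ.map Prod.snd = ν ∧
      couplingCost γ ≤ couplingCost π + (1 - π Set.univ) := by
  have m1 : π.map Prod.fst Set.univ = π Set.univ := by
    rw [Measure.map_apply measurable_fst .univ, Set.preimage_univ]
  have m2 : π.map Prod.snd Set.univ = π Set.univ := by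
    rw [Measure.map_apply measurable_snd .univ, Set.preimage_univ]
  have hπ : π Set.univ ≤ 1 := by
    rw [← m1, ← measure_univ (μ := μ)]
    exact h1 _
  have : IsFiniteMeasure π := ⟨hπ.trans_lt ENNReal.one_lt_top⟩
  have e1 : μ - π.map Prod.fst + π.map Prod.fst = μ := Measure.sub_add_cancel_of_le h1
  have e2 : ν - π.map Prod.snd + π.map Prod.snd = ν := Measure.sub_add_cancel_of_le h2
  set μ' := μ - π.map Prod.fst
  set ν' := ν - π.map Prod.snd
  have n1 : μ' Set.univ = 1 - π Set.univ := by
    have := congrArg (fun m : Measure ℝ => m Set.univ) e1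
    simp only [Measure.add_apply, m1, measure_univ] at this
    exact ENNReal.eq_sub_of_add_eq (measure_ne_top _ _) this
  have n2 : ν' Set.univ = 1 - π Set.univ := by
    have := congrArg (fun m : Measure ℝ => m Set.univ) e2
    simp only [Measure.add_apply, m2, measure_univ] at this
    exact ENNReal.eq_sub_of_add_eq (measure_ne_top _ _) this
  have : IsFiniteMeasure μ' := ⟨by rw [n1]; exact tsub_le_self.trans_lt ENNReal.one_lt_top⟩
  have : IsFiniteMeasure ν' := ⟨by rw [n2]; exact tsub_le_self.trans_lt ENNReal.one_lt_top⟩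
  set r := 1 - π Set.univ
  have hrt : r ≠ ⊤ := (tsub_le_self.trans_lt ENNReal.one_lt_top).ne
  -- The product of the leftovers has mass `r ^ 2` and must be divided by `r`.
  rcases eq_or_ne r 0 with hr | hr
  · rw [hr, Measure.measure_univ_eq_zero] at n1 n2
    rw [n1, zero_add] at e1
    rw [n2, zero_add] at e2
    exact ⟨π, e1, e2, le_self_add⟩
  · refine ⟨π + r⁻¹ • μ'.prod ν', ?_, ?_, ?_⟩
    · rw [Measure.map_add _ _ measurable_fst, Measure.map_smul, Measure.map_fst_prod, n2, smul_smul,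
        ENNReal.inv_mul_cancel hr hrt, one_smul, add_comm, e1]
    · rw [Measure.map_add _ _ measurable_snd, Measure.map_smul, Measure.map_snd_prod, n1, smul_smul,
        ENNReal.inv_mul_cancel hr hrt, one_smul, add_comm, e2]
    · have : couplingCost (π + r⁻¹ • μ'.prod ν') =
          couplingCost π + couplingCost (r⁻¹ • μ'.prod ν') := lintegral_add_measure _ _ _
      rw [this]
      refine add_le_add le_rfl ((couplingCost_le _).trans (le_of_eq ?_))
      rw [Measure.smul_apply, ← Set.univ_prod_univ, Measure.prod_prod, n1, n2, smul_eq_mul,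
        ← mul_assoc, ENNReal.inv_mul_cancel hr hrt, one_mul]

theorem conjugate_of_couplingCost {μ ν : ℕ → ProbabilityMeasure ℝ} {ε : ℕ → ENNReal}
    (h : ∀ k, ∃ γ : Measure (ℝ × ℝ), γ.map Prod.fst = μ k ∧ γ.map Prod.snd = ν k ∧
      couplingCost γ ≤ ε k) (hε : ∑' k, ε k ≠ ⊤) : Conjugate (tailAct μ) (tailAct ν) := by
  choose γ h1 h2 h3 using h
  have : ∀ k, IsProbabilityMeasure (γ k) := fun k => ⟨by
    have := congrArg (fun m : Measure ℝ => m Set.univ) (h1 k)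
    simpa [Measure.map_apply measurable_fst] using this⟩
  refine conjugate_of_coupling (Y := ℝ × ℝ) (γ := γ) (ξ := fun _ y => y.1) (ξ' := fun _ y => y.2)
    (ζ := fun _ y => y.2 - y.1) (a := fun _ => 0) (H := ⊥) ?_ ?_ ?_ ?_ ?_ ?_ h1 h2 ?_ ?_
  · exact fun _ => measurable_fst
  · exact fun _ => measurable_snd
  · exact fun _ => by fun_prop
  · simp
  · exact fun k => by simp
  · refine ae_exists_tendsto_sum_of_min (γ := γ) (ζ := fun _ y => y.2 - y.1)
      (fun _ => by fun_prop) ?_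
    exact ne_top_of_le_ne_top hε (ENNReal.tsum_le_tsum h3)
  · rintro h hh
    rw [AddSubgroup.mem_bot.1 hh]
    exact isPeriod_zero μ
  · rintro h hh
    rw [AddSubgroup.mem_bot.1 hh]
    exact isPeriod_zero ν

/-- Modulo the common periods `H` both walks stand still, so any coupling works, for instance the
independent one with `ζ = 0`. -/
theorem conjugate_of_forall_mem {μ ν : ℕ → ProbabilityMeasure ℝ} {H : AddSubgroup ℝ}
    (hH : (H : Set ℝ).Countable) (hμ : ∀ k, ∀ᵐ x ∂(μ k : Measure ℝ), x ∈ H)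
    (hν : ∀ k, ∀ᵐ x ∂(ν k : Measure ℝ), x ∈ H) (hperμ : ∀ h ∈ H, IsPeriod μ h)
    (hperν : ∀ h ∈ H, IsPeriod ν h) : Conjugate (tailAct μ) (tailAct ν) := by
  refine conjugate_of_coupling (γ := fun k => (μ k : Measure ℝ).prod (ν k : Measure ℝ))
    (ξ := fun _ => Prod.fst) (ξ' := fun _ => Prod.snd)
    (ζ := fun _ _ => 0) (a := fun _ => 0) (H := H) (fun _ => measurable_fst)
    (fun _ => measurable_snd) (fun _ => by fun_prop) hH (fun k => ?_)
    (ae_of_all _ fun y => ⟨0, by simp⟩) (fun k => by simp) (fun k => by simp) hperμ hperν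
  filter_upwards [Measure.quasiMeasurePreserving_fst.ae (hμ k),
    Measure.quasiMeasurePreserving_snd.ae (hν k)] with y h1 h2
  simpa using H.sub_mem h2 h1

/-! ### Two-point measures -/

/-- The measure with mass `1 - p` at `a` and mass `p` at `b`. -/
noncomputable def twoPoint {Y : Type*} [MeasurableSpace Y] (p : ℝ) (a b : Y) : Measure Y :=
  ENNReal.ofReal (1 - p) • Measure.dirac a + ENNReal.ofReal p • Measure.dirac b

section TwoPoint

variable {Y Y' : Type*} [MeasurableSpace Y] [MeasurableSpace Y'] {p : ℝ} {a b : Y}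

theorem isProbabilityMeasure_twoPoint (hp0 : 0 ≤ p) (hp1 : p ≤ 1) :
    IsProbabilityMeasure (twoPoint p a b) := ⟨by
  simp only [twoPoint, Measure.add_apply, Measure.smul_apply, measure_univ, smul_eq_mul, mul_one]
  rw [← ENNReal.ofReal_add (by linarith) hp0]
  simp⟩

theorem map_twoPoint {f : Y → Y'} (hf : Measurable f) :
    (twoPoint p a b).map f = twoPoint p (f a) (f b) := by
  simp only [twoPoint]
  rw [Measure.map_add _ _ hf, Measure.map_smul, Measure.map_smul, Measure.map_dirac' hf,
    Measure.map_dirac' hf]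

theorem integrable_twoPoint [MeasurableSingletonClass Y] {E : Type*} [NormedAddCommGroup E]
    (f : Y → E) : Integrable f (twoPoint p a b) :=
  ((integrable_dirac (by simp)).smul_measure (by simp)).add_measure
    ((integrable_dirac (by simp)).smul_measure (by simp))

theorem integral_twoPoint [MeasurableSingletonClass Y] {E : Type*} [NormedAddCommGroup E]
    [NormedSpace ℝ E] [CompleteSpace E] (hp0 : 0 ≤ p) (hp1 : p ≤ 1) (f : Y → E) :
    ∫ y, f y ∂(twoPoint p a b) = (1 - p) • f a + p • f b := by
  rw [twoPoint, integral_add_measure ((integrable_dirac (by simp)).smul_measure (by simp))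
    ((integrable_dirac (by simp)).smul_measure (by simp)), integral_smul_measure,
    integral_smul_measure, integral_dirac, integral_dirac, ENNReal.toReal_ofReal (by linarith),
    ENNReal.toReal_ofReal hp0]

theorem charFun_twoPoint (hp0 : 0 ≤ p) (hp1 : p ≤ 1) (a b t : ℝ) :
    charFun (twoPoint p a b) t =
      (1 - p) * Complex.exp (t * a * Complex.I) + p * Complex.exp (t * b * Complex.I) := by
  rw [charFun_apply_real, integral_twoPoint hp0 hp1]
  simp

/-- The step `a` or `b`, with probabilities `1 - p` and `p`. -/
noncomputable def twoPointProb (p a b : ℝ) (hp0 : 0 ≤ p) (hp1 : p ≤ 1) : ProbabilityMeasure ℝ :=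
  ⟨twoPoint p a b, isProbabilityMeasure_twoPoint hp0 hp1⟩

end TwoPoint

/-- Let the same coin decide both jumps. The difference of the two steps, once centred, has variance
p(1-p)(d-d')², and the variances are summable. The lower atoms `a` and `a'` contribute only
constants. -/
theorem conjugate_twoPoint {μ ν : ℕ → ProbabilityMeasure ℝ} {p a d a' d' : ℕ → ℝ}
    (hp0 : ∀ k, 0 ≤ p k) (hp1 : ∀ k, p k ≤ 1)
    (hμ : ∀ k, (μ k : Measure ℝ) = twoPoint (p k) (a k) (a k + d k))
    (hν : ∀ k, (ν k : Measure ℝ) = twoPoint (p k) (a' k) (a' k + d' k))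
    (hs : Summable fun k => p k * (d k - d' k) ^ 2) : Conjugate (tailAct μ) (tailAct ν) := by
  let γ : ℕ → Measure (ℝ × ℝ) := fun k => twoPoint (p k) (a k, a' k) (a k + d k, a' k + d' k)
  have : ∀ k, IsProbabilityMeasure (γ k) := fun k =>
    isProbabilityMeasure_twoPoint (hp0 k) (hp1 k)
  -- The mean of the difference of the coupled steps, removed as the free constant of
  -- `conjugate_of_coupling`.
  let e : ℕ → ℝ := fun k => a' k - a k + p k * (d' k - d k)
  have hm : ∀ k, Measurable fun y : ℝ × ℝ => y.2 - y.1 - e k := fun k => by fun_prop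
  refine conjugate_of_coupling (Y := ℝ × ℝ) (γ := γ) (ξ := fun _ y => y.1) (ξ' := fun _ y => y.2)
    (ζ := fun k y => y.2 - y.1 - e k) (a := e) (H := ⊥) ?_ ?_ hm ?_ ?_ ?_
    (fun k => by rw [hμ]; exact map_twoPoint measurable_fst)
    (fun k => by rw [hν]; exact map_twoPoint measurable_snd) ?_ ?_
  · exact fun _ => measurable_fst
  · exact fun _ => measurable_snd
  · simp
  · exact fun k => by simp
  · refine ae_exists_tendsto_sum_of_sq (γ := γ) (ζ := fun k y => y.2 - y.1 - e k) hm (fun k => ?_) (fun k => ?_) ?_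
    · exact (memLp_two_iff_integrable_sq (hm k).aestronglyMeasurable).2 (integrable_twoPoint _)
    · rw [integral_twoPoint (hp0 k) (hp1 k)]
      simp only [e, smul_eq_mul]
      ring
    · refine Summable.of_nonneg_of_le (fun k => integral_nonneg fun y => sq_nonneg _) (fun k => ?_) hs
      rw [integral_twoPoint (hp0 k) (hp1 k)]
      simp only [e, smul_eq_mul]
      nlinarith [mul_nonneg (mul_nonneg (hp0 k) (hp0 k)) (sq_nonneg (d k - d' k)), hp0 k, hp1 k]
  · rintro h hh
    rw [AddSubgroup.mem_bot.1 hh]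
    exact isPeriod_zero μ
  · rintro h hh
    rw [AddSubgroup.mem_bot.1 hh]
    exact isPeriod_zero ν

end TailFlow

namespace TailFlow

/-! ### Compound Poisson distributions -/

section CompoundPoisson

variable (m : Measure ℝ) [IsFiniteMeasure m]

instance isFiniteMeasure_convPow (k : ℕ) : IsFiniteMeasure (convPow m k) := by
  induction k with
  | zero => unfold convPow; infer_instance
  | succ k ih => unfold convPow; infer_instance

theorem convPow_univ (k : ℕ) : convPow m k Set.univ = m Set.univ ^ k := by
  induction k with
  | zero => simp [convPow]
  | succ k ih =>
    rw [convPow, Measure.conv, Measure.map_apply measurable_add .univ, Set.preimage_univ,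
      ← Set.univ_prod_univ, Measure.prod_prod, ih, pow_succ]

theorem charFun_convPow (k : ℕ) (t : ℝ) : charFun (convPow m k) t = charFun m t ^ k := by
  induction k with
  | zero => simp [convPow]
  | succ k ih => rw [convPow, charFun_conv, ih, pow_succ]

theorem tsum_convPow_univ :
    (Measure.sum fun k : ℕ => ((k.factorial : ENNReal)⁻¹) • convPow m k) Set.univ =
      ENNReal.ofReal (Real.exp (m.real Set.univ)) := by
  rw [Measure.sum_apply _ .univ]
  have h : ∀ k : ℕ, (((k.factorial : ENNReal)⁻¹) • convPow m k) Set.univ =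
      ENNReal.ofReal (m.real Set.univ ^ k / k.factorial) := fun k => by
    rw [Measure.smul_apply, convPow_univ, smul_eq_mul, div_eq_inv_mul,
      ENNReal.ofReal_mul (by positivity), ENNReal.ofReal_inv_of_pos (by positivity),
      ENNReal.ofReal_natCast, ENNReal.ofReal_pow measureReal_nonneg,
      ofReal_measureReal]
  simp only [h]
  rw [← ENNReal.ofReal_tsum_of_nonneg (fun k => by positivity)
    (Real.summable_pow_div_factorial _), Real.exp_eq_exp_ℝ, NormedSpace.exp_eq_tsum_div]

instance isProbabilityMeasure_compoundPoisson : IsProbabilityMeasure (compoundPoisson m) := ⟨by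
  rw [compoundPoisson, Measure.smul_apply, tsum_convPow_univ, smul_eq_mul,
    ← ENNReal.ofReal_mul (Real.exp_nonneg _), ← Real.exp_add]
  simp⟩

theorem cexp_eq_tsum (z : ℂ) : Complex.exp z = ∑' k : ℕ, z ^ k / k.factorial := by
  rw [Complex.exp_eq_exp_ℂ, NormedSpace.exp_eq_tsum_div]

theorem charFun_compoundPoisson (t : ℝ) :
    charFun (compoundPoisson m) t = Complex.exp (charFun m t - m.real Set.univ) := by
  have hfin : IsFiniteMeasure (Measure.sum fun k : ℕ =>
      ((k.factorial : ENNReal)⁻¹) • convPow m k) :=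
    ⟨by rw [tsum_convPow_univ]; exact ENNReal.ofReal_lt_top⟩
  have hint : Integrable (fun x : ℝ => Complex.exp (t * x * Complex.I))
      (Measure.sum fun k : ℕ => ((k.factorial : ENNReal)⁻¹) • convPow m k) := by
    refine Integrable.of_bound (Measurable.aestronglyMeasurable (by fun_prop)) 1
      (ae_of_all _ fun x => ?_)
    rw [← Complex.ofReal_mul, Complex.norm_exp_ofReal_mul_I]
  rw [charFun_apply_real, compoundPoisson, integral_smul_measure, integral_sum_measure hint,
    ENNReal.toReal_ofReal (Real.exp_nonneg _)]
  have h : ∀ k : ℕ, ∫ x, Complex.exp (t * x * Complex.I)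
      ∂(((k.factorial : ENNReal)⁻¹) • convPow m k) = charFun m t ^ k / k.factorial := fun k => by
    rw [integral_smul_measure, ← charFun_apply_real, charFun_convPow]
    simp only [ENNReal.toReal_inv, ENNReal.toReal_natCast, Complex.real_smul, Complex.ofReal_inv,
      Complex.ofReal_natCast]
    rw [div_eq_inv_mul]
  simp only [h]
  rw [sub_eq_neg_add, Complex.exp_add, cexp_eq_tsum (charFun m t)]
  simp

/-- These are the terms with no jump and with one jump. They provide couplings, coins, and
information on the support of `m`. -/
theorem smul_dirac_add_smul_le_compoundPoisson :
    ENNReal.ofReal (Real.exp (-(m.real Set.univ))) • (Measure.dirac 0 + m) ≤ compoundPoisson m := by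
  refine Measure.le_iff.2 fun s hs => ?_
  rw [compoundPoisson, Measure.smul_apply, Measure.smul_apply, Measure.sum_apply _ hs, smul_eq_mul,
    smul_eq_mul]
  gcongr
  refine le_trans (le_of_eq ?_) (ENNReal.sum_le_tsum (Finset.range 2))
  rw [Finset.sum_range_succ, Finset.sum_range_one]
  simp [convPow]

/-- The compound Poisson distribution as a bundled probability measure. -/
noncomputable def compoundPoissonProb : ProbabilityMeasure ℝ :=
  ⟨compoundPoisson m, isProbabilityMeasure_compoundPoisson m⟩

end CompoundPoisson

/-! ### Measures on a lattice -/

/-- The measure `∑ₖ aₖ δ_{ck}`. -/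
noncomputable def latticeMeasure (a : ℕ → ℝ) (c : ℝ) : Measure ℝ :=
  Measure.sum fun k : ℕ => ENNReal.ofReal (a k) • Measure.dirac (c * k)

section Lattice

variable {a b : ℕ → ℝ} {c : ℝ}

theorem latticeMeasure_univ (ha : ∀ k, 0 ≤ a k) (hs : Summable a) :
    latticeMeasure a c Set.univ = ENNReal.ofReal (∑' k, a k) := by
  rw [latticeMeasure, Measure.sum_apply _ .univ, ENNReal.ofReal_tsum_of_nonneg ha hs]
  simp

theorem isProbabilityMeasure_latticeMeasure (ha : ∀ k, 0 ≤ a k) (hs : HasSum a 1) :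
    IsProbabilityMeasure (latticeMeasure a c) :=
  ⟨by rw [latticeMeasure_univ ha hs.summable, hs.tsum_eq, ENNReal.ofReal_one]⟩

theorem charFun_latticeMeasure (ha : ∀ k, 0 ≤ a k) (hs : Summable a) (t : ℝ) :
    charFun (latticeMeasure a c) t = ∑' k, a k * Complex.exp (t * c * Complex.I) ^ k := by
  have hfin : IsFiniteMeasure (latticeMeasure a c) :=
    ⟨by rw [latticeMeasure_univ ha hs]; exact ENNReal.ofReal_lt_top⟩
  have hint : Integrable (fun x : ℝ => Complex.exp (t * x * Complex.I)) (latticeMeasure a c) := by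
    refine Integrable.of_bound (Measurable.aestronglyMeasurable (by fun_prop)) 1
      (ae_of_all _ fun x => ?_)
    rw [← Complex.ofReal_mul, Complex.norm_exp_ofReal_mul_I]
  rw [charFun_apply_real, latticeMeasure, integral_sum_measure hint]
  congr 1
  ext k
  rw [integral_smul_measure, integral_dirac, ENNReal.toReal_ofReal (ha k), ← Complex.exp_nat_mul]
  simp only [Complex.real_smul, Complex.ofReal_mul, Complex.ofReal_natCast]
  congr 2
  ring

theorem ae_latticeMeasure : ∀ᵐ x ∂(latticeMeasure a c), ∃ k : ℕ, x = c * k := by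
  rw [latticeMeasure, Measure.ae_sum_iff]
  intro k
  refine Measure.ae_smul_measure ?_ _
  rw [ae_dirac_eq]
  exact ⟨k, rfl⟩

/-- The common part `min (a k) (b k)` is coupled on the diagonal at no cost; the missing mass Σ (a -
min a b) is at most the ℓ¹ distance. -/
theorem exists_coupling_latticeMeasure (ha : ∀ k, 0 ≤ a k) (hb : ∀ k, 0 ≤ b k) (ha1 : HasSum a 1)
    (hb1 : HasSum b 1) : ∃ γ : Measure (ℝ × ℝ), γ.map Prod.fst = latticeMeasure a c ∧
      γ.map Prod.snd = latticeMeasure b c ∧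
        couplingCost γ ≤ ENNReal.ofReal (∑' k, |a k - b k|) := by
  have : IsProbabilityMeasure (latticeMeasure a c) := isProbabilityMeasure_latticeMeasure ha ha1
  have : IsProbabilityMeasure (latticeMeasure b c) := isProbabilityMeasure_latticeMeasure hb hb1
  have hmin0 : ∀ k, 0 ≤ min (a k) (b k) := fun k => le_min (ha k) (hb k)
  have hmin : Summable fun k => min (a k) (b k) :=
    Summable.of_nonneg_of_le hmin0 (fun k => min_le_left _ _) ha1.summable
  have hd : Measurable fun x : ℝ => (x, x) := measurable_id.prodMk measurable_id
  have hle : ∀ a' : ℕ → ℝ, (∀ k, min (a k) (b k) ≤ a' k) →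
      latticeMeasure (fun k => min (a k) (b k)) c ≤ latticeMeasure a' c := fun a' h => by
    refine Measure.le_iff.2 fun s hs => ?_
    rw [latticeMeasure, latticeMeasure, Measure.sum_apply _ hs, Measure.sum_apply _ hs]
    refine ENNReal.tsum_le_tsum fun k => ?_
    rw [Measure.smul_apply, Measure.smul_apply, smul_eq_mul, smul_eq_mul]
    gcongr
    exact h k
  obtain ⟨γ, h1, h2, h3⟩ := exists_coupling_of_le
    (μ := latticeMeasure a c) (ν := latticeMeasure b c)
    (π := (latticeMeasure (fun k => min (a k) (b k)) c).map fun x => (x, x))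
    (by rw [Measure.map_map measurable_fst hd]
        simpa [Function.comp_def] using hle a fun k => min_le_left _ _)
    (by rw [Measure.map_map measurable_snd hd]
        simpa [Function.comp_def] using hle b fun k => min_le_right _ _)
  refine ⟨γ, h1, h2, h3.trans ?_⟩
  have hz : couplingCost ((latticeMeasure (fun k => min (a k) (b k)) c).map fun x => (x, x)) = 0 := by
    unfold couplingCost
    rw [lintegral_map (by fun_prop) hd]
    simp
  rw [hz, zero_add, Measure.map_apply hd .univ, Set.preimage_univ,
    latticeMeasure_univ hmin0 hmin, ← ENNReal.ofReal_one,
    ← ENNReal.ofReal_sub _ (tsum_nonneg hmin0)]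
  refine ENNReal.ofReal_le_ofReal ?_
  rw [← ha1.tsum_eq, ← ha1.summable.tsum_sub hmin]
  refine Summable.tsum_le_tsum (fun k => ?_) (ha1.summable.sub hmin)
    (ha1.summable.sub hb1.summable).abs
  rcases le_total (a k) (b k) with h | h
  · rw [min_eq_left h, sub_self]
    exact abs_nonneg _
  · rw [min_eq_right h]
    exact le_abs_self _

/-- The weights of the Poisson distribution. -/
noncomputable def poissonWeight (r : ℝ) (k : ℕ) : ℝ := Real.exp (-r) * (r ^ k / k.factorial)

theorem hasSum_poissonWeight (r : ℝ) : HasSum (poissonWeight r) 1 := by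
  have h := (Real.summable_pow_div_factorial r).hasSum.mul_left (Real.exp (-r))
  have e : ∑' k : ℕ, r ^ k / (k.factorial : ℝ) = Real.exp r := by
    rw [Real.exp_eq_exp_ℝ, NormedSpace.exp_eq_tsum_div]
  rwa [e, ← Real.exp_add, neg_add_cancel, Real.exp_zero] at h

theorem poissonWeight_nonneg {r : ℝ} (hr : 0 ≤ r) (k : ℕ) : 0 ≤ poissonWeight r k := by
  unfold poissonWeight; positivity

theorem compoundPoisson_dirac {r : ℝ} (hr : 0 ≤ r) (c : ℝ) :
    compoundPoisson (ENNReal.ofReal r • Measure.dirac c) = latticeMeasure (poissonWeight r) c := by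
  have : IsFiniteMeasure (ENNReal.ofReal r • Measure.dirac c) :=
    ⟨by rw [Measure.smul_apply, smul_eq_mul, measure_univ, mul_one]; exact ENNReal.ofReal_lt_top⟩
  have : IsProbabilityMeasure (latticeMeasure (poissonWeight r) c) :=
    isProbabilityMeasure_latticeMeasure (poissonWeight_nonneg hr) (hasSum_poissonWeight r)
  refine Measure.ext_of_charFun ?_
  ext t
  rw [charFun_compoundPoisson, charFun_latticeMeasure (poissonWeight_nonneg hr)
    (hasSum_poissonWeight r).summable]
  have h1 : charFun (ENNReal.ofReal r • Measure.dirac c) t = r * Complex.exp (t * c * Complex.I) := by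
    rw [charFun_apply_real, integral_smul_measure, integral_dirac, ENNReal.toReal_ofReal hr]
    simp
  have h2 : (ENNReal.ofReal r • Measure.dirac c).real Set.univ = r := by
    rw [measureReal_def, Measure.smul_apply, smul_eq_mul, measure_univ, mul_one,
      ENNReal.toReal_ofReal hr]
  rw [h1, h2, sub_eq_neg_add, Complex.exp_add, cexp_eq_tsum (r * _), ← tsum_mul_left]
  congr 1
  ext k
  simp only [poissonWeight]
  push_cast
  rw [mul_pow]
  ring

end Lattice

/-! ### Supports -/

theorem twoPoint_real_singleton {p a b : ℝ} (hab : a ≠ b) :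
    twoPoint p a b {b} = ENNReal.ofReal p ∧ twoPoint p a b {a} = ENNReal.ofReal (1 - p) := by
  have h := hab.symm
  constructor <;> simp [twoPoint, hab, h]

theorem support_twoPoint {p a b : ℝ} (hp0 : 0 < p) (hp1 : p < 1) :
    (twoPoint p a b).support = {a, b} := by
  refine Set.Subset.antisymm (Measure.support_subset_of_isClosed (Set.toFinite _).isClosed ?_) ?_
  · rw [mem_ae_iff]
    simp [twoPoint]
  · rintro x hx
    rw [Measure.mem_support_iff_forall]
    intro U hU
    have hx' : x ∈ U := mem_of_mem_nhds hU
    rcases hx with rfl | rfl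
    · simp only [twoPoint, Measure.add_apply, Measure.smul_apply, Measure.dirac_apply_of_mem hx']
      simp [hp1]
    · simp only [twoPoint, Measure.add_apply, Measure.smul_apply, Measure.dirac_apply_of_mem hx']
      simp [hp0]

theorem variance_twoPoint {p a b : ℝ} (hp0 : 0 ≤ p) (hp1 : p ≤ 1) :
    variance id (twoPoint p a b) = p * (1 - p) * (b - a) ^ 2 := by
  have := isProbabilityMeasure_twoPoint (a := a) (b := b) hp0 hp1
  rw [variance_eq_integral aemeasurable_id, integral_twoPoint hp0 hp1, integral_twoPoint hp0 hp1]
  simp only [id, smul_eq_mul]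
  ring

theorem eq_twoPoint_of_support {μ : Measure ℝ} [IsProbabilityMeasure μ] {a b : ℝ} (hab : a ≠ b)
    (h : μ.support = {a, b}) : 0 < μ.real {b} ∧ μ.real {b} < 1 ∧ μ = twoPoint (μ.real {b}) a b := by
  have hae : ∀ᵐ x ∂μ, x ∈ ({a, b} : Set ℝ) := h ▸ Measure.support_mem_ae
  have hpos : ∀ x ∈ ({a, b} : Set ℝ), 0 < μ {x} := fun x hx => by
    have h1 := (Measure.mem_support_iff_forall x).1 (h ▸ hx)
    have hc : ({a, b} \ {x} : Set ℝ)ᶜ ∈ 𝓝 x :=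
      ((Set.toFinite _).subset Set.sdiff_subset).isClosed.isOpen_compl.mem_nhds (by simp)
    refine (h1 _ hc).trans_le (measure_mono_ae ?_)
    filter_upwards [hae] with y hy hy'
    by_contra hne
    exact hy' ⟨hy, hne⟩
  have hsum : μ {a} + μ {b} = 1 := by
    rw [← measure_union (by simpa using hab) (measurableSet_singleton b), ← prob_compl_eq_zero_iff
      ((measurableSet_singleton a).union (measurableSet_singleton b))]
    exact hae
  have hsum' : μ.real {a} + μ.real {b} = 1 := by
    rw [measureReal_def, measureReal_def, ← ENNReal.toReal_add (by finiteness) (by finiteness), hsum]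
    rfl
  have ha := ENNReal.toReal_pos (hpos a (by simp)).ne' (by finiteness)
  have hb := ENNReal.toReal_pos (hpos b (by simp)).ne' (by finiteness)
  rw [← measureReal_def] at ha hb
  refine ⟨hb, by linarith, ?_⟩
  refine Measure.ext fun s hs => ?_
  have e1 : ENNReal.ofReal (1 - μ.real {b}) = μ {a} := by
    rw [← hsum', add_sub_cancel_right, ofReal_measureReal]
  rw [twoPoint, e1, ofReal_measureReal]
  have e2 : μ s = μ (s ∩ {a}) + μ (s ∩ {b}) := by
    rw [← measure_union (by rw [Set.disjoint_left]; rintro x ⟨_, rfl⟩ ⟨_, h2⟩; exact hab h2)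
      (hs.inter (measurableSet_singleton b)), ← Set.inter_union_distrib_left]
    refine measure_congr ?_
    filter_upwards [hae] with x hx
    exact propext ⟨fun h => ⟨h, hx⟩, fun h => h.1⟩
  have e3 : ∀ x : ℝ, μ (s ∩ {x}) = (μ {x} • Measure.dirac x) s := fun x => by
    by_cases hx : x ∈ s
    · rw [Set.inter_eq_right.2 (by simpa using hx)]
      simp [hx]
    · rw [Set.inter_singleton_eq_empty.2 hx]
      simp [hx]
  rw [e2, e3, e3]
  rfl

/-- A positive multiple of `m` lies below the compound Poisson law, so `m` cannot charge what that
law does not charge. -/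
theorem measure_Iio_eq_zero_of_compoundPoisson {m : Measure ℝ} [IsFiniteMeasure m]
    (h : (compoundPoisson m).support ⊆ Set.Ici 0) : m (Set.Iio 0) = 0 := by
  have h1 : compoundPoisson m (Set.Iio 0) = 0 := by
    rw [← Set.compl_Ici, ← mem_ae_iff]
    exact mem_of_superset Measure.support_mem_ae h
  have h2 := (smul_dirac_add_smul_le_compoundPoisson m (Set.Iio 0)).trans h1.le
  simpa [(Real.exp_pos _).not_ge] using h2

theorem support_latticeMeasure_subset {a : ℕ → ℝ} {c : ℝ} (hc : 0 ≤ c) :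
    (latticeMeasure a c).support ⊆ Set.Ici 0 := by
  refine Measure.support_subset_of_isClosed isClosed_Ici ?_
  filter_upwards [ae_latticeMeasure] with x hx
  obtain ⟨k, rfl⟩ := hx
  exact mul_nonneg hc k.cast_nonneg

end TailFlow

namespace TailFlow

/-! ### From compound Poisson steps to two-point steps -/

/-- With r = m(ℝ), match "no jump" with 0 and "one jump x" with `d`. The unmatched mass is p - r
e^{-r} ≤ p - r + r². The condition r ≤ p leaves room for the mass 1 - p at (0, 0), since 1 - p ≤ 1 -
r ≤ e^{-r}. -/
theorem exists_coupling_compoundPoisson {m : Measure ℝ} [IsFiniteMeasure m] {p : ℝ} (d : ℝ)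
    (hr : m.real Set.univ ≤ p) (hp : p ≤ 1) :
    ∃ γ : Measure (ℝ × ℝ), γ.map Prod.fst = compoundPoisson m ∧ γ.map Prod.snd = twoPoint p 0 d ∧
      couplingCost γ ≤ ∫⁻ x, ENNReal.ofReal (min 1 |d - x|) ∂m +
        ENNReal.ofReal (p - m.real Set.univ + m.real Set.univ ^ 2) := by
  set r := m.real Set.univ with hrdef
  have hr0 : 0 ≤ r := measureReal_nonneg
  have hm : m Set.univ = ENNReal.ofReal r := by rw [hrdef, ofReal_measureReal]
  have := isProbabilityMeasure_twoPoint (a := (0 : ℝ)) (b := d) (hr0.trans hr) hp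
  have hexp : 1 - r ≤ Real.exp (-r) := by linarith [Real.add_one_le_exp (-r)]
  have hexp1 : Real.exp (-r) ≤ 1 := Real.exp_le_one_iff.2 (by linarith)
  have hd : Measurable fun x : ℝ => (x, d) := by fun_prop
  let π : Measure (ℝ × ℝ) := ENNReal.ofReal (1 - p) • Measure.dirac (0, 0) +
    ENNReal.ofReal (Real.exp (-r)) • m.map fun x => (x, d)
  have hmass : π Set.univ = ENNReal.ofReal (1 - p + Real.exp (-r) * r) := by
    simp only [π, Measure.add_apply, Measure.smul_apply, measure_univ, smul_eq_mul, mul_one]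
    rw [Measure.map_apply hd .univ, Set.preimage_univ, hm, ← ENNReal.ofReal_mul (by positivity),
      ← ENNReal.ofReal_add (by linarith) (by positivity)]
  have hm1 : π.map Prod.fst ≤ compoundPoisson m := by
    simp only [π]
    rw [Measure.map_add _ _ measurable_fst, Measure.map_smul, Measure.map_smul,
      Measure.map_dirac' measurable_fst, Measure.map_map measurable_fst hd]
    refine le_trans ?_ (smul_dirac_add_smul_le_compoundPoisson m)
    rw [smul_add]
    refine add_le_add (Measure.le_iff.2 fun s hs => ?_) (le_of_eq ?_)
    · rw [Measure.smul_apply, Measure.smul_apply, smul_eq_mul, smul_eq_mul]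
      gcongr
      linarith
    · simp [Function.comp_def, hrdef]
  have hm2 : π.map Prod.snd ≤ twoPoint p 0 d := by
    simp only [π]
    rw [Measure.map_add _ _ measurable_snd, Measure.map_smul, Measure.map_smul,
      Measure.map_dirac' measurable_snd, Measure.map_map measurable_snd hd, twoPoint]
    refine add_le_add le_rfl (Measure.le_iff.2 fun s hs => ?_)
    simp only [Function.comp_def]
    rw [Measure.map_const, Measure.smul_apply, Measure.smul_apply, Measure.smul_apply, smul_eq_mul,
      smul_eq_mul, smul_eq_mul, hm, ← mul_assoc, ← ENNReal.ofReal_mul (by positivity)]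
    gcongr
    nlinarith
  obtain ⟨γ, h1, h2, h3⟩ := exists_coupling_of_le hm1 hm2
  refine ⟨γ, h1, h2, h3.trans (add_le_add ?_ ?_)⟩
  · simp only [couplingCost, π]
    rw [lintegral_add_measure, lintegral_smul_measure, lintegral_smul_measure, lintegral_dirac,
      lintegral_map (by fun_prop) hd]
    simp only [sub_self, abs_zero, smul_eq_mul]
    simp only [zero_le_one, min_eq_right, ENNReal.ofReal_zero, mul_zero, zero_add]
    exact mul_le_of_le_one_left zero_le (ENNReal.ofReal_le_one.2 hexp1)
  · rw [hmass, ← ENNReal.ofReal_one, ← ENNReal.ofReal_sub _ (by nlinarith [Real.exp_pos (-r)])]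
    refine ENNReal.ofReal_le_ofReal ?_
    nlinarith

/-- Simple approximations of the identity with values in `s`, together with dominated convergence.
Values in `s` keep later jumps nonzero, or positive. -/
theorem exists_simpleFunc_lintegral_le (m : Measure ℝ) [IsFiniteMeasure m] {s : Set ℝ}
    (hs : s.Nonempty) (hms : m sᶜ = 0) {ε : ENNReal} (hε : ε ≠ 0) :
    ∃ q : SimpleFunc ℝ ℝ, (∀ x, q x ∈ s) ∧ ∫⁻ x, ENNReal.ofReal (min 1 |q x - x|) ∂m ≤ ε := by
  obtain ⟨x₀, hx₀⟩ := hs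
  let q := SimpleFunc.approxOn (id : ℝ → ℝ) measurable_id s x₀ hx₀
  have hlim : Tendsto (fun n => ∫⁻ x, ENNReal.ofReal (min 1 |q n x - x|) ∂m) atTop
      (𝓝 (∫⁻ _, 0 ∂m)) := by
    refine tendsto_lintegral_of_dominated_convergence (fun _ => 1) (fun n => ?_) (fun n => ?_) ?_ ?_
    · have := (q n).measurable
      fun_prop
    · refine ae_of_all _ fun x => ?_
      rw [ENNReal.ofReal_le_one]
      exact min_le_left _ _
    · simp
    · have hae : ∀ᵐ x ∂m, x ∈ s := hms
      filter_upwards [hae] with x hx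
      have h1 : Tendsto (fun n => q n x) atTop (𝓝 x) :=
        SimpleFunc.tendsto_approxOn measurable_id hx₀ (subset_closure hx)
      have h2 : Continuous fun y : ℝ => ENNReal.ofReal (min 1 |y - x|) :=
        ENNReal.continuous_ofReal.comp (by fun_prop)
      have h3 := (h2.tendsto x).comp h1
      simp only [sub_self, abs_zero, zero_le_one, min_eq_right, ENNReal.ofReal_zero] at h3
      exact h3
  rw [lintegral_zero] at hlim
  obtain ⟨n, hn⟩ := (hlim.eventually_le_const (pos_iff_ne_zero.2 hε)).exists
  exact ⟨q n, fun x => SimpleFunc.approxOn_mem measurable_id hx₀ n x, hn⟩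

theorem charFun_sum_measure {ι : Type*} (s : Finset ι) (m : ι → Measure ℝ)
    [∀ i, IsFiniteMeasure (m i)] (t : ℝ) :
    charFun (∑ i ∈ s, m i) t = ∑ i ∈ s, charFun (m i) t := by
  simp only [charFun_apply_real]
  refine integral_finsetSum_measure fun i _ => ?_
  refine Integrable.of_bound (Measurable.aestronglyMeasurable (by fun_prop)) 1
    (ae_of_all _ fun x => ?_)
  rw [← Complex.ofReal_mul, Complex.norm_exp_ofReal_mul_I]

theorem charFun_compoundPoisson_sum {ι : Type*} (s : Finset ι) (m : ι → Measure ℝ)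
    [∀ i, IsFiniteMeasure (m i)] (t : ℝ) :
    charFun (compoundPoisson (∑ i ∈ s, m i)) t = ∏ i ∈ s, charFun (compoundPoisson (m i)) t := by
  simp only [charFun_compoundPoisson, charFun_sum_measure]
  rw [← Complex.exp_sum, Finset.sum_sub_distrib]
  congr 2
  rw [measureReal_def, Measure.finsetSum_apply, ENNReal.toReal_sum (fun i _ => by finiteness)]
  push_cast
  rfl

/-- The measure is cut along the level sets of a simple approximation of the identity, and each part
into `N` equal pieces. The displacement cost does not depend on `N`, while the second-order errors
of the pieces add up to O(1/N). -/
theorem exists_sum_eq_of_finite (m : Measure ℝ) [IsFiniteMeasure m] {s : Set ℝ}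
    (hs : s.Nonempty) (hms : m sᶜ = 0) {η : ℝ} (hη : 0 < η) :
    ∃ (ι : Type) (_ : Fintype ι) (_ : Nonempty ι) (mi : ι → Measure ℝ) (p d : ι → ℝ)
      (ε : ι → ENNReal), (∀ i, IsFiniteMeasure (mi i)) ∧ ∑ i, mi i = m ∧
      (∀ i, 0 < p i ∧ p i ≤ 1 / 2 ∧ p i * d i ^ 2 ≤ 1 ∧ d i ∈ s ∧
        ∃ γ : Measure (ℝ × ℝ), γ.map Prod.fst = compoundPoisson (mi i) ∧
          γ.map Prod.snd = twoPoint (p i) 0 (d i) ∧ couplingCost γ ≤ ε i) ∧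
      ∑ i, ε i ≤ ENNReal.ofReal η := by
  obtain ⟨q, hqs, hq⟩ := exists_simpleFunc_lintegral_le m hs hms
    (ENNReal.ofReal_pos.2 (half_pos hη)).ne'
  set r := m.real Set.univ with hr
  have hr0 : 0 ≤ r := measureReal_nonneg
  let D : Finset ℝ := q.range
  -- The four terms serve, in order, N > 1, p ≤ 1/2, p d² ≤ 1, and a total second-order error |D|(1
  -- + r²)/N of at most η/2.
  obtain ⟨N, hN⟩ := exists_nat_gt (1 + 2 * (r + 1) + (r + 1) * ∑ d ∈ D, d ^ 2 +
    D.card * (1 + r ^ 2) / (η / 2))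
  have hnn1 : 0 ≤ ∑ d ∈ D, d ^ 2 := Finset.sum_nonneg fun d _ => sq_nonneg d
  have hnn2 : 0 ≤ D.card * (1 + r ^ 2) / (η / 2) := by positivity
  have hN1 : (1 : ℝ) < N := by nlinarith
  have hN0 : (0 : ℝ) < N := by linarith
  have hNpos : 0 < N := by exact_mod_cast hN0
  have : NeZero N := ⟨hNpos.ne'⟩
  have : Nonempty D := ⟨⟨q 0, q.mem_range_self 0⟩⟩
  let mi : D × Fin N → Measure ℝ := fun i => ENNReal.ofReal (N : ℝ)⁻¹ • m.restrict (q ⁻¹' {i.1.1})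
  have hmi : ∀ i, (mi i).real Set.univ ≤ r / N := fun i => by
    simp only [mi, measureReal_ennreal_smul_apply, ENNReal.toReal_ofReal (inv_nonneg.2 hN0.le)]
    rw [measureReal_restrict_apply_univ, div_eq_inv_mul]
    exact mul_le_mul_of_nonneg_left (measureReal_mono (Set.subset_univ _)) (inv_nonneg.2 hN0.le)
  have hfin : ∀ i, IsFiniteMeasure (mi i) := fun i => Measure.smul_finite _ (by simp)
  have hdis : Set.PairwiseDisjoint (↑(Finset.univ : Finset D)) fun i : D => q ⁻¹' {i.1} := by
    intro i _ j _ hij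
    refine Set.disjoint_left.2 fun x hx hx' => hij (Subtype.ext ?_)
    exact hx.symm.trans hx'
  have hcov : (⋃ i ∈ (Finset.univ : Finset D), q ⁻¹' {i.1}) = Set.univ := by
    refine Set.eq_univ_of_forall fun x => ?_
    simp only [Set.mem_iUnion]
    exact ⟨⟨q x, q.mem_range_self x⟩, Finset.mem_univ _, rfl⟩
  have hms' : ∀ i : D, MeasurableSet (q ⁻¹' {i.1}) := fun i => q.measurableSet_preimage _
  have hsum : ∀ f : ℝ → ENNReal, ∑ i, ∫⁻ x, f x ∂(mi i) = ∫⁻ x, f x ∂m := fun f => by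
    simp only [mi, lintegral_smul_measure, smul_eq_mul]
    rw [Fintype.sum_prod_type, ← setLIntegral_univ f, ← hcov,
      lintegral_biUnion_finset hdis (fun i _ => hms' i)]
    refine Finset.sum_congr rfl fun i _ => ?_
    simp only [Finset.sum_const]
    rw [Finset.card_univ, Fintype.card_fin, nsmul_eq_mul, ← mul_assoc,
      ← ENNReal.ofReal_natCast, ← ENNReal.ofReal_mul hN0.le, mul_inv_cancel₀ hN0.ne',
      ENNReal.ofReal_one, one_mul]
  -- The extra 1/N² makes `p i` positive even when the piece has mass 0, so that both atoms are
  -- really charged.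
  let p : D × Fin N → ℝ := fun i => (mi i).real Set.univ + 1 / N ^ 2
  have hN2 : (1 : ℝ) / N ^ 2 ≤ 1 / N := one_div_le_one_div_of_le hN0 (by nlinarith)
  have hp : ∀ i, p i ≤ (r + 1) / N := fun i => by
    rw [add_div]
    exact add_le_add (hmi i) hN2
  have hp0 : ∀ i, 0 < p i := fun i => by
    have : 0 ≤ (mi i).real Set.univ := measureReal_nonneg
    positivity
  have hphalf : ∀ i, p i ≤ 1 / 2 := fun i => (hp i).trans (by
    rw [div_le_div_iff₀ hN0 two_pos]
    nlinarith)
  have hcoup := fun i : D × Fin N => exists_coupling_compoundPoisson (m := mi i) (p := p i) i.1.1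
    (by simp only [p]; linarith [show (0 : ℝ) ≤ 1 / N ^ 2 by positivity])
    ((hphalf i).trans (by norm_num))
  refine ⟨D × Fin N, inferInstance, inferInstance, mi, p, fun i => i.1.1, _, hfin, ?_,
    fun i => ⟨hp0 i, hphalf i, ?_, ?_, hcoup i⟩, ?_⟩
  · refine Measure.ext fun u hu => ?_
    rw [Measure.finsetSum_apply]
    have := hsum (u.indicator 1)
    simpa [lintegral_indicator_one hu] using this
  · have h1 : i.1.1 ^ 2 ≤ ∑ d ∈ D, d ^ 2 :=
      Finset.single_le_sum (f := fun d : ℝ => d ^ 2) (fun d _ => sq_nonneg d) i.1.2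
    calc p i * i.1.1 ^ 2 ≤ (r + 1) / N * ∑ d ∈ D, d ^ 2 := by
          gcongr
          exact hp i
      _ ≤ 1 := by
          rw [div_mul_eq_mul_div, div_le_one hN0]
          linarith
  · obtain ⟨x, hx⟩ := q.mem_range.1 i.1.2
    have := hqs x
    rwa [hx] at this
  · rw [Finset.sum_add_distrib]
    have h1 : ∑ i, ∫⁻ x, ENNReal.ofReal (min 1 |i.1.1 - x|) ∂(mi i) ≤ ENNReal.ofReal (η / 2) := by
      refine le_trans (le_of_eq ?_) hq
      rw [← hsum]
      refine Finset.sum_congr rfl fun i _ => ?_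
      refine lintegral_congr_ae (Measure.ae_smul_measure ?_ _)
      filter_upwards [ae_restrict_mem (hms' i.1)] with x hx
      rw [show q x = i.1.1 from hx]
    refine (add_le_add h1 (Finset.sum_le_card_nsmul _ _
      (ENNReal.ofReal ((1 + r ^ 2) / N ^ 2)) fun i _ => ?_)).trans ?_
    · refine ENNReal.ofReal_le_ofReal ?_
      have := hmi i
      have h0 : 0 ≤ (mi i).real Set.univ := measureReal_nonneg
      simp only [p]
      rw [add_sub_cancel_left, add_div, ← div_pow]
      gcongr
    · rw [Finset.card_univ, Fintype.card_prod, Fintype.card_fin, Fintype.card_coe, nsmul_eq_mul,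
        ← ENNReal.ofReal_natCast, ← ENNReal.ofReal_mul (by positivity),
        ← ENNReal.ofReal_add (by positivity) (by positivity)]
      refine ENNReal.ofReal_le_ofReal ?_
      have h2 : D.card * (1 + r ^ 2) / (η / 2) ≤ N := by
        nlinarith [mul_nonneg (show 0 ≤ r + 1 by linarith) hnn1]
      rw [div_le_iff₀ (half_pos hη)] at h2
      have h3 : ((D.card * N : ℕ) : ℝ) * ((1 + r ^ 2) / N ^ 2) = D.card * (1 + r ^ 2) / N := by
        push_cast
        field_simp
      rw [h3]
      have h4 : D.card * (1 + r ^ 2) / N ≤ η / 2 := by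
        rw [div_le_iff₀ hN0]
        linarith
      linarith

/-- Each step splits into finitely many independent compound Poisson pieces, and all pieces are
rearranged in one sequence before they are coupled with two-point steps. The allowed error (1/2)^n
for step `n` makes the total cost finite. -/
theorem exists_twoPoint_conjugate {μ : ℕ → ProbabilityMeasure ℝ} {m : ℕ → Measure ℝ}
    [∀ n, IsFiniteMeasure (m n)] (hμ : ∀ n, (μ n : Measure ℝ) = compoundPoisson (m n))
    {s : Set ℝ} (hs : s.Nonempty) (hms : ∀ n, m n sᶜ = 0) :
    ∃ (p d : ℕ → ℝ) (ν : ℕ → ProbabilityMeasure ℝ), (∀ n, 0 < p n ∧ p n ≤ 1 / 2 ∧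
      p n * d n ^ 2 ≤ 1 ∧ d n ∈ s ∧ (ν n : Measure ℝ) = twoPoint (p n) 0 (d n)) ∧
      Conjugate (tailAct μ) (tailAct ν) := by
  choose ι hfin hne mi p d ε hmi hsum hp hε using fun n =>
    exists_sum_eq_of_finite (m n) hs (hms n) (η := (1 / 2) ^ n) (by positivity)
  have : Countable (Σ n, ι n) := inferInstance
  have : Infinite (Σ n, ι n) :=
    Infinite.of_injective (fun n => ⟨n, (hne n).some⟩) fun a b h => congrArg Sigma.fst h
  obtain ⟨e⟩ : Nonempty ((Σ n, ι n) ≃ ℕ) := nonempty_equiv_of_countable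
  let κ : (Σ n, ι n) → ProbabilityMeasure ℝ := fun i => compoundPoissonProb (mi i.1 i.2)
  let ν : ℕ → ProbabilityMeasure ℝ := fun k =>
    twoPointProb (p (e.symm k).1 (e.symm k).2) 0 (d (e.symm k).1 (e.symm k).2)
      (hp _ _).1.le ((hp _ _).2.1.trans (by norm_num))
  have hβ : ∀ k, ((Sigma.fst : (Σ n, ι n) → ℕ) ⁻¹' {k}).Finite := fun k => by
    refine (Set.finite_range fun j : ι k => (⟨k, j⟩ : Σ n, ι n)).subset ?_
    rintro ⟨n, j⟩ h
    obtain rfl : n = k := h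
    exact ⟨j, rfl⟩
  have hβ' : ∀ k, ((e : (Σ n, ι n) → ℕ) ⁻¹' {k}).Finite := fun k =>
    (Set.finite_singleton k).preimage e.injective.injOn
  have h1 : Conjugate (tailAct μ) (tailAct fun k => κ (e.symm k)) := by
    refine conjugate_of_regroup κ hβ hβ' (fun k t => ?_) fun k t => ?_
    · have hset : (hβ k).toFinset = Finset.univ.map ⟨fun j : ι k => (⟨k, j⟩ : Σ n, ι n),
          fun a b h => by simpa using h⟩ := by
        ext ⟨n, j⟩
        simp only [Set.Finite.mem_toFinset, Set.mem_preimage, Set.mem_singleton_iff,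
          Finset.mem_map, Finset.mem_univ, true_and]
        constructor
        · rintro rfl
          exact ⟨j, rfl⟩
        · rintro ⟨a, ha⟩
          exact (congrArg Sigma.fst ha).symm
      rw [hset, Finset.prod_map, hμ, ← hsum k, charFun_compoundPoisson_sum]
      rfl
    · have hset : (hβ' k).toFinset = {e.symm k} := by
        ext i
        simp [Equiv.eq_symm_apply]
      rw [hset, Finset.prod_singleton]
  have h2 : Conjugate (tailAct fun k => κ (e.symm k)) (tailAct ν) := by
    refine conjugate_of_couplingCost (ε := fun k => ε (e.symm k).1 (e.symm k).2)
      (fun k => (hp _ _).2.2.2.2) ?_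
    rw [e.symm.tsum_eq (fun i : Σ n, ι n => ε i.1 i.2), ENNReal.tsum_sigma']
    simp only [tsum_fintype]
    refine ne_top_of_le_ne_top ?_ (ENNReal.tsum_le_tsum hε)
    rw [← ENNReal.ofReal_tsum_of_nonneg (fun n => by positivity) summable_geometric_two]
    exact ENNReal.ofReal_ne_top
  exact ⟨fun k => p (e.symm k).1 (e.symm k).2, fun k => d (e.symm k).1 (e.symm k).2, ν,
    fun k => ⟨(hp _ _).1, (hp _ _).2.1, (hp _ _).2.2.1, (hp _ _).2.2.2.1, rfl⟩, h1.trans h2⟩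

/-- Jumps of size 0 are not seen. Removing them allows the two-point jumps to be taken away from 0.
-/
theorem compoundPoisson_restrict_compl_zero (m : Measure ℝ) [IsFiniteMeasure m] :
    compoundPoisson (m.restrict {0}ᶜ) = compoundPoisson m := by
  refine Measure.ext_of_charFun (funext fun t => ?_)
  rw [charFun_compoundPoisson, charFun_compoundPoisson]
  congr 1
  have hint : Integrable (fun x : ℝ => Complex.exp (t * x * Complex.I)) m := by
    refine Integrable.of_bound (Measurable.aestronglyMeasurable (by fun_prop)) 1
      (ae_of_all _ fun x => ?_)
    rw [← Complex.ofReal_mul, Complex.norm_exp_ofReal_mul_I]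
  have h1 := integral_add_compl (measurableSet_singleton (0 : ℝ)) hint
  have h2 := measureReal_add_measureReal_compl (μ := m) (measurableSet_singleton (0 : ℝ))
  rw [charFun_apply_real, charFun_apply_real, ← h1, ← h2, measureReal_restrict_apply_univ,
    integral_singleton]
  simp

theorem exists_isTwoPointSequence_conjugate {μ : ℕ → ProbabilityMeasure ℝ}
    (hμ : ∀ n, IsCompoundPoisson (μ n)) : ∃ ν : ℕ → ProbabilityMeasure ℝ, IsTwoPointSequence ν ∧
      Conjugate (tailAct μ) (tailAct ν) := by
  choose m hfin hm using hμ
  obtain ⟨p, d, ν, h, hc⟩ := exists_twoPoint_conjugate (m := fun n => (m n).restrict {0}ᶜ)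
    (fun n => by rw [hm, compoundPoisson_restrict_compl_zero]) (s := {0}ᶜ) ⟨1, by simp⟩
    (fun n => by simp)
  refine ⟨ν, ⟨fun n => ?_, ⟨1, ?_⟩⟩, hc⟩
  · obtain ⟨h1, h2, h3, h4, h5⟩ := h n
    rw [h5, support_twoPoint h1 (by linarith)]
    rcases lt_or_gt_of_ne (show d n ≠ 0 from h4) with h6 | h6
    · exact ⟨d n, 0, h6, Set.pair_comm _ _⟩
    · exact ⟨0, d n, h6, rfl⟩
  · rintro _ ⟨n, rfl⟩
    obtain ⟨h1, h2, h3, h4, h5⟩ := h n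
    simp only [h5]
    rw [variance_twoPoint h1.le (by linarith), sub_zero]
    nlinarith [sq_nonneg (d n), mul_nonneg h1.le (sq_nonneg (d n))]

theorem exists_isLeftHeavyTwoPointSequence_conjugate {μ : ℕ → ProbabilityMeasure ℝ}
    (hμ : ∀ n, IsCompoundPoisson (μ n) ∧ (μ n : Measure ℝ).support ⊆ Set.Ici 0) :
    ∃ ν : ℕ → ProbabilityMeasure ℝ, IsLeftHeavyTwoPointSequence ν ∧
      Conjugate (tailAct μ) (tailAct ν) := by
  choose m hfin hm using fun n => (hμ n).1
  obtain ⟨p, d, ν, h, hc⟩ := exists_twoPoint_conjugate (m := fun n => (m n).restrict {0}ᶜ)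
    (fun n => by rw [hm, compoundPoisson_restrict_compl_zero]) (s := Set.Ioi 0) ⟨1, by simp⟩
    (fun n => by
      rw [Set.compl_Ioi, Measure.restrict_apply measurableSet_Iic]
      refine measure_mono_null ?_ (measure_Iio_eq_zero_of_compoundPoisson (m := m n) ?_)
      · rintro x ⟨hx, hx'⟩
        exact lt_of_le_of_ne hx hx'
      · rw [← hm]
        exact (hμ n).2)
  refine ⟨ν, ⟨fun n => ?_, ⟨1, ?_⟩⟩, hc⟩
  · obtain ⟨h1, h2, h3, h4, h5⟩ := h n
    have h4' : (0 : ℝ) < d n := h4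
    refine ⟨0, d n, h4', ?_⟩
    rw [h5, support_twoPoint h1 (by linarith), (twoPoint_real_singleton h4'.ne).1,
      (twoPoint_real_singleton h4'.ne).2]
    exact ⟨rfl, ENNReal.ofReal_le_ofReal (by linarith)⟩
  · rintro _ ⟨n, rfl⟩
    obtain ⟨h1, h2, h3, h4, h5⟩ := h n
    simp only [h5]
    rw [variance_twoPoint h1.le (by linarith), sub_zero]
    nlinarith [sq_nonneg (d n), mul_nonneg h1.le (sq_nonneg (d n))]

end TailFlow

namespace TailFlow

/-! ### Bounded harmonic functions and periods -/

section Harmonic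

variable {μ : ℕ → ProbabilityMeasure ℝ}

theorem indepFun_eval_shift (μ : ℕ → ProbabilityMeasure ℝ) (n : ℕ) :
    IndepFun (past id n : (ℕ → ℝ) → ℕ → ℝ) (fun (y : ℕ → ℝ) k => y (n + k))
      (Measure.infinitePi fun k => (μ k : Measure ℝ)) := by
  have h := (indepFun_past_future id (fun k => (μ k : Measure ℝ)) n).comp
    (φ := id) (ψ := fun (y : ℕ → ℝ) k => y (n + k)) measurable_id (by fun_prop)
  have e : (fun (y : ℕ → ℝ) k => y (n + k)) ∘ (future id n : (ℕ → ℝ) → ℕ → ℝ) =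
      fun (y : ℕ → ℝ) k => y (n + k) := by
    ext y k
    simp [future]
  rwa [e, Function.id_comp] at h

/-- `G n` is `g n` averaged over the future. Averaging over the step with law `μ n` first gives the
harmonic relation. The sequence `G` determines `F` as a limit, and `F` determines each `G n`, so
both have the same invariance under translations. -/
theorem exists_harmonic (F : tailBoundary μ) : ∃ (C : ℝ) (G : ℕ → ℝ → ℂ),
    (∀ n, Measurable (G n)) ∧ (∀ n x, ‖G n x‖ ≤ C) ∧
    (∀ᵐ z ∂(pathMeasure μ), Tendsto (fun n => G n (z.1 + ∑ i ∈ Finset.range n, z.2 i)) atTop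
      (𝓝 ((F : ℝ × (ℕ → ℝ) →ₘ[pathMeasure μ] ℂ) z))) ∧
    (∀ n, ∀ᵐ x : ℝ, G n x = ∫ y, G (n + 1) (x + y) ∂(μ n : Measure ℝ)) ∧
    ∀ e, tailAct μ e F = F ↔ ∀ n, ∀ᵐ x : ℝ, G n (x + e) = G n x := by
  obtain ⟨C, g, hg, hC, hFg⟩ := tailBoundary.exists_factor F
  set P := Measure.infinitePi fun k => (μ k : Measure ℝ) with hP
  let sh : ℕ → (ℕ → ℝ) → ℕ → ℝ := fun n y k => y (n + k)
  let S : ℕ → (ℕ → ℝ) → ℝ := fun n y => ∑ i ∈ Finset.range n, y i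
  have hsh : ∀ n, Measurable (sh n) := fun n => by fun_prop
  have hS : ∀ n, Measurable (S n) := fun n => by fun_prop
  have hSp : ∀ n y, S n (past id n y) = S n y := fun n y =>
    Finset.sum_congr rfl fun i hi => by simp [past, Finset.mem_range.1 hi]
  let G : ℕ → ℝ → ℂ := fun n x => ∫ y, g n (x, sh n y) ∂P
  have hGm : ∀ n, Measurable (G n) := fun n => by
    have : StronglyMeasurable (Function.uncurry fun (x : ℝ) y => g n (x, sh n y)) :=
      ((hg n).comp (measurable_fst.prodMk ((hsh n).comp measurable_snd))).stronglyMeasurable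
    exact this.integral_prod_right.measurable
  have hGC : ∀ n x, ‖G n x‖ ≤ C := fun n x => by
    simpa using norm_integral_le_of_norm_le_const (μ := P) (ae_of_all _ fun y => hC n (x, sh n y))
  have hmp : ∀ n, MeasurePreserving (fun z : ℝ × (ℕ → ℝ) => (z.1 - S n z.2, z.2))
      (pathMeasure μ) (pathMeasure μ) := fun n => by
    have := measurePreserving_shear (τ := fun y => - S n y) (hS n).neg (MeasurePreserving.id P)
    simp only [← sub_eq_add_neg, id] at this
    exact this
  have hmp' : ∀ n, MeasurePreserving (fun z : ℝ × (ℕ → ℝ) => (z.1 + S n z.2, z.2))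
      (pathMeasure μ) (pathMeasure μ) := fun n =>
    measurePreserving_shear (hS n) (MeasurePreserving.id P)
  have hlim : ∀ᵐ z ∂(pathMeasure μ), Tendsto (fun n => G n (z.1 + S n z.2)) atTop
      (𝓝 ((F : ℝ × (ℕ → ℝ) →ₘ[pathMeasure μ] ℂ) z)) := by
    have := ae_tendsto_integral_walk (P := P) (measurable_past id) hsh
      (fun n => indepFun_eval_shift μ n) (monotone_comap_past id)
      (le_iSup_comap_past id) hS hg hC (F := (F : ℝ × (ℕ → ℝ) →ₘ[pathMeasure μ] ℂ))
      (AEEqFun.measurable _)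
      (fun n => by simp only [hSp]; exact hFg n)
    simp only [hSp] at this
    exact this
  refine ⟨C, G, hGm, hGC, hlim, fun n => ?_, fun e => ⟨fun he n => ?_, fun he => ?_⟩⟩
  · have h1 : ∀ᵐ z ∂(pathMeasure μ), g n (z.1, sh n z.2) = g (n + 1) (z.1 + z.2 n, sh (n + 1) z.2) := by
      filter_upwards [(hmp n).quasiMeasurePreserving.ae (hFg n),
        (hmp n).quasiMeasurePreserving.ae (hFg (n + 1))] with z h1 h2
      rw [h1] at h2
      simp only [Function.comp_apply, walk, S, Finset.sum_range_succ] at h2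
      simp only [sub_add_cancel, ← add_assoc] at h2
      exact h2
    filter_upwards [Measure.ae_ae_of_ae_prod h1] with x hx
    have hind : IndepFun (fun y : ℕ → ℝ => y n) (sh (n + 1)) P := by
      have hn : Measurable fun y : ℕ → ℝ => y n := measurable_pi_apply n
      have := (indepFun_eval_shift μ (n + 1)).comp hn measurable_id
      have e : (fun y : ℕ → ℝ => y n) ∘ (past id (n + 1) : (ℕ → ℝ) → ℕ → ℝ) = fun y => y n := by
        ext y
        simp [past]
      rwa [e, Function.id_comp] at this
    have hlaw := (indepFun_iff_map_prod_eq_prod_map_map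
      (measurable_pi_apply n).aemeasurable (hsh (n + 1)).aemeasurable).1 hind
    have hmn : P.map (fun y : ℕ → ℝ => y n) = (μ n : Measure ℝ) :=
      (measurePreserving_eval_infinitePi (fun k => (μ k : Measure ℝ)) n).map_eq
    have : IsProbabilityMeasure (P.map (sh (n + 1))) :=
      Measure.isProbabilityMeasure_map (hsh (n + 1)).aemeasurable
    have hgm : Measurable fun w : ℝ × (ℕ → ℝ) => g (n + 1) (x + w.1, w.2) :=
      (hg (n + 1)).comp (by fun_prop)
    calc G n x = ∫ y, g (n + 1) (x + y n, sh (n + 1) y) ∂P := integral_congr_ae hx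
      _ = ∫ w, g (n + 1) (x + w.1, w.2) ∂(P.map fun y => (y n, sh (n + 1) y)) := by
          rw [integral_map (by fun_prop) hgm.aestronglyMeasurable]
      _ = ∫ y, ∫ w, g (n + 1) (x + y, w) ∂(P.map (sh (n + 1))) ∂(μ n : Measure ℝ) := by
          rw [hlaw, hmn, integral_prod _ (Integrable.of_bound hgm.aestronglyMeasurable C
            (ae_of_all _ fun w => hC _ _))]
      _ = _ := by
          congr 1
          ext y
          have hm : Measurable fun w : ℕ → ℝ => g (n + 1) (x + y, w) :=
            (hg (n + 1)).comp (by fun_prop)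
          rw [integral_map (hsh _).aemeasurable hm.aestronglyMeasurable]
  · have h0 := tailAct_ae e F
    rw [he] at h0
    have h1 : ∀ᵐ z ∂(pathMeasure μ), g n (z.1 + e, sh n z.2) = g n (z.1, sh n z.2) := by
      have hT := (translate_measurePreserving μ e).quasiMeasurePreserving
      have h2 : ∀ᵐ z ∂(pathMeasure μ), (F : ℝ × (ℕ → ℝ) →ₘ[pathMeasure μ] ℂ) (translate e z) =
          (F : ℝ × (ℕ → ℝ) →ₘ[pathMeasure μ] ℂ) z := by
        filter_upwards [hT.ae h0] with z hz
        simpa [translate] using hz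
      have h3 : ∀ᵐ z ∂(pathMeasure μ), g n (walk n (translate e z)) = g n (walk n z) := by
        filter_upwards [h2, hFg n, hT.ae (hFg n)] with z h2 h3 h4
        rw [h3, h4] at h2
        exact h2
      filter_upwards [(hmp n).quasiMeasurePreserving.ae h3] with z hz
      simp only [walk, translate, S] at hz
      convert hz using 3 <;> ring
    filter_upwards [Measure.ae_ae_of_ae_prod h1] with x hx
    exact integral_congr_ae hx
  · have h1 : ∀ᵐ z ∂(pathMeasure μ), ∀ n, G n (z.1 + S n z.2 + e) = G n (z.1 + S n z.2) := by
      rw [ae_all_iff]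
      intro n
      have hq : Measure.QuasiMeasurePreserving (fun z : ℝ × (ℕ → ℝ) => z.1 + S n z.2)
          (pathMeasure μ) volume :=
        Measure.quasiMeasurePreserving_fst.comp (hmp' n).quasiMeasurePreserving
      exact hq.ae (he n)
    have h2 : ∀ᵐ z ∂(pathMeasure μ), (F : ℝ × (ℕ → ℝ) →ₘ[pathMeasure μ] ℂ) (translate e z) =
        (F : ℝ × (ℕ → ℝ) →ₘ[pathMeasure μ] ℂ) z := by
      filter_upwards [h1, hlim,
        (translate_measurePreserving μ e).quasiMeasurePreserving.ae hlim] with z h1 h2 h3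
      refine tendsto_nhds_unique h3 (h2.congr fun n => ?_)
      rw [← h1 n]
      simp only [translate]
      congr 1
      ring
    refine Subtype.ext (AEEqFun.ext ?_)
    filter_upwards [tailAct_ae e F,
      (translate_measurePreserving μ (-e)).quasiMeasurePreserving.ae h2] with z h3 h4
    rw [h3]
    simp only [translate, neg_add_cancel_right] at h4
    rw [← sub_eq_add_neg] at h4
    exact h4.symm

/-- The relations for `G n` hold only almost everywhere. Integrating over the window from `x` to `x
+ h` gives Lipschitz functions for which they hold everywhere. All `h` are kept so that no
invariance is lost. -/
theorem exists_smooth_harmonic (F : tailBoundary μ) : ∃ (C : ℝ) (u : ℝ → ℕ → ℝ → ℂ), 0 ≤ C ∧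
    (∀ h n x, ‖u h n x‖ ≤ C * |h|) ∧ (∀ h n x y, ‖u h n x - u h n y‖ ≤ 2 * C * |x - y|) ∧
    (∀ h n x, u h n x = ∫ y, u h (n + 1) (x + y) ∂(μ n : Measure ℝ)) ∧
    ∀ e, tailAct μ e F = F ↔ ∀ h n x, u h n (x + e) = u h n x := by
  obtain ⟨C, G, hGm, hGC, -, hG, hper⟩ := exists_harmonic F
  have hC0 : 0 ≤ C := (norm_nonneg _).trans (hGC 0 0)
  have hint : ∀ n a b, IntervalIntegrable (G n) volume a b := fun n a b =>
    intervalIntegrable_const.mono_fun' (g := fun _ => C) (hGm n).aestronglyMeasurable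
      (ae_of_all _ fun x => hGC n x)
  have hnorm : ∀ n a b, ‖∫ s in a..b, G n s‖ ≤ C * |b - a| := fun n a b =>
    intervalIntegral.norm_integral_le_of_norm_le_const fun x _ => hGC n x
  let u : ℝ → ℕ → ℝ → ℂ := fun h n x => ∫ s in x..x + h, G n s
  refine ⟨C, u, hC0, fun h n x => ?_, fun h n x y => ?_, fun h n x => ?_, fun e => ?_⟩
  · simpa using hnorm n x (x + h)
  · simp only [u]
    rw [intervalIntegral.integral_interval_sub_interval_comm (hint _ _ _) (hint _ _ _) (hint _ _ _)]
    refine (norm_sub_le _ _).trans ((add_le_add (hnorm _ _ _) (hnorm _ _ _)).trans (le_of_eq ?_))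
    rw [show y + h - (x + h) = y - x by ring, abs_sub_comm]
    ring
  · have h1 : u h n x = ∫ s in x..x + h, ∫ y, G (n + 1) (s + y) ∂(μ n : Measure ℝ) :=
      intervalIntegral.integral_congr_ae ((hG n).mono fun s hs _ => hs)
    rw [h1, intervalIntegral_integral_swap]
    · congr 1
      ext y
      rw [intervalIntegral.integral_comp_add_right]
      simp only [u]
      congr 1
      ring
    · have : IsFiniteMeasure ((volume : Measure ℝ).restrict (Set.uIoc x (x + h))) :=
        inferInstanceAs (IsFiniteMeasure (volume.restrict (Set.Ioc _ _)))
      refine Integrable.of_bound (C := C) ?_ (ae_of_all _ fun w => hGC _ _)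
      exact ((hGm (n + 1)).comp (measurable_fst.add measurable_snd)).aestronglyMeasurable
  · rw [hper]
    constructor
    · intro he h n x
      simp only [u]
      have : ∫ s in x + e..x + e + h, G n s = ∫ s in x..x + h, G n (s + e) := by
        rw [intervalIntegral.integral_comp_add_right]
        congr 1
        ring
      rw [this]
      exact intervalIntegral.integral_congr_ae ((he n).mono fun s hs _ => hs)
    · intro he n
      have hloc : LocallyIntegrable (fun s => G n (s + e) - G n s) volume := by
        refine (locallyIntegrable_const (C + C)).mono ?_ (ae_of_all _ fun x => ?_)
        · exact (((hGm n).comp (measurable_id.add_const e)).sub (hGm n)).aestronglyMeasurable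
        · rw [Real.norm_of_nonneg (by linarith)]
          exact (norm_sub_le _ _).trans (add_le_add (hGC _ _) (hGC _ _))
      -- The windows starting at 0 show that the primitive of `G n (· + e) - G n` vanishes, so by
      -- Lebesgue differentiation its integrand vanishes almost everywhere.
      filter_upwards [_root_.LocallyIntegrable.ae_hasDerivAt_integral hloc] with x hx
      have hz : ∀ y, ∫ s in (0 : ℝ)..y, (G n (s + e) - G n s) = 0 := fun y => by
        rw [intervalIntegral.integral_sub (by
            simpa using (hint n (0 + e) (y + e)).comp_add_right e) (hint _ _ _),
          intervalIntegral.integral_comp_add_right, sub_eq_zero]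
        have := he y n 0
        simp only [u] at this
        rw [zero_add, zero_add] at this
        rw [zero_add, ← this, add_comm y e]
      have h0 := hx 0
      simp only [hz] at h0
      exact sub_eq_zero.1 (h0.unique (hasDerivAt_const x 0))

/-- The exceptional null set depends on `e`. Fubini provides one point `x` with `G (x + y) = G x`
for almost every `y`. -/
theorem exists_ae_eq_const_of_forall_add {G : ℝ → ℂ} (hG : Measurable G)
    (h : ∀ e, ∀ᵐ x, G (x + e) = G x) : ∃ c, ∀ᵐ x, G x = c := by
  have hm : MeasurableSet {z : ℝ × ℝ | G (z.2 + z.1) = G z.2} :=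
    measurableSet_eq_fun (hG.comp (by fun_prop)) (hG.comp measurable_snd)
  have h1 : ∀ᵐ z ∂((volume : Measure ℝ).prod volume), G (z.2 + z.1) = G z.2 :=
    (Measure.ae_prod_iff_ae_ae hm).2 (ae_of_all _ h)
  have h2 : ∀ᵐ z ∂((volume : Measure ℝ).prod volume), G (z.1 + z.2) = G z.1 :=
    Measure.measurePreserving_swap.quasiMeasurePreserving.ae h1
  obtain ⟨x, hx⟩ := (Measure.ae_ae_of_ae_prod h2).exists
  refine ⟨G x, ?_⟩
  have := (measurePreserving_add_left (volume : Measure ℝ) (-x)).quasiMeasurePreserving.ae hx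
  filter_upwards [this] with y hy
  simpa using hy

/-- All `G n` are constant, hence so is the limit of the `G n` along the walk. This gives the
ergodicity of every tail boundary flow. -/
theorem eq_algebraMap_of_forall_tailAct_eq (F : tailBoundary μ) (h : ∀ e, tailAct μ e F = F) :
    ∃ c : ℂ, F = algebraMap ℂ (tailBoundary μ) c := by
  obtain ⟨C, G, hGm, -, hlim, -, hper⟩ := exists_harmonic F
  choose c hc using fun n => exists_ae_eq_const_of_forall_add (hGm n) fun e => (hper e).1 (h e) n
  have h1 : ∀ᵐ z ∂(pathMeasure μ), ∀ n, G n (z.1 + ∑ i ∈ Finset.range n, z.2 i) = c n := by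
    rw [ae_all_iff]
    intro n
    have hq : Measure.QuasiMeasurePreserving
        (fun z : ℝ × (ℕ → ℝ) => z.1 + ∑ i ∈ Finset.range n, z.2 i) (pathMeasure μ) volume :=
      Measure.quasiMeasurePreserving_fst.comp
        (measurePreserving_walk μ n).quasiMeasurePreserving
    exact hq.ae (hc n)
  have h2 : ∀ᵐ z ∂(pathMeasure μ), (F : ℝ × (ℕ → ℝ) →ₘ[pathMeasure μ] ℂ) z = limUnder atTop c := by
    filter_upwards [h1, hlim] with z h1 h2
    simp only [h1] at h2
    exact h2.limUnder_eq.symm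
  refine ⟨limUnder atTop c, Subtype.ext (AEEqFun.ext ?_)⟩
  exact EventuallyEq.trans h2 (coeFn_algebraMap (m := pathMeasure μ) _).symm

/-- The indicator of an invariant set is an invariant element of L^∞; its image in the tail boundary
is a constant, so the indicator is 0 or 1. -/
theorem Flow.isErgodic_of_conjugate {Z : Type*} [MeasurableSpace Z] {η : Measure Z} (α : Flow η)
    (h : Conjugate α.act (tailAct μ)) : α.IsErgodic := by
  obtain ⟨Φ, hΦ⟩ := h
  intro U hU hinv
  have hm : AEStronglyMeasurable (U.indicator fun _ => (1 : ℂ)) η :=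
    (stronglyMeasurable_const.indicator hU).aestronglyMeasurable
  let X : Linfty η := ⟨AEEqFun.mk _ hm, 1, by
    filter_upwards [AEEqFun.coeFn_mk _ hm] with z hz
    rw [hz]
    by_cases h : z ∈ U <;> simp [h]⟩
  have hX : ∀ t, α.act t X = X := fun t => by
    refine Subtype.ext (AEEqFun.ext ?_)
    have hset : ∀ᵐ z ∂η, (α.map (-t) z ∈ U) = (z ∈ U) := hinv (-t)
    filter_upwards [AEEqFun.coeFn_compQuasiMeasurePreserving (X : Z →ₘ[η] ℂ) (α.quasi (-t)),
      (α.quasi (-t)).ae (AEEqFun.coeFn_mk _ hm), AEEqFun.coeFn_mk _ hm, hset] with z h1 h2 h3 h4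
    refine h1.trans (h2.trans (Eq.trans ?_ h3.symm))
    by_cases h5 : z ∈ U
    · rw [Set.indicator_of_mem h5, Set.indicator_of_mem (h4.mpr h5)]
    · rw [Set.indicator_of_notMem h5, Set.indicator_of_notMem fun h => h5 (h4.mp h)]
  obtain ⟨c, hc⟩ := eq_algebraMap_of_forall_tailAct_eq (Φ X) fun e => by rw [← hΦ, hX]
  have hXc : X = algebraMap ℂ (Linfty η) c := by
    refine EquivLike.injective Φ ?_
    rw [hc, Algebra.algebraMap_eq_smul_one, Algebra.algebraMap_eq_smul_one, map_smul, map_one]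
  have hae : ∀ᵐ z ∂η, U.indicator (fun _ => (1 : ℂ)) z = c := by
    have h1 : (X : Z →ₘ[η] ℂ) = algebraMap ℂ (Z →ₘ[η] ℂ) c := congrArg Subtype.val hXc
    filter_upwards [AEEqFun.coeFn_mk _ hm, coeFn_algebraMap (m := η) c] with z h2 h3
    rw [← h2, ← h3]
    exact congrArg (fun f : Z →ₘ[η] ℂ => f z) h1
  by_cases h1 : c = 1
  · right
    change ∀ᵐ z ∂η, z ∈ U
    filter_upwards [hae] with z hz
    by_contra hzU
    rw [Set.indicator_of_notMem hzU, h1] at hz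
    exact zero_ne_one hz
  · left
    refine measure_eq_zero_iff_ae_notMem.2 ?_
    filter_upwards [hae] with z hz hzU
    rw [Set.indicator_of_mem hzU] at hz
    exact h1 hz.symm

/-- The periods of the tail boundary. -/
def periods (μ : ℕ → ProbabilityMeasure ℝ) : AddSubgroup ℝ where
  carrier := {e | IsPeriod μ e}
  zero_mem' := isPeriod_zero μ
  add_mem' {a b} ha hb F := by
    obtain ⟨C, u, -, -, -, -, hper⟩ := exists_smooth_harmonic F
    refine (hper _).2 fun h n x => ?_
    rw [← add_assoc, (hper b).1 (hb F), (hper a).1 (ha F)]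
  neg_mem' {a} ha F := by
    obtain ⟨C, u, -, -, -, -, hper⟩ := exists_smooth_harmonic F
    refine (hper _).2 fun h n x => ?_
    rw [← (hper a).1 (ha F), neg_add_cancel_right]

theorem mem_periods {e : ℝ} : e ∈ periods μ ↔ IsPeriod μ e := Iff.rfl

/-- For the continuous averages `u h n`, periods pass to limits. -/
theorem isClosed_periods (μ : ℕ → ProbabilityMeasure ℝ) : IsClosed (periods μ : Set ℝ) := by
  refine IsSeqClosed.isClosed fun e a he ha F => ?_
  obtain ⟨C, u, hC, -, hlip, -, hper⟩ := exists_smooth_harmonic F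
  refine (hper _).2 fun h n x => ?_
  have hc : Continuous (u h n) := by
    refine (LipschitzWith.of_dist_le_mul (K := ⟨2 * C, by positivity⟩) fun x y => ?_).continuous
    rw [dist_eq_norm, Real.dist_eq]
    exact hlip h n x y
  refine tendsto_nhds_unique (((hc.tendsto _).comp (ha.const_add x)).congr fun k => ?_)
    tendsto_const_nhds
  exact (hper _).1 (he k F) h n x

theorem Conjugate.isPeriod {ν : ℕ → ProbabilityMeasure ℝ} (h : Conjugate (tailAct μ) (tailAct ν))
    {e : ℝ} (he : IsPeriod μ e) : IsPeriod ν e := by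
  obtain ⟨Φ, hΦ⟩ := h
  intro F
  obtain ⟨F, rfl⟩ := EquivLike.surjective Φ F
  rw [← hΦ, he F]

theorem Conjugate.periods_eq {ν : ℕ → ProbabilityMeasure ℝ}
    (h : Conjugate (tailAct μ) (tailAct ν)) : periods μ = periods ν :=
  SetLike.ext fun _ => ⟨fun he => h.isPeriod he, fun he => h.symm.isPeriod he⟩

end Harmonic

end TailFlow

namespace TailFlow

/-! ### The mirror coupling -/

theorem tendsto_prod_one_sub_of_not_summable {f : ℕ → ℝ} (h0 : ∀ k, 0 ≤ f k) (h1 : ∀ k, f k ≤ 1)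
    (hf : ¬ Summable f) (n : ℕ) :
    Tendsto (fun j => ∏ i ∈ Finset.range j, (1 - f (n + i))) atTop (𝓝 0) := by
  have hf' : ¬ Summable fun i => f (n + i) := by
    simp only [add_comm n]
    rwa [summable_nat_add_iff n]
  have ht := (not_summable_iff_tendsto_nat_atTop_of_nonneg fun i => h0 (n + i)).1 hf'
  refine squeeze_zero (fun j => Finset.prod_nonneg fun i _ => by linarith [h1 (n + i)])
    (fun j => ?_) (Real.tendsto_exp_neg_atTop_nhds_zero.comp ht)
  rw [Function.comp_apply, ← Finset.sum_neg_distrib, Real.exp_sum]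
  exact Finset.prod_le_prod (fun i _ => by linarith [h1 (n + i)])
    fun i _ => by linarith [Real.add_one_le_exp (-f (n + i))]

/-- `μ` contains a fair coin of mass `q` between two points at distance `g`. -/
def HasCoin (μ : Measure ℝ) (q g : ℝ) : Prop :=
  ∃ a, ENNReal.ofReal (q / 2) • (Measure.dirac a + Measure.dirac (a + g)) ≤ μ

theorem hasCoin_zero (μ : Measure ℝ) (g : ℝ) : HasCoin μ 0 g :=
  ⟨0, by simp [Measure.zero_le]⟩

/-- One step of the mirror coupling. Outside the coin both copies move together and keep the
distance `D`; on the coin equal faces are avoided, and the distance becomes `D + e` or `D - e`, each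
with mass q/2. The true gap `g` may be replaced by `e` because `v` does not distinguish them. -/
theorem norm_integral_add_sub_le {μ : Measure ℝ} [IsProbabilityMeasure μ] {q g e D A A' A'' B : ℝ}
    (hq : 0 ≤ q) (hc : HasCoin μ q g) {v : ℝ → ℂ} (hv : Measurable v) (hvB : ∀ x, ‖v x‖ ≤ B)
    (hge : ∀ x, v (x + g) = v (x + e)) (hA : ∀ x, ‖v (x + D) - v x‖ ≤ A)
    (hA' : ∀ x, ‖v (x + (D + e)) - v x‖ ≤ A') (hA'' : ∀ x, ‖v (x + (D - e)) - v x‖ ≤ A'') (x : ℝ) :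
    ‖∫ y, v (x + D + y) ∂μ - ∫ y, v (x + y) ∂μ‖ ≤ (1 - q) * A + q / 2 * (A' + A'') := by
  obtain ⟨a, ha⟩ := hc
  set κ := ENNReal.ofReal (q / 2) • (Measure.dirac a + Measure.dirac (a + g)) with hκ
  have hκf : IsFiniteMeasure κ := Measure.smul_finite _ (by simp)
  obtain ⟨ρ, hρ⟩ : ∃ ρ : Measure ℝ, ρ + κ = μ := ⟨μ - κ, Measure.sub_add_cancel_of_le ha⟩
  have hρf : IsFiniteMeasure ρ := ⟨by
    have : ρ Set.univ ≤ μ Set.univ := by rw [← hρ]; exact le_self_add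
    exact this.trans_lt (measure_lt_top _ _)⟩
  have hmass : ρ.real Set.univ = 1 - q := by
    have h1 : μ.real Set.univ = 1 := by simp
    rw [← hρ, measureReal_add_apply, hκ, measureReal_ennreal_smul_apply, measureReal_add_apply] at h1
    rw [ENNReal.toReal_ofReal (by linarith)] at h1
    simp only [probReal_univ] at h1
    linarith
  have hint : ∀ (m : Measure ℝ) [IsFiniteMeasure m] (z : ℝ), Integrable (fun y => v (z + y)) m :=
    fun m _ z => Integrable.of_bound (hv.comp (by fun_prop)).aestronglyMeasurable B
      (ae_of_all _ fun y => hvB _)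
  have hsplit : ∀ z, ∫ y, v (z + y) ∂μ =
      ∫ y, v (z + y) ∂ρ + (q / 2 : ℝ) • (v (z + a) + v (z + a + e)) := fun z => by
    rw [← hρ, integral_add_measure (hint ρ z) (hint κ z), hκ, integral_smul_measure,
      integral_add_measure (hint _ z) (hint _ z), integral_dirac, integral_dirac,
      ENNReal.toReal_ofReal (by linarith), ← add_assoc, hge]
  have h1 : ‖∫ y, (v (x + D + y) - v (x + y)) ∂ρ‖ ≤ (1 - q) * A := by
    have := norm_integral_le_of_norm_le_const (μ := ρ) (f := fun y => v (x + D + y) - v (x + y))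
      (C := A) (ae_of_all _ fun y => by
        have := hA (x + y)
        rwa [add_right_comm] at this)
    rwa [hmass, mul_comm] at this
  have h2 : ‖v (x + D + a + e) - v (x + a)‖ ≤ A' := by
    convert hA' (x + a) using 3
    ring_nf
  have h3 : ‖v (x + D + a) - v (x + a + e)‖ ≤ A'' := by
    convert hA'' (x + a + e) using 3
    ring_nf
  rw [hsplit, hsplit]
  have e1 : ∫ y, v (x + D + y) ∂ρ + (q / 2 : ℝ) • (v (x + D + a) + v (x + D + a + e)) -
      (∫ y, v (x + y) ∂ρ + (q / 2 : ℝ) • (v (x + a) + v (x + a + e))) =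
      ∫ y, (v (x + D + y) - v (x + y)) ∂ρ + (q / 2 : ℝ) • ((v (x + D + a + e) - v (x + a)) +
        (v (x + D + a) - v (x + a + e))) := by
    rw [integral_sub (hint ρ _) (hint ρ _)]
    simp only [smul_add, smul_sub]
    ring
  rw [e1]
  refine (norm_add_le _ _).trans (add_le_add h1 ?_)
  rw [norm_smul, Real.norm_of_nonneg (by linarith)]
  exact mul_le_mul_of_nonneg_left ((norm_add_le _ _).trans (add_le_add h2 h3)) (by linarith)

section Mirror

variable {μ : ℕ → ProbabilityMeasure ℝ} {u : ℕ → ℝ → ℂ} {B L : ℝ} {q g e : ℕ → ℝ}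

/-- Gambler's ruin for the distance `D`, by a comparison function instead of stopping times. The
linear term is a martingale under the symmetric moves ±e, and (D+ε)(R+ε-D) decreases by q e² on
average. So the factor in front of it can be multiplied by 1 - c q e² at each step, and it tends to
0 because Σ q e² diverges. -/
theorem norm_sub_le_of_small_steps (hm : ∀ n, Measurable (u n)) (hB : ∀ n x, ‖u n x‖ ≤ B / 2)
    (hlip : ∀ n x y, ‖u n x - u n y‖ ≤ L * |x - y|)
    (hu : ∀ n x, u n x = ∫ y, u (n + 1) (x + y) ∂(μ n : Measure ℝ))
    (hq0 : ∀ k, 0 ≤ q k) (hq1 : ∀ k, q k ≤ 1) (hc : ∀ k, HasCoin (μ k) (q k) (g k))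
    (hge : ∀ n k x, u n (x + g k) = u n (x + e k)) {ε R : ℝ} (hε : 0 < ε) (hR : 0 < R)
    (he : ∀ k, |e k| < ε) (hs : ¬ Summable fun k => q k * e k ^ 2) {D : ℝ} (hD0 : 0 < D)
    (hDR : D < R) (n : ℕ) (x : ℝ) : ‖u n (x + D) - u n x‖ ≤ L * ε + B * (D + ε) / R := by
  have hB0 : 0 ≤ B := by linarith [(norm_nonneg _).trans (hB 0 0)]
  have hL0 : 0 ≤ L := by simpa using (norm_nonneg _).trans (hlip 0 1 0)
  have hBB : ∀ n x y, ‖u n x - u n y‖ ≤ B := fun n x y => by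
    linarith [norm_sub_le (u n x) (u n y), hB n x, hB n y]
  have hRe : 0 < R + 2 * ε := by linarith
  -- Since (D+ε)(R+ε-D) ≤ (R+2ε)², an absolute decrease by q e² is a relative decrease by at least c
  -- q e².
  set c := ((R + 2 * ε) ^ 2)⁻¹ with hcdef
  have hc0 : 0 < c := by positivity
  have hce : ∀ k, e k ^ 2 ≤ (R + 2 * ε) ^ 2 := fun k => by
    have := he k
    rw [← sq_abs]
    have := abs_nonneg (e k)
    gcongr
    linarith
  have hf0 : ∀ k, 0 ≤ c * (q k * e k ^ 2) := fun k =>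
    mul_nonneg hc0.le (mul_nonneg (hq0 k) (sq_nonneg _))
  have hf1 : ∀ k, c * (q k * e k ^ 2) ≤ 1 := fun k => by
    rw [hcdef, inv_mul_le_iff₀ (by positivity), mul_one]
    nlinarith [hce k, hq1 k, hq0 k, sq_nonneg (e k)]
  set P : ℕ → ℕ → ℝ := fun n j => ∏ i ∈ Finset.range j, (1 - c * (q (n + i) * e (n + i) ^ 2))
  have hP0 : ∀ n j, 0 ≤ P n j := fun n j => Finset.prod_nonneg fun i _ => by linarith [hf1 (n + i)]
  have hbd : ∀ j n D, -ε < D → D < R + ε → ∀ x, (0 < D → D < R → ‖u n (x + D) - u n x‖ ≤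
      L * ε + B * (D + ε) / R + B / ε ^ 2 * P n j * ((D + ε) * (R + ε - D))) →
      ‖u n (x + D) - u n x‖ ≤
        L * ε + B * (D + ε) / R + B / ε ^ 2 * P n j * ((D + ε) * (R + ε - D)) := by
    intro j n D hD1 hD2 x hin
    have hw : 0 ≤ (D + ε) * (R + ε - D) := mul_nonneg (by linarith) (by linarith)
    have hlin : 0 ≤ B * (D + ε) / R := div_nonneg (mul_nonneg hB0 (by linarith)) hR.le
    have hlast : 0 ≤ B / ε ^ 2 * P n j * ((D + ε) * (R + ε - D)) :=
      mul_nonneg (mul_nonneg (by positivity) (hP0 n j)) hw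
    have hLe : 0 ≤ L * ε := by positivity
    rcases le_or_gt D 0 with h0 | h0
    · have h1 := hlip n (x + D) x
      rw [add_sub_cancel_left] at h1
      have h2 : |D| ≤ ε := abs_le.2 ⟨by linarith, by linarith⟩
      have h3 : L * |D| ≤ L * ε := by gcongr
      linarith
    rcases le_or_gt R D with h4 | h4
    · have h1 : B ≤ B * (D + ε) / R := by
        rw [le_div_iff₀ hR]
        gcongr
        linarith
      linarith [hBB n (x + D) x]
    exact hin h0 h4
  have key : ∀ j n D, -ε < D → D < R + ε → ∀ x, ‖u n (x + D) - u n x‖ ≤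
      L * ε + B * (D + ε) / R + B / ε ^ 2 * P n j * ((D + ε) * (R + ε - D)) := by
    intro j
    induction j with
    | zero =>
      intro n D hD1 hD2 x
      refine hbd 0 n D hD1 hD2 x fun h0 h4 => ?_
      have hlin : 0 ≤ B * (D + ε) / R := div_nonneg (mul_nonneg hB0 (by linarith)) hR.le
      have hLe : 0 ≤ L * ε := by positivity
      have h1 : B ≤ B / ε ^ 2 * P n 0 * ((D + ε) * (R + ε - D)) := by
        simp only [P, Finset.range_zero, Finset.prod_empty, mul_one]
        rw [div_mul_eq_mul_div, le_div_iff₀ (by positivity)]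
        gcongr
        nlinarith
      linarith [hBB n (x + D) x]
    | succ j ih =>
      intro n D hD1 hD2 x
      refine hbd (j + 1) n D hD1 hD2 x fun h0 h4 => ?_
      have hek := abs_lt.1 (he n)
      rw [hu n (x + D), hu n x]
      refine (norm_integral_add_sub_le (hq0 n) (hc n) (hm (n + 1)) (hB (n + 1)) (hge (n + 1) n)
        (ih (n + 1) D hD1 hD2) (ih (n + 1) (D + e n) (by linarith) (by linarith))
        (ih (n + 1) (D - e n) (by linarith) (by linarith)) x).trans ?_
      have hPs : P n (j + 1) = (1 - c * (q n * e n ^ 2)) * P (n + 1) j := by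
        simp only [P]
        rw [Finset.prod_range_succ', mul_comm, add_zero]
        congr 1
        refine Finset.prod_congr rfl fun i _ => ?_
        rw [add_assoc, add_comm 1 i]
      have hcw : c * ((D + ε) * (R + ε - D)) ≤ 1 := by
        rw [hcdef, inv_mul_le_iff₀ (by positivity), mul_one]
        nlinarith
      have e1 : B / ε ^ 2 * P n (j + 1) =
          (1 - c * (q n * e n ^ 2)) * (B / ε ^ 2 * P (n + 1) j) := by rw [hPs]; ring
      rw [e1]
      have hK0 : 0 ≤ B / ε ^ 2 * P (n + 1) j := mul_nonneg (by positivity) (hP0 _ _)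
      generalize B / ε ^ 2 * P (n + 1) j = K at hK0 ⊢
      have hmain : 0 ≤ K * (q n * e n ^ 2) * (1 - c * ((D + ε) * (R + ε - D))) :=
        mul_nonneg (mul_nonneg hK0 (mul_nonneg (hq0 n) (sq_nonneg _))) (by linarith)
      refine le_trans (b := L * ε + B * (D + ε) / R +
        K * ((D + ε) * (R + ε - D) - q n * e n ^ 2)) (le_of_eq (by ring)) ?_
      linarith
  have hlim := ((tendsto_prod_one_sub_of_not_summable hf0 hf1
    (by rwa [summable_mul_left_iff hc0.ne']) n).const_mul (B / ε ^ 2)).mul_const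
      ((D + ε) * (R + ε - D))
  have hlim' := hlim.const_add (L * ε + B * (D + ε) / R)
  rw [mul_zero, zero_mul, add_zero] at hlim'
  exact ge_of_tendsto' hlim' fun j => key j n D (by linarith) (by linarith) x

/-- The same argument for distances `i * e₀` with 0 ≤ i ≤ R. Replacing `e k` by `e₀` costs L η on
the mass `q k`, and this is paid by the decrease of i(R - i) by `q k` on average, hence the
coefficient L η + B P. -/
theorem norm_sub_le_of_steps_near (hm : ∀ n, Measurable (u n)) (hB : ∀ n x, ‖u n x‖ ≤ B / 2)
    (hlip : ∀ n x y, ‖u n x - u n y‖ ≤ L * |x - y|)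
    (hu : ∀ n x, u n x = ∫ y, u (n + 1) (x + y) ∂(μ n : Measure ℝ))
    (hq0 : ∀ k, 0 ≤ q k) (hq1 : ∀ k, q k ≤ 1) (hc : ∀ k, HasCoin (μ k) (q k) (g k))
    (hge : ∀ n k x, u n (x + g k) = u n (x + e k)) {η e₀ : ℝ} {R : ℕ} (hη : 0 < η)
    (he : ∀ k, |e k - e₀| < η) (hs : ¬ Summable q) (hR : 0 < R) (n : ℕ) (x : ℝ) :
    ‖u n (x + e₀) - u n x‖ ≤ B / R + L * η * (R - 1) := by
  have hB0 : 0 ≤ B := by linarith [(norm_nonneg _).trans (hB 0 0)]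
  have hL0 : 0 ≤ L := by simpa using (norm_nonneg _).trans (hlip 0 1 0)
  have hBB : ∀ n x y, ‖u n x - u n y‖ ≤ B := fun n x y => by
    linarith [norm_sub_le (u n x) (u n y), hB n x, hB n y]
  have hR1 : (1 : ℝ) ≤ R := by exact_mod_cast hR
  set c := ((R : ℝ) ^ 2)⁻¹ with hcdef
  have hc0 : 0 < c := by positivity
  have hc1 : c ≤ 1 := inv_le_one_of_one_le₀ (by nlinarith)
  have hf0 : ∀ k, 0 ≤ c * q k := fun k => mul_nonneg hc0.le (hq0 k)
  have hf1 : ∀ k, c * q k ≤ 1 := fun k => by nlinarith [hq0 k, hq1 k]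
  set P : ℕ → ℕ → ℝ := fun n j => ∏ i ∈ Finset.range j, (1 - c * q (n + i))
  have hP0 : ∀ n j, 0 ≤ P n j := fun n j => Finset.prod_nonneg fun i _ => by linarith [hf1 (n + i)]
  have hbd : ∀ (j n i : ℕ), i ≤ R → ∀ x, (1 ≤ i → i + 1 ≤ R → ‖u n (x + i * e₀) - u n x‖ ≤
      B * i / R + (L * η + B * P n j) * (i * (R - i))) → ‖u n (x + i * e₀) - u n x‖ ≤
        B * i / R + (L * η + B * P n j) * (i * (R - i)) := by
    intro j n i hi x hin
    rcases Nat.eq_zero_or_pos i with rfl | hipos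
    · simp
    rcases hi.eq_or_lt with rfl | hlt
    · have h1 : B * i / i = B := by rw [mul_div_assoc, div_self (by linarith), mul_one]
      rw [h1, sub_self, mul_zero, mul_zero, add_zero]
      exact hBB n _ _
    exact hin hipos hlt
  have hLη : 0 ≤ L * η := by positivity
  have key : ∀ (j n i : ℕ), i ≤ R → ∀ x, ‖u n (x + i * e₀) - u n x‖ ≤
      B * i / R + (L * η + B * P n j) * (i * (R - i)) := by
    intro j
    induction j with
    | zero =>
      intro n i hi x
      refine hbd 0 n i hi x fun hi1 hi2 => ?_
      have hi1' : (1 : ℝ) ≤ i := by exact_mod_cast hi1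
      have hi2' : (i : ℝ) + 1 ≤ R := by exact_mod_cast hi2
      have hw1 : (1 : ℝ) ≤ i * (R - i) := by nlinarith
      have hlin : 0 ≤ B * i / R := by positivity
      have h1 : B ≤ (L * η + B * P n 0) * (i * (R - i)) := by
        simp only [P, Finset.range_zero, Finset.prod_empty, mul_one]
        nlinarith [mul_nonneg hLη (zero_le_one.trans hw1), mul_nonneg hB0 (sub_nonneg.2 hw1)]
      exact (hBB n _ _).trans (h1.trans (le_add_of_nonneg_left hlin))
    | succ j ih =>
      intro n i hi x
      refine hbd (j + 1) n i hi x fun hi1 hi2 => ?_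
      obtain ⟨i', rfl⟩ : ∃ i', i = i' + 1 := ⟨i - 1, by omega⟩
      have hi2' : ((i' + 1 : ℕ) : ℝ) + 1 ≤ R := by exact_mod_cast hi2
      have hA' : ∀ x, ‖u (n + 1) (x + (((i' + 1 : ℕ) : ℝ) * e₀ + e n)) - u (n + 1) x‖ ≤ L * η +
          (B * ((i' + 2 : ℕ) : ℝ) / R + (L * η + B * P (n + 1) j) *
            (((i' + 2 : ℕ) : ℝ) * (R - ((i' + 2 : ℕ) : ℝ)))) := fun x => by
        refine (norm_sub_le_norm_sub_add_norm_sub _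
          (u (n + 1) (x + ((i' + 2 : ℕ) : ℝ) * e₀)) _).trans
          (add_le_add ((hlip _ _ _).trans (mul_le_mul_of_nonneg_left ?_ hL0))
            (ih (n + 1) (i' + 2) (by omega) x))
        convert (he n).le using 2
        push_cast
        ring
      have hA'' : ∀ x, ‖u (n + 1) (x + (((i' + 1 : ℕ) : ℝ) * e₀ - e n)) - u (n + 1) x‖ ≤ L * η +
          (B * (i' : ℝ) / R + (L * η + B * P (n + 1) j) * ((i' : ℝ) * (R - (i' : ℝ)))) := fun x => by
        refine (norm_sub_le_norm_sub_add_norm_sub _ (u (n + 1) (x + (i' : ℝ) * e₀)) _).trans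
          (add_le_add ((hlip _ _ _).trans (mul_le_mul_of_nonneg_left ?_ hL0))
            (ih (n + 1) i' (by omega) x))
        rw [← abs_neg]
        convert (he n).le using 2
        push_cast
        ring
      rw [hu n (x + _), hu n x]
      refine (norm_integral_add_sub_le (hq0 n) (hc n) (hm (n + 1)) (hB (n + 1)) (hge (n + 1) n)
        (ih (n + 1) (i' + 1) hi) hA' hA'' x).trans ?_
      have hPs : P n (j + 1) = (1 - c * q n) * P (n + 1) j := by
        simp only [P]
        rw [Finset.prod_range_succ', mul_comm, add_zero]
        congr 1
        refine Finset.prod_congr rfl fun i _ => ?_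
        rw [add_assoc, add_comm 1 i]
      have hcw : c * (((i' + 1 : ℕ) : ℝ) * (R - ((i' + 1 : ℕ) : ℝ))) ≤ 1 := by
        rw [hcdef, inv_mul_le_iff₀ (by positivity), mul_one]
        nlinarith [(i' + 1 : ℕ).cast_nonneg (α := ℝ)]
      have hmain := mul_nonneg (mul_nonneg (mul_nonneg hB0 (hP0 (n + 1) j)) (hq0 n))
        (sub_nonneg.2 hcw)
      rw [hPs]
      push_cast at hmain ⊢
      generalize P (n + 1) j = K at hmain ⊢
      refine le_trans (b := B * (i' + 1) / R + L * η * ((i' + 1) * (R - (i' + 1))) +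
        B * K * ((i' + 1) * (R - (i' + 1)) - q n)) (le_of_eq (by ring)) ?_
      linarith
  have hlim := ((tendsto_prod_one_sub_of_not_summable hf0 hf1
    (by rwa [summable_mul_left_iff hc0.ne']) n).const_mul B).mul_const ((R : ℝ) - 1)
  have hlim' := hlim.const_add (B / R + L * η * (R - 1))
  rw [mul_zero, zero_mul, add_zero] at hlim'
  refine ge_of_tendsto' hlim' fun j => ?_
  have := key j n 1 hR x
  simp only [Nat.cast_one, one_mul, mul_one] at this
  refine this.trans (le_of_eq ?_)
  simp only [P]
  ring

/-- A choice of coins in the steps, with gaps that are `e k` up to periods of the tail boundary. -/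
structure CoinFamily (μ : ℕ → ProbabilityMeasure ℝ) (q e : ℕ → ℝ) : Prop where
  nonneg : ∀ k, 0 ≤ q k
  le_one : ∀ k, q k ≤ 1
  exists_gap : ∀ k, ∃ g, HasCoin (μ k) (q k) g ∧ IsPeriod μ (g - e k)

theorem IsPeriod.add_eq {F : tailBoundary μ} {v : ℝ → ℂ} {g e : ℝ}
    (hper : ∀ e, tailAct μ e F = F → ∀ x, v (x + e) = v x) (h : IsPeriod μ (g - e)) (x : ℝ) :
    v (x + g) = v (x + e) := by
  rw [← hper _ (h F) (x + e)]
  congr 1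
  ring

/-- Coins outside `s` are switched off by giving them mass 0. Their gap is then arbitrary and is set
to a value `e₀` that satisfies the size conditions. -/
theorem CoinFamily.restrict (h : CoinFamily μ q e) (s : Set ℕ) [DecidablePred (· ∈ s)] (e₀ : ℝ) :
    CoinFamily μ (fun k => if k ∈ s then q k else 0) (fun k => if k ∈ s then e k else e₀) where
  nonneg k := by
    split_ifs
    · exact h.nonneg k
    · exact le_rfl
  le_one k := by
    split_ifs
    · exact h.le_one k
    · exact zero_le_one
  exists_gap k := by
    split_ifs
    · exact h.exists_gap k
    · exact ⟨e₀, hasCoin_zero _ _, by rw [sub_self]; exact isPeriod_zero μ⟩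

-- The estimate L ε + B(D+ε)/R is available for every small ε and large R; let ε → 0 and then R → ∞.
open Classical in
theorem CoinFamily.isPeriod_of_small (h : CoinFamily μ q e)
    (hs : ∀ ε : ℝ, 0 < ε → ¬ Summable fun k => if |e k| < ε then q k * e k ^ 2 else 0) (D : ℝ) :
    IsPeriod μ D := by
  have key : ∀ D, 0 < D → IsPeriod μ D := fun D hD F => by
    obtain ⟨C, u, hC, hB, hlip, hu, hper⟩ := exists_smooth_harmonic F
    refine (hper D).2 fun a n x => ?_
    have hcont : ∀ n, Continuous (u a n) := fun n => by
      refine (LipschitzWith.of_dist_le_mul (K := ⟨2 * C, by positivity⟩) fun x y => ?_).continuous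
      rw [dist_eq_norm, Real.dist_eq]
      exact hlip a n x y
    have hle : ∀ ε R : ℝ, 0 < ε → D < R → ‖u a n (x + D) - u a n x‖ ≤
        2 * C * ε + 2 * (C * |a|) * (D + ε) / R := fun ε R hε hR => by
      have h' := h.restrict {k | |e k| < ε} 0
      choose g hg hge using h'.exists_gap
      refine norm_sub_le_of_small_steps (fun n => (hcont n).measurable)
        (fun n x => by rw [mul_div_cancel_left₀ _ two_ne_zero]; exact hB a n x) (hlip a) (hu a)
        h'.nonneg h'.le_one hg (fun n k x => (hge k).add_eq (F := F)
          (fun e he x => (hper e).1 he a n x) x) hε (hD.trans hR) (fun k => ?_) ?_ hD hR n x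
      · split_ifs with hk
        · exact hk
        · simpa using hε
      · convert hs ε hε using 3 with k
        by_cases hk : |e k| < ε <;> simp [hk]
    have h1 : ∀ R : ℝ, D < R → ‖u a n (x + D) - u a n x‖ ≤ 2 * (C * |a|) * D / R := fun R hR => by
      have : Tendsto (fun ε : ℝ => 2 * C * ε + 2 * (C * |a|) * (D + ε) / R) (𝓝[>] 0)
          (𝓝 (2 * C * 0 + 2 * (C * |a|) * (D + 0) / R)) :=
        (Continuous.tendsto (by fun_prop) 0).mono_left nhdsWithin_le_nhds
      rw [mul_zero, zero_add, add_zero] at this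
      refine ge_of_tendsto this ?_
      filter_upwards [self_mem_nhdsWithin] with ε hε using hle ε R hε hR
    have h2 : ‖u a n (x + D) - u a n x‖ ≤ 0 := by
      refine ge_of_tendsto (tendsto_const_nhds.div_atTop tendsto_id : Tendsto
        (fun R : ℝ => 2 * (C * |a|) * D / R) atTop (𝓝 0)) ?_
      filter_upwards [eventually_gt_atTop D] with R hR using h1 R hR
    exact sub_eq_zero.1 (norm_le_zero_iff.1 h2)
  rcases lt_trichotomy D 0 with hD | rfl | hD
  · have := (periods μ).neg_mem (key (-D) (by linarith))
    rwa [neg_neg] at this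
  · exact isPeriod_zero μ
  · exact key D hD

-- Here the estimate is B/R + L η (R - 1): let η → 0 first, and then R → ∞.
open Classical in
theorem CoinFamily.isPeriod_of_near (h : CoinFamily μ q e) {e₀ : ℝ}
    (hs : ∀ η : ℝ, 0 < η → ¬ Summable fun k => if |e k - e₀| < η then q k else 0) :
    IsPeriod μ e₀ := fun F => by
  obtain ⟨C, u, hC, hB, hlip, hu, hper⟩ := exists_smooth_harmonic F
  refine (hper e₀).2 fun a n x => ?_
  have hcont : ∀ n, Continuous (u a n) := fun n => by
    refine (LipschitzWith.of_dist_le_mul (K := ⟨2 * C, by positivity⟩) fun x y => ?_).continuous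
    rw [dist_eq_norm, Real.dist_eq]
    exact hlip a n x y
  have hle : ∀ (η : ℝ) (R : ℕ), 0 < η → 0 < R → ‖u a n (x + e₀) - u a n x‖ ≤
      2 * (C * |a|) / R + 2 * C * η * (R - 1) := fun η R hη hR => by
    have h' := h.restrict {k | |e k - e₀| < η} e₀
    choose g hg hge using h'.exists_gap
    refine norm_sub_le_of_steps_near (fun n => (hcont n).measurable)
      (fun n x => by rw [mul_div_cancel_left₀ _ two_ne_zero]; exact hB a n x) (hlip a) (hu a)
      h'.nonneg h'.le_one hg (fun n k x => (hge k).add_eq (F := F)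
        (fun e he x => (hper e).1 he a n x) x) hη (fun k => ?_) ?_ hR n x
    · split_ifs with hk
      · exact hk
      · simpa using hη
    · exact hs η hη
  have h1 : ∀ R : ℕ, 0 < R → ‖u a n (x + e₀) - u a n x‖ ≤ 2 * (C * |a|) / R := fun R hR => by
    have : Tendsto (fun η : ℝ => 2 * (C * |a|) / R + 2 * C * η * (R - 1)) (𝓝[>] 0)
        (𝓝 (2 * (C * |a|) / R + 2 * C * 0 * (R - 1))) :=
      (Continuous.tendsto (by fun_prop) 0).mono_left nhdsWithin_le_nhds
    rw [mul_zero, zero_mul, add_zero] at this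
    refine ge_of_tendsto this ?_
    filter_upwards [self_mem_nhdsWithin] with η hη using hle η R hη hR
  have h2 : ‖u a n (x + e₀) - u a n x‖ ≤ 0 := by
    refine ge_of_tendsto (tendsto_const_div_atTop_nhds_zero_nat (2 * (C * |a|))) ?_
    filter_upwards [eventually_gt_atTop 0] with R hR using h1 R hR
  exact sub_eq_zero.1 (norm_le_zero_iff.1 h2)

-- Either arbitrarily small gaps already make the series diverge, and then every number is a period.
-- Or the divergence comes from gaps with ε ≤ |e| ≤ M, and by compactness some `d` there has
-- infinite coin mass in each neighbourhood, so `d` is a period.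
open Classical in
theorem CoinFamily.exists_isPeriod (h : CoinFamily μ q e) {M : ℝ} (hM : 0 < M)
    (he : ∀ k, |e k| ≤ M) (hs : ¬ Summable fun k => q k * e k ^ 2) :
    ∃ d, 0 < d ∧ d ≤ M ∧ IsPeriod μ d := by
  by_cases hsmall : ∀ ε : ℝ, 0 < ε → ¬ Summable fun k => if |e k| < ε then q k * e k ^ 2 else 0
  · exact ⟨M, hM, le_rfl, h.isPeriod_of_small hsmall M⟩
  push Not at hsmall
  obtain ⟨ε, hε, hsε⟩ := hsmall
  let K : Set ℝ := {d | ε ≤ |d| ∧ |d| ≤ M}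
  have hK : IsCompact K := by
    refine (isCompact_Icc (a := -M) (b := M)).of_isClosed_subset ?_ fun d hd => abs_le.1 hd.2
    exact (isClosed_le continuous_const continuous_abs).inter
      (isClosed_le continuous_abs continuous_const)
  obtain ⟨d, hdK, hd⟩ : ∃ d ∈ K, ∀ η : ℝ, 0 < η →
      ¬ Summable fun k => if |e k - d| < η then q k else 0 := by
    by_contra! hcon
    choose! η hη hsη using hcon
    obtain ⟨t, htK, ht⟩ := hK.elim_nhds_subcover (fun d => Metric.ball d (η d))
      fun d hd => Metric.ball_mem_nhds d (hη d hd)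
    refine hs (Summable.of_nonneg_of_le (fun k => mul_nonneg (h.nonneg k) (sq_nonneg _))
      (fun k => ?_) (hsε.add ((summable_sum fun d hd => hsη d (htK d hd)).mul_left (M ^ 2))))
    have hsum0 : 0 ≤ ∑ d ∈ t, (if |e k - d| < η d then q k else 0) :=
      Finset.sum_nonneg fun d _ => by split_ifs <;> simp [h.nonneg k]
    by_cases hk : |e k| < ε
    · rw [if_pos hk]
      have := mul_nonneg (sq_nonneg M) hsum0
      linarith
    · rw [if_neg hk, zero_add]
      have hkK : e k ∈ K := ⟨not_lt.1 hk, he k⟩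
      obtain ⟨d, hd, hkd⟩ := Set.mem_iUnion₂.1 (ht hkK)
      have h1 : q k ≤ ∑ d ∈ t, (if |e k - d| < η d then q k else 0) := by
        refine le_trans (le_of_eq ?_) (Finset.single_le_sum
          (f := fun d => if |e k - d| < η d then q k else 0) (fun d _ => ?_) hd)
        · rw [Metric.mem_ball, Real.dist_eq] at hkd
          exact (if_pos hkd).symm
        · split_ifs <;> simp [h.nonneg k]
      have h2 : e k ^ 2 ≤ M ^ 2 := sq_le_sq.2 (by rw [abs_of_pos hM]; exact he k)
      rw [mul_comm]
      exact mul_le_mul h2 h1 (h.nonneg k) (sq_nonneg M)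
  have hper := h.isPeriod_of_near hd
  refine ⟨|d|, hε.trans_le hdK.1, hdK.2, ?_⟩
  rcases abs_choice d with h1 | h1 <;> rw [h1]
  · exact hper
  · exact (periods μ).neg_mem hper

end Mirror

end TailFlow

namespace TailFlow

/-! ### Poisson approximation of sums of Bernoulli variables -/

theorem poissonWeight_succ (t : ℝ) (k : ℕ) :
    ((k : ℝ) + 1) * poissonWeight t (k + 1) = t * poissonWeight t k := by
  unfold poissonWeight
  rw [Nat.factorial_succ, pow_succ]
  push_cast
  field_simp

theorem hasSum_mul_poissonWeight (t : ℝ) : HasSum (fun k : ℕ => (k : ℝ) * poissonWeight t k) t := by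
  rw [← hasSum_nat_add_iff' 1]
  simp only [Finset.sum_range_one, Nat.cast_zero, zero_mul, sub_zero, Nat.cast_add, Nat.cast_one,
    poissonWeight_succ]
  simpa using (hasSum_poissonWeight t).mul_left t

theorem hasSum_mul_sub_one_mul_poissonWeight (t : ℝ) :
    HasSum (fun k : ℕ => (k : ℝ) * (k - 1) * poissonWeight t k) (t ^ 2) := by
  rw [← hasSum_nat_add_iff' 1]
  simp only [Finset.sum_range_one, Nat.cast_zero, zero_mul, sub_zero, Nat.cast_add, Nat.cast_one,
    add_sub_cancel_right]
  have h := (hasSum_mul_poissonWeight t).mul_left t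
  rw [← pow_two] at h
  refine Eq.mp (congrArg (HasSum · _) (funext fun k => ?_)) h
  rw [mul_left_comm, ← poissonWeight_succ]
  ring

theorem hasSum_poissonWeight_mul_sq {t : ℝ} (ht : 0 < t) :
    HasSum (fun k : ℕ => poissonWeight t k * (k / t - 1) ^ 2) (1 / t) := by
  have h := (((hasSum_mul_sub_one_mul_poissonWeight t).mul_left (1 / t ^ 2)).add
    ((hasSum_mul_poissonWeight t).mul_left (1 / t ^ 2 - 2 / t))).add (hasSum_poissonWeight t)
  have e : 1 / t ^ 2 * t ^ 2 + (1 / t ^ 2 - 2 / t) * t + 1 = 1 / t := by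
    field_simp
    ring
  rw [e] at h
  refine Eq.mp (congrArg (HasSum · _) (funext fun k => ?_)) h
  field_simp
  ring

section BanachAlgebra

variable {𝔸 : Type*} [NormedCommRing 𝔸] [NormedAlgebra ℝ 𝔸]

theorem exp_add_smul [CompleteSpace 𝔸] (S : 𝔸) (a b : ℝ) :
    NormedSpace.exp ((a + b) • S) = NormedSpace.exp (a • S) * NormedSpace.exp (b • S) := by
  let _ : NormedAlgebra ℚ 𝔸 := NormedAlgebra.restrictScalars ℚ ℝ 𝔸
  rw [add_smul, NormedSpace.exp_add]

theorem hasSum_poissonWeight_smul [CompleteSpace 𝔸] (T : 𝔸) (t : ℝ) :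
    HasSum (fun k : ℕ => poissonWeight t k • T ^ k) (NormedSpace.exp (t • (T - 1))) := by
  have h := (NormedSpace.exp_series_hasSum_exp' (𝕂 := ℝ) (t • T)).const_smul (Real.exp (-t))
  have e : NormedSpace.exp (t • (T - 1)) = Real.exp (-t) • NormedSpace.exp (t • T) := by
    have : t • (T - 1) = algebraMap ℝ 𝔸 (-t) + t • T := by
      rw [Algebra.algebraMap_eq_smul_one, smul_sub, neg_smul]
      abel
    let _ : NormedAlgebra ℚ 𝔸 := NormedAlgebra.restrictScalars ℚ ℝ 𝔸
    rw [this, NormedSpace.exp_add, ← NormedSpace.algebraMap_exp_comm, ← Real.exp_eq_exp_ℝ,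
      ← Algebra.smul_def]
  rw [e]
  refine Eq.mp (congrArg (HasSum · _) (funext fun k => ?_)) h
  rw [smul_pow, smul_smul, smul_smul, poissonWeight]
  congr 1
  ring

variable [NormOneClass 𝔸] {ι : Type*} {p : ι → ℝ} {T : 𝔸}

theorem norm_one_add_smul_le (hT : ‖T‖ ≤ 1) {a : ℝ} (h0 : 0 ≤ a) (h1 : a ≤ 1) :
    ‖1 + a • (T - 1)‖ ≤ 1 := by
  have : 1 + a • (T - 1) = (1 - a) • (1 : 𝔸) + a • T := by
    rw [smul_sub, sub_smul, one_smul]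
    ring
  rw [this]
  refine (norm_add_le _ _).trans ?_
  rw [norm_smul, norm_smul, Real.norm_of_nonneg h0, Real.norm_of_nonneg (by linarith), norm_one]
  nlinarith

theorem norm_prod_one_add_smul_le (hT : ‖T‖ ≤ 1) (s : Finset ι) (h0 : ∀ i ∈ s, 0 ≤ p i)
    (h1 : ∀ i ∈ s, p i ≤ 1) : ‖∏ i ∈ s, (1 + p i • (T - 1))‖ ≤ 1 :=
  (Finset.norm_prod_le _ _).trans (Finset.prod_le_one (fun _ _ => norm_nonneg _) fun i hi =>
    norm_one_add_smul_le hT (h0 i hi) (h1 i hi))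

variable [CompleteSpace 𝔸]

theorem norm_exp_smul_sub_one_le (hT : ‖T‖ ≤ 1) {t : ℝ} (ht : 0 ≤ t) :
    ‖NormedSpace.exp (t • (T - 1))‖ ≤ 1 := by
  rw [← (hasSum_poissonWeight_smul T t).tsum_eq]
  refine tsum_of_norm_bounded (hasSum_poissonWeight t) fun k => ?_
  rw [norm_smul, Real.norm_of_nonneg (poissonWeight_nonneg ht k)]
  exact mul_le_of_le_one_right (poissonWeight_nonneg ht k)
    ((norm_pow_le T k).trans (pow_le_one₀ (norm_nonneg _) hT))

/-- The coefficient of T^k is w_k (k/t - 1) with w the Poisson weights. The variance of the Poisson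
law bounds the sum of their absolute values by 1/√t. -/
theorem norm_sub_one_mul_exp_le (hT : ‖T‖ ≤ 1) {t : ℝ} (ht : 0 < t) :
    ‖(T - 1) * NormedSpace.exp (t • (T - 1))‖ ≤ 1 / √t := by
  have h0 := hasSum_poissonWeight_smul T t
  have h1 : HasSum (fun k : ℕ => (k / t * poissonWeight t k) • T ^ k)
      (T * NormedSpace.exp (t • (T - 1))) := by
    rw [← hasSum_nat_add_iff' 1]
    simp only [Finset.sum_range_one, Nat.cast_zero, zero_div, zero_mul, zero_smul, sub_zero]
    refine Eq.mp (congrArg (HasSum · _) (funext fun k => ?_)) (h0.mul_left T)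
    rw [mul_smul_comm, ← pow_succ']
    congr 1
    have := poissonWeight_succ t k
    push_cast
    field_simp
    linarith
  have h2 := h1.sub h0
  rw [sub_mul, one_mul, ← h2.tsum_eq]
  have hs := Real.sqrt_pos.2 ht
  have h3 := ((hasSum_poissonWeight_mul_sq ht).mul_left (√t / 2)).add
    ((hasSum_poissonWeight t).mul_left (1 / (2 * √t)))
  have e : √t / 2 * (1 / t) + 1 / (2 * √t) * 1 = 1 / √t := by
    have := Real.mul_self_sqrt ht.le
    field_simp
    nlinarith
  rw [e] at h3
  refine tsum_of_norm_bounded h3 fun k => ?_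
  rw [← sub_smul, norm_smul]
  have hw := poissonWeight_nonneg ht.le k
  have h4 : ‖k / t * poissonWeight t k - poissonWeight t k‖ = poissonWeight t k * |k / t - 1| := by
    rw [← abs_of_nonneg hw, Real.norm_eq_abs, ← abs_mul, abs_of_nonneg hw]
    congr 1
    ring
  -- A pointwise arithmetic-geometric inequality in place of Cauchy–Schwarz; its weights are
  -- balanced so that each half contributes 1/(2√t).
  have h5 : |k / t - 1| ≤ √t / 2 * (k / t - 1) ^ 2 + 1 / (2 * √t) := by
    rw [← sq_abs (k / t - 1)]
    have : 0 ≤ (√t * |k / t - 1| - 1) ^ 2 / (2 * √t) := by positivity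
    have e2 : (√t * |k / t - 1| - 1) ^ 2 / (2 * √t) =
        √t / 2 * |k / t - 1| ^ 2 + 1 / (2 * √t) - |k / t - 1| := by
      field_simp
      ring
    linarith
  calc ‖k / t * poissonWeight t k - poissonWeight t k‖ * ‖T ^ k‖
      ≤ poissonWeight t k * |k / t - 1| * 1 := by
        rw [h4]
        gcongr
        exact (norm_pow_le T k).trans (pow_le_one₀ (norm_nonneg _) hT)
    _ ≤ poissonWeight t k * (√t / 2 * (k / t - 1) ^ 2 + 1 / (2 * √t)) := by
        rw [mul_one]
        gcongr
    _ = _ := by ring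

theorem exists_exp_eq_one_add {x : 𝔸} (hx : ‖x‖ ≤ 1) :
    ∃ r : 𝔸, ‖r‖ ≤ 3 ∧ NormedSpace.exp x = 1 + x + x ^ 2 * r := by
  have h := NormedSpace.exp_series_hasSum_exp' (𝕂 := ℝ) x
  have h1 := (hasSum_nat_add_iff' 2).2 h
  have hb : ∀ k : ℕ, ‖(((k + 2).factorial : ℝ)⁻¹) • x ^ k‖ ≤ 1 ^ k / k.factorial := fun k => by
    rw [norm_smul, Real.norm_of_nonneg (by positivity), one_pow, div_eq_mul_inv, one_mul]
    have : ((k + 2).factorial : ℝ)⁻¹ ≤ (k.factorial : ℝ)⁻¹ := by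
      gcongr
      omega
    exact (mul_le_of_le_one_right (by positivity)
      ((norm_pow_le x k).trans (pow_le_one₀ (norm_nonneg _) hx))).trans this
  have hexp : HasSum (fun k : ℕ => (1 : ℝ) ^ k / k.factorial) (Real.exp 1) := by
    have := (Real.summable_pow_div_factorial 1).hasSum
    rwa [show ∑' k : ℕ, (1 : ℝ) ^ k / (k.factorial : ℝ) = Real.exp 1 by
      rw [Real.exp_eq_exp_ℝ, NormedSpace.exp_eq_tsum_div]] at this
  have hsum : Summable fun k : ℕ => (((k + 2).factorial : ℝ)⁻¹) • x ^ k :=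
    Summable.of_norm_bounded hexp.summable hb
  refine ⟨∑' k : ℕ, (((k + 2).factorial : ℝ)⁻¹) • x ^ k,
    (tsum_of_norm_bounded hexp hb).trans Real.exp_one_lt_three.le, ?_⟩
  have h2 := hsum.hasSum.mul_left (x ^ 2)
  have h3 : (fun k : ℕ => x ^ 2 * (((k + 2).factorial : ℝ)⁻¹) • x ^ k) =
      fun k : ℕ => (((k + 2).factorial : ℝ)⁻¹) • x ^ (k + 2) := by
    ext k
    rw [mul_smul_comm, ← pow_add, add_comm 2 k]
  rw [h3] at h2
  have h4 := h2.unique h1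
  rw [h4, Finset.sum_range_succ, Finset.sum_range_one]
  simp

/-- Replace the factors one by one. Each replacement leaves p²(T-1)² times a bounded element, and
writing the smoothing factor as the square of exp((t/2)(T-1)) bounds its product with (T-1)² by 2/t.
-/
theorem norm_sub_mul_exp_le (hT : ‖T‖ ≤ 1) (s : Finset ι) (h0 : ∀ i ∈ s, 0 ≤ p i)
    (h1 : ∀ i ∈ s, p i ≤ 1 / 2) {t : ℝ} (ht : 0 < t) :
    ‖(∏ i ∈ s, (1 + p i • (T - 1)) - NormedSpace.exp ((∑ i ∈ s, p i) • (T - 1))) *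
      NormedSpace.exp (t • (T - 1))‖ ≤ ∑ i ∈ s, 3 * p i ^ 2 * (2 / t) := by
  classical
  induction s using Finset.induction_on with
  | empty => simp
  | insert i s hi ih =>
    have ih' := ih (fun j hj => h0 j (Finset.mem_insert_of_mem hj))
      fun j hj => h1 j (Finset.mem_insert_of_mem hj)
    have hp0 := h0 i (Finset.mem_insert_self i s)
    have hp1 := h1 i (Finset.mem_insert_self i s)
    have hs0 : 0 ≤ ∑ j ∈ s, p j :=
      Finset.sum_nonneg fun j hj => h0 j (Finset.mem_insert_of_mem hj)
    rw [Finset.prod_insert hi, Finset.sum_insert hi, Finset.sum_insert hi, exp_add_smul]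
    have hx : ‖p i • (T - 1)‖ ≤ 1 := by
      rw [norm_smul, Real.norm_of_nonneg hp0]
      have : ‖T - 1‖ ≤ 2 := (norm_sub_le _ _).trans (by rw [norm_one]; linarith)
      nlinarith [norm_nonneg (T - 1)]
    obtain ⟨r, hr, hexp⟩ := exists_exp_eq_one_add hx
    set S := T - 1
    have hhalf : NormedSpace.exp (t • S) =
        NormedSpace.exp ((t / 2) • S) * NormedSpace.exp ((t / 2) • S) := by
      rw [← exp_add_smul, add_halves]
    have hE := norm_sub_one_mul_exp_le hT (half_pos ht)
    have hB := norm_exp_smul_sub_one_le hT hs0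
    set A := ∏ j ∈ s, (1 + p j • S)
    set B := NormedSpace.exp ((∑ j ∈ s, p j) • S)
    have e1 : ((1 + p i • S) * A - NormedSpace.exp (p i • S) * B) * NormedSpace.exp (t • S) =
        (1 + p i • S) * ((A - B) * NormedSpace.exp (t • S)) -
          p i ^ 2 • (r * B * ((S * NormedSpace.exp ((t / 2) • S)) *
            (S * NormedSpace.exp ((t / 2) • S)))) := by
      rw [hexp, hhalf, smul_pow]
      simp only [Algebra.smul_def]
      ring
    rw [e1]
    refine (norm_sub_le _ _).trans ?_
    rw [add_comm]
    have h2 : ‖(1 + p i • S) * ((A - B) * NormedSpace.exp (t • S))‖ ≤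
        ∑ j ∈ s, 3 * p j ^ 2 * (2 / t) :=
      (norm_mul_le _ _).trans ((mul_le_of_le_one_left (norm_nonneg _)
        (norm_one_add_smul_le hT hp0 (by linarith))).trans ih')
    refine add_le_add ?_ h2
    rw [norm_smul, Real.norm_of_nonneg (sq_nonneg _)]
    have h3 : ‖r * B * ((S * NormedSpace.exp ((t / 2) • S)) *
        (S * NormedSpace.exp ((t / 2) • S)))‖ ≤ 3 * 1 * (1 / √(t / 2) * (1 / √(t / 2))) := by
      refine (norm_mul_le _ _).trans (mul_le_mul ((norm_mul_le _ _).trans ?_)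
        ((norm_mul_le _ _).trans ?_) (norm_nonneg _) (by norm_num))
      · gcongr
      · gcongr
    have h4 : 1 / √(t / 2) * (1 / √(t / 2)) = 2 / t := by
      rw [div_mul_div_comm, Real.mul_self_sqrt (half_pos ht).le]
      field_simp
    rw [h4] at h3
    calc p i ^ 2 * _ ≤ p i ^ 2 * (3 * 1 * (2 / t)) := by gcongr
      _ = _ := by ring

/-- Split the factors into two halves: the Poisson part of one half smooths the error of the other.
As the parameters are comparable to `P`, the gain 2/t compensates the number of terms, so the bound
does not depend on this number. -/
theorem norm_prod_sub_exp_le (hT : ‖T‖ ≤ 1) {P : ℝ} (hP : 0 < P) (s : Finset ι)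
    (h0 : ∀ i ∈ s, P / 2 ≤ p i) (h1 : ∀ i ∈ s, p i ≤ P) (h2 : ∀ i ∈ s, p i ≤ 1 / 2) :
    ‖∏ i ∈ s, (1 + p i • (T - 1)) - NormedSpace.exp ((∑ i ∈ s, p i) • (T - 1))‖ ≤ 384 * P := by
  classical
  have hp0 : ∀ i ∈ s, 0 ≤ p i := fun i hi => (half_pos hP).le.trans (h0 i hi)
  -- For P > 1/192 the trivial bound 2 is below 384 P. Otherwise 96 P ≤ 1/2, which lets the
  -- induction absorb the quadratic term.
  rcases lt_or_ge (1 / 2) (96 * P) with hbig | hsmall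
  · refine (norm_sub_le _ _).trans ?_
    have := norm_prod_one_add_smul_le hT s hp0 fun i hi => (h2 i hi).trans (by norm_num)
    have := norm_exp_smul_sub_one_le hT (Finset.sum_nonneg hp0)
    linarith
  suffices ∀ n (s : Finset ι), s.card ≤ n → (∀ i ∈ s, P / 2 ≤ p i) → (∀ i ∈ s, p i ≤ P) →
      ‖∏ i ∈ s, (1 + p i • (T - 1)) - NormedSpace.exp ((∑ i ∈ s, p i) • (T - 1))‖ ≤ 96 * P from
    (this s.card s le_rfl h0 h1).trans (by linarith)
  clear! s
  intro n
  induction n with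
  | zero =>
    intro s hs h0 h1
    rw [Finset.card_eq_zero.1 (Nat.le_zero.1 hs)]
    simpa using hP.le
  | succ n ih =>
    intro s hs h0 h1
    have hp0 : ∀ i ∈ s, 0 ≤ p i := fun i hi => (half_pos hP).le.trans (h0 i hi)
    rcases Nat.lt_or_ge s.card 2 with hc | hc
    · rcases Nat.lt_or_ge s.card 1 with hc' | hc'
      · rw [Finset.card_eq_zero.1 (show s.card = 0 by omega)]
        simpa using hP.le
      · obtain ⟨i, rfl⟩ := Finset.card_eq_one.1 (show s.card = 1 by omega)
        have hi := h1 i (Finset.mem_singleton_self i)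
        have hi0 := hp0 i (Finset.mem_singleton_self i)
        have hS : ‖T - 1‖ ≤ 2 := (norm_sub_le _ _).trans (by rw [norm_one]; linarith)
        have hx0 : ‖p i • (T - 1)‖ ≤ 2 * P := by
          rw [norm_smul, Real.norm_of_nonneg hi0]
          nlinarith [norm_nonneg (T - 1)]
        obtain ⟨r, hr, hexp⟩ := exists_exp_eq_one_add (hx0.trans (by linarith))
        rw [Finset.prod_singleton, Finset.sum_singleton, hexp, sub_add_cancel_left, norm_neg]
        calc ‖(p i • (T - 1)) ^ 2 * r‖ ≤ (2 * P) ^ 2 * 3 := by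
              refine (norm_mul_le _ _).trans ?_
              gcongr
              refine (norm_pow_le _ 2).trans ?_
              gcongr
          _ ≤ 96 * P := by nlinarith
    · obtain ⟨s₁, hs₁, hcard₁⟩ := Finset.exists_subset_card_eq (show (s.card + 1) / 2 ≤ s.card by omega)
      set s₂ := s \ s₁ with hs₂def
      have hs₂ : s₂ ⊆ s := Finset.sdiff_subset
      have hcard₂ : s₂.card = s.card - (s.card + 1) / 2 := by
        rw [hs₂def, Finset.card_sdiff_of_subset hs₁, hcard₁]
      have hprod : ∏ i ∈ s, (1 + p i • (T - 1)) =
          (∏ i ∈ s₁, (1 + p i • (T - 1))) * ∏ i ∈ s₂, (1 + p i • (T - 1)) := by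
        rw [mul_comm, Finset.prod_sdiff hs₁]
      have hsum : ∑ i ∈ s, p i = ∑ i ∈ s₁, p i + ∑ i ∈ s₂, p i := by
        rw [add_comm, Finset.sum_sdiff hs₁]
      have ih₁ := ih s₁ (by omega) (fun i hi => h0 i (hs₁ hi)) fun i hi => h1 i (hs₁ hi)
      have ih₂ := ih s₂ (by omega) (fun i hi => h0 i (hs₂ hi)) fun i hi => h1 i (hs₂ hi)
      have hlow : ∀ s' ⊆ s, s'.card * (P / 2) ≤ ∑ i ∈ s', p i := fun s' hs' => by
        have := Finset.card_nsmul_le_sum s' p (P / 2) fun i hi => h0 i (hs' hi)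
        rwa [nsmul_eq_mul] at this
      have htel : ∀ s' ⊆ s, ∀ s'' ⊆ s, s'.card ≤ 2 * s''.card → 1 ≤ s''.card →
          ‖(∏ i ∈ s', (1 + p i • (T - 1)) - NormedSpace.exp ((∑ i ∈ s', p i) • (T - 1))) *
            NormedSpace.exp ((∑ i ∈ s'', p i) • (T - 1))‖ ≤ 24 * P := fun s' hs' s'' hs'' hc hc1 => by
        have hc1' : (1 : ℝ) ≤ s''.card := by exact_mod_cast hc1
        have hc' : (s'.card : ℝ) ≤ 2 * s''.card := by exact_mod_cast hc
        have hl := hlow s'' hs''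
        have hpos : 0 < ∑ i ∈ s'', p i := by nlinarith
        refine (norm_sub_mul_exp_le hT s' (fun i hi => hp0 i (hs' hi))
          (fun i hi => (h1 i (hs' hi)).trans (by linarith)) hpos).trans ?_
        have h3 := Finset.sum_le_card_nsmul s' (fun i => 3 * p i ^ 2 * (2 / ∑ i ∈ s'', p i))
          (3 * P ^ 2 * (2 / ∑ i ∈ s'', p i)) fun i hi => by
            have := hp0 i (hs' hi)
            have := h1 i (hs' hi)
            gcongr
        refine h3.trans ?_
        rw [nsmul_eq_mul, mul_div_assoc', mul_div_assoc', div_le_iff₀ hpos]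
        nlinarith [mul_pos hP hP]
      have t1 := htel s₁ hs₁ s₂ hs₂ (by omega) (by omega)
      have t2 := htel s₂ hs₂ s₁ hs₁ (by omega) (by omega)
      rw [hprod, hsum, exp_add_smul]
      set A₁ := ∏ i ∈ s₁, (1 + p i • (T - 1))
      set A₂ := ∏ i ∈ s₂, (1 + p i • (T - 1))
      set B₁ := NormedSpace.exp ((∑ i ∈ s₁, p i) • (T - 1))
      set B₂ := NormedSpace.exp ((∑ i ∈ s₂, p i) • (T - 1))
      -- The first two terms are at most 24 P each by smoothing; the last is at most (96 P)² ≤ 48 P.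
      -- The total is again 96 P.
      have e : A₁ * A₂ - B₁ * B₂ = (A₁ - B₁) * B₂ + (A₂ - B₂) * B₁ + (A₁ - B₁) * (A₂ - B₂) := by
        ring
      rw [e]
      have t3 : ‖(A₁ - B₁) * (A₂ - B₂)‖ ≤ 96 * P * (96 * P) :=
        (norm_mul_le _ _).trans (mul_le_mul ih₁ ih₂ (norm_nonneg _) (by positivity))
      calc _ ≤ 24 * P + 24 * P + 96 * P * (96 * P) :=
            (norm_add_le _ _).trans (add_le_add ((norm_add_le _ _).trans (add_le_add t1 t2)) t3)
        _ ≤ 96 * P := by nlinarith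

end BanachAlgebra

/-- The shift `f ↦ f (· + 1)` of bounded sequences. -/
noncomputable def shiftCLM : BoundedContinuousFunction ℕ ℝ →L[ℝ] BoundedContinuousFunction ℕ ℝ :=
  LinearMap.mkContinuous
    { toFun := fun f => f.compContinuous ⟨fun k => k + 1, continuous_of_discreteTopology⟩
      map_add' := fun _ _ => rfl
      map_smul' := fun _ _ => rfl } 1 fun f => by
    rw [one_mul]
    exact BoundedContinuousFunction.norm_compContinuous_le f _

theorem norm_shiftCLM_le : ‖shiftCLM‖ ≤ 1 := LinearMap.mkContinuous_norm_le _ zero_le_one _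

theorem shiftCLM_pow_apply (f : BoundedContinuousFunction ℕ ℝ) (k j : ℕ) :
    (shiftCLM ^ k) f j = f (j + k) := by
  induction k generalizing j with
  | zero => rfl
  | succ k ih =>
    rw [pow_succ']
    change (shiftCLM ^ k) f (j + 1) = _
    rw [ih, add_assoc, add_comm 1 k]

/-- The generating polynomial of a sum of independent Bernoulli variables. -/
noncomputable def bernoulliPoly {ι : Type*} (s : Finset ι) (p : ι → ℝ) : Polynomial ℝ :=
  ∏ i ∈ s, (Polynomial.C (1 - p i) + Polynomial.C (p i) * Polynomial.X)

section Bernoulli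

variable {ι : Type*} {s : Finset ι} {p : ι → ℝ}

theorem bernoulliPoly_coeff_nonneg (h0 : ∀ i ∈ s, 0 ≤ p i) (h1 : ∀ i ∈ s, p i ≤ 1) (k : ℕ) :
    0 ≤ (bernoulliPoly s p).coeff k := by
  classical
  unfold bernoulliPoly
  induction s using Finset.induction_on generalizing k with
  | empty =>
    rw [Finset.prod_empty, Polynomial.coeff_one]
    split_ifs <;> norm_num
  | insert i s hi ih =>
    have ih' := ih (fun j hj => h0 j (Finset.mem_insert_of_mem hj))
      fun j hj => h1 j (Finset.mem_insert_of_mem hj)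
    rw [Finset.prod_insert hi, add_mul, Polynomial.coeff_add, Polynomial.coeff_C_mul, mul_assoc,
      Polynomial.coeff_C_mul]
    refine add_nonneg (mul_nonneg ?_ (ih' k)) (mul_nonneg (h0 i (Finset.mem_insert_self i s)) ?_)
    · linarith [h1 i (Finset.mem_insert_self i s)]
    · cases k with
      | zero => simp
      | succ k =>
        rw [Polynomial.coeff_X_mul]
        exact ih' k

theorem hasSum_bernoulliPoly_coeff_mul {A : Type*} [CommRing A] [Algebra ℝ A] [TopologicalSpace A]
    (x : A) : HasSum (fun k => (bernoulliPoly s p).coeff k • x ^ k)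
      (∏ i ∈ s, (1 + p i • (x - 1))) := by
  have h : ∏ i ∈ s, (1 + p i • (x - 1)) = Polynomial.aeval x (bernoulliPoly s p) := by
    rw [bernoulliPoly, map_prod]
    refine Finset.prod_congr rfl fun i _ => ?_
    simp only [map_add, map_mul, Polynomial.aeval_C, Polynomial.aeval_X, map_sub, map_one,
      Algebra.smul_def]
    ring
  rw [h, Polynomial.aeval_eq_sum_range]
  refine hasSum_sum_of_ne_finset_zero fun k hk => ?_
  rw [Polynomial.coeff_eq_zero_of_natDegree_lt (by simpa using hk), zero_smul]

theorem hasSum_bernoulliPoly_coeff : HasSum (bernoulliPoly s p).coeff 1 := by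
  simpa using hasSum_bernoulliPoly_coeff_mul (s := s) (p := p) (1 : ℝ)

/-- The Banach algebra estimate needs commutativity, so it is applied in the closed subalgebra
generated by `T` and then evaluated by `φ` at `f`. -/
theorem exists_hasSum_bernoulliPoly_sub_poissonWeight {F : Type*} [NormedAddCommGroup F]
    [NormedSpace ℝ F] [CompleteSpace F] [Nontrivial F] {T : F →L[ℝ] F} (hT : ‖T‖ ≤ 1) (φ : F →L[ℝ] ℝ)
    (f : F) {P : ℝ} (hP : 0 < P)
    (h0 : ∀ i ∈ s, P / 2 ≤ p i) (h1 : ∀ i ∈ s, p i ≤ P) (h2 : ∀ i ∈ s, p i ≤ 1 / 2) :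
    ∃ D : ℝ, |D| ≤ ‖φ‖ * (384 * P * ‖f‖) ∧ HasSum (fun k => ((bernoulliPoly s p).coeff k -
      poissonWeight (∑ i ∈ s, p i) k) * φ ((T ^ k) f)) D := by
  let 𝔸 := Algebra.elemental ℝ T
  let _ : NormedCommRing 𝔸 := { (inferInstance : NormedRing 𝔸) with mul_comm := mul_comm }
  have : CompleteSpace 𝔸 := (Algebra.elemental.isClosed ℝ T).completeSpace_coe
  have : NormOneClass 𝔸 := ⟨norm_one (α := F →L[ℝ] F)⟩
  let T' : 𝔸 := ⟨T, Algebra.elemental.self_mem ℝ T⟩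
  have hD := norm_prod_sub_exp_le (T := T') hT hP s h0 h1 h2
  set c : ℕ → ℝ := fun k => (bernoulliPoly s p).coeff k - poissonWeight (∑ i ∈ s, p i) k with hc
  have hsum : HasSum (fun k => c k • T' ^ k) (∏ i ∈ s, (1 + p i • (T' - 1)) -
      NormedSpace.exp ((∑ i ∈ s, p i) • (T' - 1))) := by
    simp only [hc, sub_smul]
    exact (hasSum_bernoulliPoly_coeff_mul T').sub (hasSum_poissonWeight_smul T' _)
  set D : 𝔸 := ∏ i ∈ s, (1 + p i • (T' - 1)) - NormedSpace.exp ((∑ i ∈ s, p i) • (T' - 1))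
  let ψ : 𝔸 →+ ℝ :=
    { toFun := fun x => φ ((x : F →L[ℝ] F) f)
      map_zero' := map_zero φ
      map_add' := fun x y => map_add φ ((x : F →L[ℝ] F) f) ((y : F →L[ℝ] F) f) }
  have hψ : Continuous ψ :=
    φ.continuous.comp ((ContinuousLinearMap.apply ℝ F f).continuous.comp continuous_subtype_val)
  refine ⟨ψ D, ?_, ?_⟩
  · refine (φ.le_opNorm _).trans ?_
    refine mul_le_mul_of_nonneg_left (((D : F →L[ℝ] F).le_opNorm f).trans ?_) (norm_nonneg _)
    exact mul_le_mul_of_nonneg_right hD (norm_nonneg _)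
  · convert hsum.map ψ hψ using 2 with k
    exact (map_smul φ (c k) ((T ^ k) f)).symm

/-- For the shift and evaluation at 0, φ(T^k f) = f(k). Taking for `f` the signs of the coefficients
turns the operator bound into an ℓ¹ bound. -/
theorem tsum_abs_bernoulliPoly_sub_poissonWeight_le {P : ℝ} (hP : 0 < P)
    (h0 : ∀ i ∈ s, P / 2 ≤ p i) (h1 : ∀ i ∈ s, p i ≤ P) (h2 : ∀ i ∈ s, p i ≤ 1 / 2) :
    ∑' k, |(bernoulliPoly s p).coeff k - poissonWeight (∑ i ∈ s, p i) k| ≤ 384 * P := by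
  set c : ℕ → ℝ := fun k => (bernoulliPoly s p).coeff k - poissonWeight (∑ i ∈ s, p i) k with hc
  let f : BoundedContinuousFunction ℕ ℝ := BoundedContinuousFunction.ofNormedAddCommGroupDiscrete
    (fun k => (SignType.sign (c k) : ℝ)) 1 fun k => by
      rcases lt_trichotomy (c k) 0 with h | h | h <;> simp [h]
  have hf : ‖f‖ ≤ 1 := (BoundedContinuousFunction.norm_le zero_le_one).2 fun k => by
    change ‖(SignType.sign (c k) : ℝ)‖ ≤ 1
    rcases lt_trichotomy (c k) 0 with h | h | h <;> simp [h]
  let φ : BoundedContinuousFunction ℕ ℝ →L[ℝ] ℝ :=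
    LinearMap.mkContinuous
      { toFun := fun g => g 0
        map_add' := fun _ _ => rfl
        map_smul' := fun _ _ => rfl } 1 fun g => by
      rw [one_mul]
      exact BoundedContinuousFunction.norm_coe_le_norm g 0
  have hφ : ‖φ‖ ≤ 1 := LinearMap.mkContinuous_norm_le _ zero_le_one _
  have : Nontrivial (BoundedContinuousFunction ℕ ℝ) :=
    ⟨0, BoundedContinuousFunction.const ℕ 1, fun h =>
      zero_ne_one (α := ℝ) (congrArg (fun g : BoundedContinuousFunction ℕ ℝ => g 0) h)⟩
  obtain ⟨D, hD, hsum⟩ := exists_hasSum_bernoulliPoly_sub_poissonWeight norm_shiftCLM_le φ f hP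
    h0 h1 h2
  have e : ∀ k, c k * φ ((shiftCLM ^ k) f) = |c k| := fun k => by
    change c k * (shiftCLM ^ k) f 0 = |c k|
    rw [shiftCLM_pow_apply, zero_add]
    exact self_mul_sign (c k)
  have hsum' : HasSum (fun k => |c k|) D := (funext e) ▸ hsum
  rw [hsum'.tsum_eq]
  refine (le_abs_self _).trans (hD.trans ?_)
  calc ‖φ‖ * (384 * P * ‖f‖) ≤ 1 * (384 * P * 1) := by gcongr
    _ = 384 * P := by ring

/-- The coupling of a sum of Bernoulli variables with a Poisson variable, on the lattice `cℤ`. -/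
theorem exists_coupling_bernoulliPoly {P : ℝ} (hP : 0 < P)
    (h0 : ∀ i ∈ s, P / 2 ≤ p i) (h1 : ∀ i ∈ s, p i ≤ P) (h2 : ∀ i ∈ s, p i ≤ 1 / 2) (c : ℝ) :
    ∃ γ : Measure (ℝ × ℝ), γ.map Prod.fst = latticeMeasure (bernoulliPoly s p).coeff c ∧
      γ.map Prod.snd = compoundPoisson (ENNReal.ofReal (∑ i ∈ s, p i) • Measure.dirac c) ∧
        couplingCost γ ≤ ENNReal.ofReal (384 * P) := by
  have hp0 : ∀ i ∈ s, 0 ≤ p i := fun i hi => (half_pos hP).le.trans (h0 i hi)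
  have hs0 : 0 ≤ ∑ i ∈ s, p i := Finset.sum_nonneg hp0
  rw [compoundPoisson_dirac hs0]
  obtain ⟨γ, h3, h4, h5⟩ := exists_coupling_latticeMeasure (c := c)
    (bernoulliPoly_coeff_nonneg hp0 fun i hi => (h2 i hi).trans (by norm_num))
    (poissonWeight_nonneg hs0) (hasSum_bernoulliPoly_coeff (s := s) (p := p))
    (hasSum_poissonWeight _)
  exact ⟨γ, h3, h4, h5.trans (ENNReal.ofReal_le_ofReal
    (tsum_abs_bernoulliPoly_sub_poissonWeight_le hP h0 h1 h2))⟩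

theorem charFun_latticeMeasure_bernoulliPoly (h0 : ∀ i ∈ s, 0 ≤ p i) (h1 : ∀ i ∈ s, p i ≤ 1)
    (c t : ℝ) : charFun (latticeMeasure (bernoulliPoly s p).coeff c) t =
      ∏ i ∈ s, charFun (twoPoint (p i) 0 c) t := by
  rw [charFun_latticeMeasure (bernoulliPoly_coeff_nonneg h0 h1) hasSum_bernoulliPoly_coeff.summable]
  have h := (hasSum_bernoulliPoly_coeff_mul (s := s) (p := p)
    (Complex.exp (t * c * Complex.I))).tsum_eq
  simp only [Complex.real_smul] at h
  rw [h]
  refine Finset.prod_congr rfl fun i hi => ?_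
  rw [charFun_twoPoint (h0 i hi) (h1 i hi)]
  simp only [Complex.ofReal_zero, mul_zero, zero_mul, Complex.exp_zero]
  ring

end Bernoulli

end TailFlow

namespace TailFlow

/-! ### From two-point steps to compound Poisson steps -/

instance isFiniteMeasure_ofReal_smul_dirac (r c : ℝ) :
    IsFiniteMeasure (ENNReal.ofReal r • Measure.dirac c) :=
  Measure.smul_finite _ ENNReal.ofReal_ne_top

/-- The compound Poisson step with jumps `c` at rate `r`. -/
noncomputable def poissonStep (r c : ℝ) : ProbabilityMeasure ℝ :=
  compoundPoissonProb (ENNReal.ofReal r • Measure.dirac c)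

theorem coe_poissonStep (r c : ℝ) :
    (poissonStep r c : Measure ℝ) = compoundPoisson (ENNReal.ofReal r • Measure.dirac c) := rfl

theorem isCompoundPoisson_poissonStep (r c : ℝ) : IsCompoundPoisson (poissonStep r c) :=
  ⟨_, inferInstance, coe_poissonStep r c⟩

theorem support_poissonStep_subset {r c : ℝ} (hr : 0 ≤ r) (hc : 0 ≤ c) :
    (poissonStep r c : Measure ℝ).support ⊆ Set.Ici 0 := by
  rw [coe_poissonStep, compoundPoisson_dirac hr]
  exact support_latticeMeasure_subset hc

theorem hasCoin_poissonStep (c : ℝ) : HasCoin (poissonStep 1 c) (2 * Real.exp (-1)) c := by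
  refine ⟨0, ?_⟩
  have h := smul_dirac_add_smul_le_compoundPoisson (ENNReal.ofReal 1 • Measure.dirac c)
  rw [coe_poissonStep]
  simpa using h

theorem coinFamily_poissonStep (c : ℕ → ℝ) :
    CoinFamily (fun k => poissonStep 1 (c k)) (fun _ => 2 * Real.exp (-1)) c where
  nonneg _ := by positivity
  le_one _ := by
    have := Real.exp_one_gt_d9
    rw [Real.exp_neg, ← div_eq_mul_inv, div_le_one (Real.exp_pos _)]
    linarith
  exists_gap k := ⟨c k, hasCoin_poissonStep (c k), by rw [sub_self]; exact isPeriod_zero _⟩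

/-- The gaps tend to 0 while their squares form the harmonic series, so small gaps alone make Σ q e²
diverge. This is the model with all periods. -/
theorem isPeriod_poissonStep_inv_sqrt (D : ℝ) :
    IsPeriod (fun k => poissonStep 1 (1 / √((k : ℝ) + 1))) D := by
  refine (coinFamily_poissonStep _).isPeriod_of_small (fun ε hε hs => ?_) D
  have ht : Tendsto (fun k : ℕ => |1 / √((k : ℝ) + 1)|) atTop (𝓝 0) := by
    have h1 : Tendsto (fun k : ℕ => √((k : ℝ) + 1)) atTop atTop :=
      Real.tendsto_sqrt_atTop.comp (tendsto_atTop_add_const_right _ 1 tendsto_natCast_atTop_atTop)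
    simpa using (tendsto_const_nhds (x := (1 : ℝ))).div_atTop h1 |>.abs
  obtain ⟨N, hN⟩ := eventually_atTop.1 (ht.eventually_lt_const hε)
  rw [← summable_nat_add_iff N] at hs
  have e : ∀ k : ℕ, (if |1 / √(((k + N : ℕ) : ℝ) + 1)| < ε then
      2 * Real.exp (-1) * (1 / √(((k + N : ℕ) : ℝ) + 1)) ^ 2 else 0) =
      2 * Real.exp (-1) * (1 / ((k + (N + 1) : ℕ) : ℝ)) := fun k => by
    rw [if_pos (hN _ (by omega)), div_pow, one_pow, Real.sq_sqrt (by positivity)]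
    push_cast
    ring
  simp only [e] at hs
  rw [summable_mul_left_iff (by positivity), summable_nat_add_iff (N + 1) (f := fun k : ℕ =>
    1 / (k : ℝ))] at hs
  exact Real.not_summable_one_div_natCast hs

theorem isPeriod_poissonStep (d : ℝ) : IsPeriod (fun _ => poissonStep 1 d) d := by
  refine (coinFamily_poissonStep fun _ => d).isPeriod_of_near fun η hη => ?_
  simp only [sub_self, abs_zero, if_pos hη]
  rw [summable_const_iff]
  positivity

theorem hasCoin_twoPoint {p a d : ℝ} (hp : p ≤ 1 / 2) :
    HasCoin (twoPoint p a (a + d)) (2 * p) d := by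
  refine ⟨a, ?_⟩
  rw [mul_div_cancel_left₀ _ two_ne_zero, smul_add, twoPoint]
  refine add_le_add (Measure.le_iff.2 fun s _ => ?_) le_rfl
  rw [Measure.smul_apply, Measure.smul_apply, smul_eq_mul, smul_eq_mul]
  gcongr
  linarith

theorem coinFamily_twoPoint {ν : ℕ → ProbabilityMeasure ℝ} {p a d e : ℕ → ℝ} (hp0 : ∀ k, 0 ≤ p k)
    (hp : ∀ k, p k ≤ 1 / 2) (hν : ∀ k, (ν k : Measure ℝ) = twoPoint (p k) (a k) (a k + d k))
    (he : ∀ k, IsPeriod ν (d k - e k)) : CoinFamily ν (fun k => 2 * p k) e where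
  nonneg k := by linarith [hp0 k]
  le_one k := by linarith [hp k]
  exists_gap k := ⟨d k, by rw [hν]; exact hasCoin_twoPoint (hp k), he k⟩

theorem ae_poissonStep {r c : ℝ} (hr : 0 ≤ r) {H : AddSubgroup ℝ} (hc : c ∈ H) :
    ∀ᵐ x ∂(poissonStep r c : Measure ℝ), x ∈ H := by
  rw [coe_poissonStep, compoundPoisson_dirac hr]
  filter_upwards [ae_latticeMeasure] with x hx
  obtain ⟨k, rfl⟩ := hx
  rw [mul_comm, ← nsmul_eq_mul]
  exact H.nsmul_mem hc k

theorem ae_twoPoint {p a b : ℝ} {H : AddSubgroup ℝ} (ha : a ∈ H) (hb : b ∈ H) :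
    ∀ᵐ x ∂(twoPoint p a b), x ∈ H := by
  rw [twoPoint, ae_add_measure_iff]
  constructor <;> refine Measure.ae_smul_measure ?_ _ <;> rw [ae_dirac_eq]
  · exact ha
  · exact hb

theorem countable_span_int {s : Set ℝ} (hs : s.Countable) :
    (Submodule.span ℤ s : Set ℝ).Countable := by
  have := hs.to_subtype
  rw [← Subtype.range_coe (s := s), ← Finsupp.range_linearCombination, LinearMap.coe_range]
  exact Set.countable_range _

section

variable {ν : ℕ → ProbabilityMeasure ℝ} {p a d : ℕ → ℝ}

/-- Periods form a closed group, so here every number is a period of both sequences. The countable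
group generated by all atoms and jumps serves as the common group of periods. -/
theorem exists_poissonStep_conjugate_of_dense
    (hν : ∀ k, (ν k : Measure ℝ) = twoPoint (p k) (a k) (a k + d k))
    (hper : Dense (periods ν : Set ℝ)) :
    Conjugate (tailAct ν) (tailAct fun k => poissonStep 1 (1 / √((k : ℝ) + 1))) := by
  have hall : ∀ e, IsPeriod ν e := fun e => by
    have : e ∈ (periods ν : Set ℝ) := by
      rw [← (isClosed_periods ν).closure_eq, hper.closure_eq]
      trivial
    exact this
  let s : Set ℝ := Set.range a ∪ Set.range d ∪ Set.range fun k : ℕ => 1 / √((k : ℝ) + 1)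
  have hs : s.Countable :=
    ((Set.countable_range a).union (Set.countable_range d)).union (Set.countable_range _)
  have ha : ∀ k, a k ∈ (Submodule.span ℤ s).toAddSubgroup := fun k =>
    Submodule.subset_span (Or.inl (Or.inl ⟨k, rfl⟩))
  have hd : ∀ k, d k ∈ (Submodule.span ℤ s).toAddSubgroup := fun k =>
    Submodule.subset_span (Or.inl (Or.inr ⟨k, rfl⟩))
  refine conjugate_of_forall_mem (H := (Submodule.span ℤ s).toAddSubgroup) ?_ (fun k => ?_) (fun k => ?_)
    (fun h _ => hall h) fun h _ => isPeriod_poissonStep_inv_sqrt h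
  · exact countable_span_int hs
  · rw [hν]
    exact ae_twoPoint (ha k) (add_mem (ha k) (hd k))
  · exact ae_poissonStep zero_le_one (Submodule.subset_span (Or.inr ⟨k, rfl⟩))

/-- Round each jump to the nearest multiple of d₀, with remainder `e k`. Once Σ p e² converges, the
rounded walk lives on the periods d₀ℤ, and so does the Poisson walk with jumps d₀. -/
theorem exists_poissonStep_conjugate_of_zmultiples (hp0 : ∀ k, 0 ≤ p k) (hp : ∀ k, p k ≤ 1 / 2)
    (hν : ∀ k, (ν k : Measure ℝ) = twoPoint (p k) (a k) (a k + d k)) {d₀ : ℝ} (hd₀ : 0 < d₀)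
    (hper : periods ν = AddSubgroup.zmultiples d₀) :
    Conjugate (tailAct ν) (tailAct fun _ => poissonStep 1 d₀) := by
  let e : ℕ → ℝ := fun k => d k - round (d k / d₀) * d₀
  have he : ∀ k, d k - e k ∈ AddSubgroup.zmultiples d₀ := fun k =>
    ⟨round (d k / d₀), by simp [e, zsmul_eq_mul]⟩
  have heM : ∀ k, |e k| ≤ d₀ / 2 := fun k => by
    have h1 : e k = (d k / d₀ - round (d k / d₀)) * d₀ := by
      simp only [e]
      field_simp
    rw [h1, abs_mul, abs_of_pos hd₀]
    have := abs_sub_round (d k / d₀)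
    nlinarith
  -- Otherwise the mirror coupling gives a period in (0, d₀/2], which d₀ℤ does not contain.
  have hsum : Summable fun k => 2 * p k * e k ^ 2 := by
    by_contra hs
    obtain ⟨x, hx0, hxM, hx⟩ := (coinFamily_twoPoint hp0 hp hν (e := e) fun k => by
      rw [← mem_periods, hper]; exact he k).exists_isPeriod (half_pos hd₀) heM hs
    rw [← mem_periods, hper, AddSubgroup.mem_zmultiples_iff] at hx
    obtain ⟨n, rfl⟩ := hx
    rw [zsmul_eq_mul] at hx0 hxM
    have h1 : (0 : ℝ) < n := pos_of_mul_pos_left hx0 hd₀.le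
    have h2 : (1 : ℝ) ≤ n := by exact_mod_cast (show (0 : ℤ) < n by exact_mod_cast h1)
    nlinarith
  let ν' : ℕ → ProbabilityMeasure ℝ := fun k =>
    twoPointProb (p k) 0 (0 + (d k - e k)) (hp0 k) ((hp k).trans (by norm_num))
  have h1 : Conjugate (tailAct ν) (tailAct ν') := by
    refine conjugate_twoPoint hp0 (fun k => (hp k).trans (by norm_num)) hν (fun k => rfl) ?_
    refine (hsum.mul_left (1 / 2)).congr fun k => ?_
    ring
  refine h1.trans (conjugate_of_forall_mem (H := AddSubgroup.zmultiples d₀) ?_ (fun k => ?_)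
    (fun k => ae_poissonStep zero_le_one (AddSubgroup.mem_zmultiples d₀)) (fun h hh => ?_)
    fun h hh => ?_)
  · exact Set.countable_coe_iff.1 (inferInstanceAs (Countable (AddSubgroup.zmultiples d₀)))
  · refine ae_twoPoint (zero_mem _) ?_
    rw [zero_add]
    exact he k
  · rw [← mem_periods, ← h1.periods_eq, hper]
    exact hh
  · have : AddSubgroup.zmultiples d₀ ≤ periods fun _ => poissonStep 1 d₀ := by
      rw [AddSubgroup.zmultiples_le]
      exact isPeriod_poissonStep d₀
    exact this hh

end

end TailFlow

namespace TailFlow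

/-! ### Replacing the jumps of similar two-point steps by a common jump -/

/-- Sort the values and pair the j-th smallest with the j-th largest. The median lies between the
two members of each pair. -/
theorem exists_perm_abs_sub_center_le {ι : Type*} [Fintype ι] [Nonempty ι] (d : ι → ℝ) :
    ∃ (σ : Equiv.Perm ι) (m : ι), ∀ i, σ (σ i) = i ∧ |d i - d m| ≤ |d i - d (σ i)| := by
  let e := Fintype.equivFin ι
  let E : ι ≃ Fin (Fintype.card ι) := e.trans (Tuple.sort (d ∘ e.symm)).symm
  have hE : Monotone fun j => d (E.symm j) := Tuple.monotone_sort (d ∘ e.symm)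
  have hn : 0 < Fintype.card ι := Fintype.card_pos
  let m : Fin (Fintype.card ι) := ⟨(Fintype.card ι - 1) / 2, by omega⟩
  refine ⟨(E.trans Fin.revPerm).trans E.symm, E.symm m, fun i => ⟨by simp, ?_⟩⟩
  obtain ⟨j, rfl⟩ := E.symm.surjective i
  simp only [Equiv.trans_apply, Equiv.apply_symm_apply, Fin.revPerm_apply]
  have hm : (m : ℕ) = (Fintype.card ι - 1) / 2 := rfl
  have hj := j.2
  rcases le_total j m with h | h
  · have h' : m ≤ j.rev := by
      rw [Fin.le_def] at h ⊢
      rw [Fin.val_rev]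
      omega
    have h1 := hE h
    have h2 := hE h'
    simp only at h1 h2
    rw [abs_of_nonpos (by linarith), abs_of_nonpos (by linarith)]
    linarith
  · by_cases hjm : j = m
    · subst hjm
      simp
    have h' : j.rev ≤ m := by
      have h3 : (m : ℕ) < j := lt_of_le_of_ne h fun h => hjm (Fin.ext h.symm)
      rw [Fin.le_def, Fin.val_rev]
      omega
    have h1 := hE h
    have h2 := hE h'
    simp only at h1 h2
    rw [abs_of_nonneg (by linarith), abs_of_nonneg (by linarith)]
    linarith

theorem exists_involutive_center {K : Type*} (κ : ℕ → K) (hκ : ∀ k, (κ ⁻¹' {k}).Finite)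
    (d : ℕ → ℝ) : ∃ (σ : ℕ → ℕ) (c : K → ℝ), Function.Involutive σ ∧ (∀ i, κ (σ i) = κ i) ∧
      (∀ k, c k = 0 ∨ ∃ i, κ i = k ∧ c k = d i) ∧
      ∀ i, |d i - c (κ i)| ≤ |d i - d (σ i)| := by
  have h : ∀ k, ∃ (σ : Equiv.Perm (κ ⁻¹' {k})) (c : ℝ), (c = 0 ∨ ∃ i, κ i = k ∧ c = d i) ∧
      ∀ i : κ ⁻¹' {k}, σ (σ i) = i ∧ |d i - c| ≤ |d i - d (σ i)| := fun k => by
    rcases isEmpty_or_nonempty (κ ⁻¹' {k}) with _ | _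
    · exact ⟨1, 0, Or.inl rfl, isEmptyElim⟩
    · have := (hκ k).fintype
      obtain ⟨σ, m, h⟩ := exists_perm_abs_sub_center_le fun i : κ ⁻¹' {k} => d i
      exact ⟨σ, d m, Or.inr ⟨m, m.2, rfl⟩, h⟩
  choose σ c hc hσ using h
  have key : ∀ (i : ℕ) k (hi : κ i = k), ((σ (κ i) ⟨i, rfl⟩ : κ ⁻¹' {κ i}) : ℕ) = σ k ⟨i, hi⟩ := by
    rintro i k rfl
    rfl
  refine ⟨fun i => σ (κ i) ⟨i, rfl⟩, c, fun i => ?_, fun i => (σ (κ i) ⟨i, rfl⟩).2, hc,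
    fun i => (hσ (κ i) ⟨i, rfl⟩).2⟩
  have h1 := key (σ (κ i) ⟨i, rfl⟩) (κ i) (σ (κ i) ⟨i, rfl⟩).2
  simp only
  rw [h1]
  exact congrArg Subtype.val (hσ (κ i) ⟨i, rfl⟩).1

/-- The coin consists of the events that exactly one of the two steps jumps. Each has at least the
mass min(p, p')/2, because the other step stays with probability at least 1/2. -/
theorem hasCoin_twoPoint_conv {p p' d d' : ℝ} (hp0 : 0 ≤ p) (hp : p ≤ 1 / 2) (hp0' : 0 ≤ p')
    (hp' : p' ≤ 1 / 2) :
    HasCoin ((twoPoint p 0 d).conv (twoPoint p' 0 d')) (min p p') (d - d') := by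
  refine ⟨d', ?_⟩
  have := isProbabilityMeasure_twoPoint (a := (0 : ℝ)) (b := d) hp0 (hp.trans (by norm_num))
  have := isProbabilityMeasure_twoPoint (a := (0 : ℝ)) (b := d') hp0' (hp'.trans (by norm_num))
  have f1 : ∀ r x : ℝ, IsFiniteMeasure (ENNReal.ofReal r • Measure.dirac x) := fun r x =>
    inferInstance
  have e : (twoPoint p 0 d).conv (twoPoint p' 0 d') =
      ENNReal.ofReal ((1 - p) * (1 - p')) • Measure.dirac 0 +
      ENNReal.ofReal ((1 - p) * p') • Measure.dirac d' +
      (ENNReal.ofReal (p * (1 - p')) • Measure.dirac d +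
      ENNReal.ofReal (p * p') • Measure.dirac (d + d')) := by
    rw [twoPoint, twoPoint, Measure.conv_add, Measure.add_conv, Measure.add_conv]
    simp only [Measure.conv_smul_left, Measure.conv_smul_right, Measure.dirac_conv_dirac,
      smul_smul]
    rw [ENNReal.ofReal_mul (by linarith), ENNReal.ofReal_mul (by linarith), ENNReal.ofReal_mul hp0,
      ENNReal.ofReal_mul hp0]
    simp only [zero_add, add_zero]
    simp only [mul_comm]
    abel
  rw [e, smul_add, add_sub_cancel]
  have hle : ∀ {r s : ℝ} (x : ℝ), r ≤ s →
      ENNReal.ofReal r • Measure.dirac x ≤ ENNReal.ofReal s • Measure.dirac x := fun x h => by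
    refine Measure.le_iff.2 fun s _ => ?_
    rw [Measure.smul_apply, Measure.smul_apply, smul_eq_mul, smul_eq_mul]
    gcongr
  refine add_le_add ((hle d' ?_).trans (Measure.le_add_left le_rfl))
    ((hle d ?_).trans (Measure.le_add_right le_rfl))
  · nlinarith [min_le_right p p']
  · nlinarith [min_le_left p p']

theorem not_isPeriod_of_periods_eq_bot {ν : ℕ → ProbabilityMeasure ℝ} (hper : periods ν = ⊥)
    {x : ℝ} (hx : 0 < x) : ¬ IsPeriod ν x := fun h => by
  rw [← mem_periods, hper, AddSubgroup.mem_bot] at h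
  exact hx.ne' h

theorem CoinFamily.summable {ν : ℕ → ProbabilityMeasure ℝ} {q e : ℕ → ℝ} (h : CoinFamily ν q e)
    (hper : periods ν = ⊥) {M : ℝ} (hM : 0 < M) (he : ∀ k, |e k| ≤ M) :
    Summable fun k => q k * e k ^ 2 := by
  by_contra hs
  obtain ⟨x, hx, -, hx'⟩ := h.exists_isPeriod hM he hs
  exact not_isPeriod_of_periods_eq_bot hper hx hx'

section

variable {ν : ℕ → ProbabilityMeasure ℝ} {p a d : ℕ → ℝ}

/-- Merge the steps `i` and `σ i` into one. The merged step contains a coin with gap d_i - d_{σ i};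
without periods the series of these coins cannot diverge. -/
theorem summable_mul_sub_involutive (hp0 : ∀ k, 0 ≤ p k) (hp : ∀ k, p k ≤ 1 / 2)
    (hν : ∀ k, (ν k : Measure ℝ) = twoPoint (p k) (a k) (a k + d k)) (hper : periods ν = ⊥)
    {σ : ℕ → ℕ} (hσ : Function.Involutive σ) {M : ℝ} (hM : 0 < M)
    (hdσ : ∀ i, |d i - d (σ i)| ≤ M) :
    Summable fun i => min (p i) (p (σ i)) * (d i - d (σ i)) ^ 2 := by
  have hp1 : ∀ k, p k ≤ 1 := fun k => (hp k).trans (by norm_num)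
  let ν' : ℕ → ProbabilityMeasure ℝ := fun k => twoPointProb (p k) 0 (0 + d k) (hp0 k) (hp1 k)
  have h1 : Conjugate (tailAct ν) (tailAct ν') :=
    conjugate_twoPoint hp0 hp1 hν (fun k => rfl) (by simp)
  -- The merged step sits at the smaller index of the pair; the larger index receives the trivial
  -- step.
  let m : ℕ → Measure ℝ := fun k =>
    if k < σ k then (ν' k : Measure ℝ).conv (ν' (σ k) : Measure ℝ)
    else if k = σ k then ν' k else Measure.dirac 0
  have hm : ∀ k, IsProbabilityMeasure (m k) := fun k => by
    simp only [m]
    split_ifs <;> infer_instance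
  let ρ : ℕ → ProbabilityMeasure ℝ := fun k => ⟨m k, hm k⟩
  have hβ : ∀ k, ((fun i => min i (σ i)) ⁻¹' {k}).Finite := fun k => by
    refine (Set.toFinite {k, σ k}).subset fun i hi => ?_
    rcases min_choice i (σ i) with h | h
    · exact Or.inl (h.symm.trans hi)
    · exact Or.inr (by rw [← (show σ i = k from h.symm.trans hi), hσ i]; rfl)
  have hset : ∀ k, (hβ k).toFinset = if k < σ k then {k, σ k} else
      if k = σ k then {k} else ∅ := fun k => by
    ext i
    have hi := hσ i
    have hk := hσ k
    have h5 : i = σ k → σ i = k := fun h => by rw [h, hk]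
    have h6 : σ i = k → σ k = i := fun h => by rw [← h, hi]
    have h7 : i = k → σ i = σ k := fun h => by rw [h]
    rw [Set.Finite.mem_toFinset, Set.mem_preimage, Set.mem_singleton_iff]
    split_ifs with h1 h2 <;> simp only [Finset.mem_insert, Finset.mem_singleton,
      Finset.notMem_empty, iff_false] <;> omega
  have h2 : Conjugate (tailAct ν') (tailAct ρ) := by
    refine conjugate_of_regroup (β := fun i : ℕ => i) ν'
      (fun k => Set.finite_singleton k) hβ (fun k t => ?_) fun k t => ?_
    · have : (Set.finite_singleton k).toFinset = {k} := by
        ext i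
        simp
      exact (congrArg (fun s : Finset ℕ => ∏ i ∈ s, charFun (ν' i : Measure ℝ) t) this).trans
        (Finset.prod_singleton _ _) |>.symm
    · rw [hset]
      change charFun (m k) t = _
      simp only [m]
      split_ifs with h1
      · rw [Finset.prod_pair h1.ne]
        exact charFun_conv _
      · rw [Finset.prod_singleton]
      · simp [charFun_dirac]
  have hfam : CoinFamily ρ (fun k => if k < σ k then min (p k) (p (σ k)) else 0)
      fun k => if k < σ k then d k - d (σ k) else 0 := by
    refine ⟨fun k => ?_, fun k => ?_, fun k =>
      ⟨if k < σ k then d k - d (σ k) else 0, ?_, by rw [sub_self]; exact isPeriod_zero ρ⟩⟩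
    · split_ifs
      exacts [le_min (hp0 _) (hp0 _), le_rfl]
    · split_ifs
      exacts [(min_le_left _ _).trans (hp1 _), zero_le_one]
    · change HasCoin (m k) _ _
      simp only [m]
      split_ifs with h1
      · have := hasCoin_twoPoint_conv (d := 0 + d k) (d' := 0 + d (σ k)) (hp0 k) (hp k)
          (hp0 (σ k)) (hp (σ k))
        rw [add_sub_add_left_eq_sub] at this
        exact this
      all_goals exact hasCoin_zero _ _
  have hs := hfam.summable (by rw [← h2.periods_eq, ← h1.periods_eq, hper]) hM fun k => by
    split_ifs
    exacts [hdσ k, by rw [abs_zero]; exact hM.le]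
  -- The coins count each pair once, at its smaller index; composing with `σ` supplies the other
  -- index.
  refine (hs.add (hs.comp_injective hσ.injective)).congr fun i => ?_
  simp only [Function.comp_apply, hσ i]
  rcases lt_trichotomy i (σ i) with h | h | h
  · rw [if_pos h, if_pos h, if_neg h.not_gt]
    ring
  · rw [← h]
    simp
  · rw [if_neg h.not_gt, if_pos h, if_pos h, min_comm]
    ring

/-- Inside a class the probabilities agree up to a factor 2, so `min` may be replaced by `p i`, and
the distance to the median is at most the distance to the partner. -/
theorem exists_center_summable {K : Type*} {κ : ℕ → K} (hκ : ∀ k, (κ ⁻¹' {k}).Finite)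
    (hp0 : ∀ k, 0 ≤ p k) (hp : ∀ k, p k ≤ 1 / 2)
    (hν : ∀ k, (ν k : Measure ℝ) = twoPoint (p k) (a k) (a k + d k)) (hper : periods ν = ⊥)
    (hpκ : ∀ i j, κ i = κ j → p i ≤ 2 * p j) (hdκ : ∀ i j, κ i = κ j → |d i - d j| ≤ 1) :
    ∃ c : K → ℝ, (∀ k, c k = 0 ∨ ∃ i, κ i = k ∧ c k = d i) ∧
      Summable fun i => p i * (d i - c (κ i)) ^ 2 := by
  obtain ⟨σ, c, hσ, hκσ, hc, hdc⟩ := exists_involutive_center κ hκ d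
  refine ⟨c, hc, ?_⟩
  have hs := summable_mul_sub_involutive hp0 hp hν hper hσ one_pos fun i =>
    hdκ i (σ i) (hκσ i).symm
  refine Summable.of_nonneg_of_le (fun i => mul_nonneg (hp0 i) (sq_nonneg _)) (fun i => ?_)
    (hs.mul_left 2)
  rw [← mul_assoc]
  have h1 : p i ≤ 2 * min (p i) (p (σ i)) := by
    rw [mul_min_of_nonneg _ _ zero_le_two]
    exact le_min (by linarith [hp0 i]) (hpκ i (σ i) (hκσ i).symm)
  exact mul_le_mul h1 (sq_le_sq.2 (hdc i)) (sq_nonneg _) ((hp0 i).trans h1)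

end

end TailFlow

/-! ### Classes of jumps and the case without periods -/

namespace TailFlow

theorem tsum_geometric_ite_le (x : ℝ) :
    ∑' l : ℕ, (if (1 / 2 : ℝ) ^ l ≤ x then ENNReal.ofReal ((1 / 2) ^ l) else 0) ≤
      ENNReal.ofReal (2 * x) := by
  rcases le_or_gt x 0 with hx | hx
  · have : ∀ l : ℕ, ¬ (1 / 2 : ℝ) ^ l ≤ x := fun l => (hx.trans_lt (by positivity)).not_ge
    simp only [this, if_false, tsum_zero]
    exact zero_le
  have hex : ∃ l : ℕ, (1 / 2 : ℝ) ^ l ≤ x := by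
    obtain ⟨l, hl⟩ := exists_pow_lt_of_lt_one hx (show (1 / 2 : ℝ) < 1 by norm_num)
    exact ⟨l, hl.le⟩
  classical
  let l₀ := Nat.find hex
  rw [← Summable.sum_add_tsum_nat_add' (k := l₀) ENNReal.summable,
    Finset.sum_eq_zero fun l hl => if_neg (Nat.find_min hex (Finset.mem_range.1 hl)), zero_add]
  calc ∑' l : ℕ, (if (1 / 2 : ℝ) ^ (l + l₀) ≤ x then ENNReal.ofReal ((1 / 2) ^ (l + l₀)) else 0)
      ≤ ∑' l : ℕ, ENNReal.ofReal ((1 / 2) ^ l * (1 / 2) ^ l₀) := ENNReal.tsum_le_tsum fun l => by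
        rw [← pow_add]
        split_ifs
        exacts [le_rfl, zero_le]
    _ = ENNReal.ofReal (2 * (1 / 2) ^ l₀) := by
        rw [← ENNReal.ofReal_tsum_of_nonneg (fun l => by positivity)
          (summable_geometric_two.mul_right _), tsum_mul_right, tsum_geometric_two]
    _ ≤ ENNReal.ofReal (2 * x) := by
        gcongr
        exact Nat.find_spec hex

/-- For fixed j ≠ 0 the admissible powers (1/2)^l are at most |C|/j², so they sum to at most
2|C|/j², which is summable over j. -/
theorem tsum_geometric_ite_ne_top (C : ℝ) :
    ∑' x : ℤ × ℕ, (if x.1 ≠ 0 ∧ (1 / 2 : ℝ) ^ x.2 * x.1 ^ 2 ≤ C then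
      ENNReal.ofReal (384 * (1 / 2) ^ x.2) else 0) ≠ ⊤ := by
  rw [ENNReal.tsum_prod']
  have hs : Summable fun j : ℤ => 1 / (j : ℝ) ^ 2 := Real.summable_one_div_int_pow.2 one_lt_two
  have h : ∀ j : ℤ, ∑' l : ℕ, (if j ≠ 0 ∧ (1 / 2 : ℝ) ^ l * j ^ 2 ≤ C then
      ENNReal.ofReal (384 * (1 / 2) ^ l) else 0) ≤
      ENNReal.ofReal 384 * ENNReal.ofReal (2 * (|C| * (1 / (j : ℝ) ^ 2))) := fun j => by
    refine le_trans ?_ (mul_le_mul_right (tsum_geometric_ite_le _) _)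
    rw [← ENNReal.tsum_mul_left]
    refine ENNReal.tsum_le_tsum fun l => ?_
    rw [ENNReal.ofReal_mul (by norm_num)]
    split_ifs with h1 h2
    · exact le_rfl
    · refine absurd ?_ h2
      have : (0 : ℝ) < (j : ℝ) ^ 2 := by
        have := h1.1
        positivity
      rw [mul_one_div, le_div_iff₀ this]
      exact h1.2.trans (le_abs_self C)
    · exact zero_le
    · exact zero_le
  refine ne_top_of_le_ne_top ?_ (ENNReal.tsum_le_tsum h)
  rw [ENNReal.tsum_mul_left, ← ENNReal.ofReal_tsum_of_nonneg (fun j => by positivity)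
    ((hs.mul_left _).mul_left _)]
  exact ENNReal.mul_ne_top ENNReal.ofReal_ne_top ENNReal.ofReal_ne_top

theorem exists_coupling_self (μ : Measure ℝ) : ∃ γ : Measure (ℝ × ℝ), γ.map Prod.fst = μ ∧
    γ.map Prod.snd = μ ∧ couplingCost γ = 0 := by
  have hd : Measurable fun x : ℝ => (x, x) := measurable_id.prodMk measurable_id
  refine ⟨μ.map fun x => (x, x), ?_, ?_, ?_⟩
  · rw [Measure.map_map measurable_fst hd]
    exact Measure.map_id
  · rw [Measure.map_map measurable_snd hd]
    exact Measure.map_id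
  · rw [couplingCost, lintegral_map (by fun_prop) hd]
    simp

section

variable {ν : ℕ → ProbabilityMeasure ℝ} {p a d : ℕ → ℝ}

/-- Both sides are the point mass at 0. Thus empty classes, and classes with jump 0, need no Poisson
approximation and cost nothing. -/
theorem latticeMeasure_bernoulliPoly_eq {s : Finset ℕ} {c : ℝ} (hp0 : ∀ k, 0 ≤ p k)
    (hp1 : ∀ k, p k ≤ 1) (h : s = ∅ ∨ c = 0) : latticeMeasure (bernoulliPoly s p).coeff c =
      compoundPoisson (ENNReal.ofReal (∑ i ∈ s, p i) • Measure.dirac c) := by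
  have hs0 : 0 ≤ ∑ i ∈ s, p i := Finset.sum_nonneg fun i _ => hp0 i
  have : IsProbabilityMeasure (latticeMeasure (bernoulliPoly s p).coeff c) :=
    isProbabilityMeasure_latticeMeasure
      (bernoulliPoly_coeff_nonneg (fun i _ => hp0 i) fun i _ => hp1 i) hasSum_bernoulliPoly_coeff
  have : IsProbabilityMeasure
      (compoundPoisson (ENNReal.ofReal (∑ i ∈ s, p i) • Measure.dirac c)) :=
    (poissonStep (∑ i ∈ s, p i) c).2
  refine Measure.ext_of_charFun ?_
  ext t
  rw [charFun_latticeMeasure_bernoulliPoly (fun i _ => hp0 i) fun i _ => hp1 i,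
    charFun_compoundPoisson]
  rcases h with rfl | rfl
  · simp [charFun_apply_real]
  · rw [Finset.prod_eq_one fun i _ => by simp [charFun_twoPoint (hp0 i) (hp1 i)]]
    simp [charFun_apply_real, measureReal_def]

/-- Three replacements: all jumps of a class by `c`, the steps of a class by their sum, and this sum
by a Poisson number of jumps `c`. They use summable variances, regrouping, and summable coupling
costs. -/
theorem conjugate_poissonStep_of_key {K : Type*} (E : K ≃ ℕ) {κ : ℕ → K}
    (hκ : ∀ k, (κ ⁻¹' {k}).Finite) {c : K → ℝ} {P : K → ℝ} {ε : K → ENNReal}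
    (hp0 : ∀ k, 0 ≤ p k) (hp : ∀ k, p k ≤ 1 / 2)
    (hν : ∀ k, (ν k : Measure ℝ) = twoPoint (p k) (a k) (a k + d k))
    (hsum : Summable fun i => p i * (d i - c (κ i)) ^ 2) (hP : ∀ k, 0 < P k)
    (hpP : ∀ i, P (κ i) / 2 ≤ p i ∧ p i ≤ P (κ i))
    (hε : ∀ i, c (κ i) ≠ 0 → ENNReal.ofReal (384 * P (κ i)) ≤ ε (κ i)) (hεs : ∑' k, ε k ≠ ⊤) :
    ∃ r : ℕ → ℝ, (∀ k, 0 ≤ r k) ∧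
      Conjugate (tailAct ν) (tailAct fun k => poissonStep (r k) (c (E.symm k))) := by
  have hp1 : ∀ k, p k ≤ 1 := fun k => (hp k).trans (by norm_num)
  let ν' : ℕ → ProbabilityMeasure ℝ := fun k =>
    twoPointProb (p k) 0 (0 + c (κ k)) (hp0 k) (hp1 k)
  have h1 : Conjugate (tailAct ν) (tailAct ν') :=
    conjugate_twoPoint hp0 hp1 hν (fun k => rfl) hsum
  have hβ : ∀ n, ((fun i => E (κ i)) ⁻¹' {n}).Finite := fun n => by
    refine (hκ (E.symm n)).subset fun i hi => ?_
    exact E.eq_symm_apply.2 hi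
  let s : ℕ → Finset ℕ := fun n => (hβ n).toFinset
  have hs : ∀ n, ∀ i ∈ s n, κ i = E.symm n := fun n i hi =>
    E.eq_symm_apply.2 ((hβ n).mem_toFinset.1 hi)
  let ρ : ℕ → ProbabilityMeasure ℝ := fun n =>
    ⟨latticeMeasure (bernoulliPoly (s n) p).coeff (c (E.symm n)),
      isProbabilityMeasure_latticeMeasure
        (bernoulliPoly_coeff_nonneg (fun i _ => hp0 i) fun i _ => hp1 i)
        hasSum_bernoulliPoly_coeff⟩
  have h2 : Conjugate (tailAct ν') (tailAct ρ) := by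
    refine conjugate_of_regroup (β := fun i : ℕ => i) ν'
      (fun k => Set.finite_singleton k) hβ (fun k t => ?_) fun n t => ?_
    · have : (Set.finite_singleton k).toFinset = {k} := by
        ext i
        simp
      exact (congrArg (fun s : Finset ℕ => ∏ i ∈ s, charFun (ν' i : Measure ℝ) t) this).trans
        (Finset.prod_singleton _ _) |>.symm
    · refine (charFun_latticeMeasure_bernoulliPoly (fun i _ => hp0 i) (fun i _ => hp1 i)
        (c (E.symm n)) t).trans (Finset.prod_congr rfl fun i hi => ?_)
      rw [← hs n i hi]
      simp only [ν', zero_add]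
      rfl
  refine ⟨fun n => ∑ i ∈ s n, p i, fun n => Finset.sum_nonneg fun i _ => hp0 i,
    (h1.trans h2).trans (conjugate_of_couplingCost (ε := fun n => ε (E.symm n)) (fun n => ?_) ?_)⟩
  · by_cases h : s n = ∅ ∨ c (E.symm n) = 0
    · obtain ⟨γ, h3, h4, h5⟩ :=
        exists_coupling_self (latticeMeasure (bernoulliPoly (s n) p).coeff (c (E.symm n)))
      exact ⟨γ, h3, h4.trans (latticeMeasure_bernoulliPoly_eq hp0 hp1 h), h5.trans_le zero_le⟩
    · push Not at h
      obtain ⟨i, hi⟩ := h.1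
      obtain ⟨γ, h3, h4, h5⟩ := exists_coupling_bernoulliPoly (s := s n) (p := p)
        (hP (E.symm n)) (fun i hi => by rw [← hs n i hi]; exact (hpP i).1)
        (fun i hi => by rw [← hs n i hi]; exact (hpP i).2) (fun i _ => hp i) (c (E.symm n))
      refine ⟨γ, h3, h4, h5.trans ?_⟩
      have := hε i
      rw [hs n i hi] at this
      exact this h.2
  · rw [E.symm.tsum_eq ε]
    exact hεs

theorem exists_poissonStep_conjugate_of_periods_eq_bot (hp0 : ∀ k, 0 < p k) (hp : ∀ k, p k ≤ 1 / 2)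
    (hν : ∀ k, (ν k : Measure ℝ) = twoPoint (p k) (a k) (a k + d k)) {C : ℝ}
    (hC : ∀ k, p k * d k ^ 2 ≤ C) (hper : periods ν = ⊥) :
    ∃ r c : ℕ → ℝ, (∀ k, 0 ≤ r k) ∧ ((∀ k, 0 ≤ d k) → ∀ k, 0 ≤ c k) ∧
      Conjugate (tailAct ν) (tailAct fun k => poissonStep (r k) (c k)) := by
  classical
  have hsmall : ∀ M : ℝ, 0 < M → Summable fun k => if |d k| ≤ M then p k * d k ^ 2 else 0 :=
    fun M hM => by
      have h := ((coinFamily_twoPoint (fun k => (hp0 k).le) hp hν (e := d) fun k => by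
        rw [sub_self]; exact isPeriod_zero ν).restrict {k | |d k| ≤ M} 0).summable hper hM
          fun k => by
            split_ifs with h
            exacts [h, by rw [abs_zero]; exact hM.le]
      refine (h.mul_left (1 / 2)).congr fun k => ?_
      simp only [Set.mem_ofPred_eq]
      split_ifs <;> ring
  choose l hl using fun k => exists_nat_pow_near_of_lt_one (hp0 k) ((hp k).trans (by norm_num))
    (show (0 : ℝ) < 1 / 2 by norm_num) (by norm_num)
  -- Small jumps form classes of one step each. A large jump is classified by its integer part and
  -- by the `l` with (1/2)^(l+1) < p ≤ (1/2)^l.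
  let κ : ℕ → ℕ ⊕ (ℤ × ℕ) := fun i => if |d i| < 1 then Sum.inl i else Sum.inr (⌊d i⌋, l i)
  have hκl : ∀ {i n}, κ i = Sum.inl n → i = n ∧ |d i| < 1 := fun {i n} h => by
    simp only [κ] at h
    split_ifs at h with h1
    exact ⟨Sum.inl_injective h, h1⟩
  have hκr : ∀ {i x}, κ i = Sum.inr x → 1 ≤ |d i| ∧ ⌊d i⌋ = x.1 ∧ l i = x.2 := fun {i x} h => by
    simp only [κ] at h
    split_ifs at h with h1
    have h2 := Sum.inr_injective h
    exact ⟨not_lt.1 h1, congrArg Prod.fst h2, congrArg Prod.snd h2⟩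
  have hfl : ∀ i, |d i| ≤ |(⌊d i⌋ : ℝ)| + 1 ∧ |(⌊d i⌋ : ℝ)| ≤ |d i| + 1 := fun i => by
    have h1 := Int.floor_le (d i)
    have h2 := Int.lt_floor_add_one (d i)
    constructor
    · have := abs_add_le (⌊d i⌋ : ℝ) (d i - ⌊d i⌋)
      rw [add_sub_cancel, abs_of_nonneg (sub_nonneg.2 h1)] at this
      linarith
    · have := abs_sub (d i) (d i - ⌊d i⌋)
      rw [sub_sub_cancel, abs_of_nonneg (sub_nonneg.2 h1)] at this
      linarith
  have hκ : ∀ k, (κ ⁻¹' {k}).Finite := by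
    rintro (n | ⟨j, m⟩)
    · exact (Set.finite_singleton n).subset fun i hi => (hκl hi).1
    -- A class of large jumps is finite: its members have bounded |d|, so their p d² are summable,
    -- yet each exceeds (1/2)^(m+1).
    · have ht := (hsmall (|(j : ℝ)| + 1) (by positivity)).tendsto_cofinite_zero.eventually_lt_const
        (show (0 : ℝ) < (1 / 2) ^ (m + 1) by positivity)
      refine (eventually_cofinite.1 ht).subset fun i hi => ?_
      obtain ⟨h1, h2, h3⟩ := hκr hi
      have h4 := (hfl i).1
      simp only at h2 h3
      rw [h2] at h4
      rw [Set.mem_ofPred_eq, if_pos h4, not_lt, ← h3]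
      have h5 : 1 ≤ d i ^ 2 := by
        rw [← sq_abs]
        nlinarith
      nlinarith [(hl i).1, hp0 i]
  have hpl : ∀ i, (1 / 2 : ℝ) ^ l i / 2 ≤ p i := fun i => by
    have := (hl i).1
    rw [pow_succ] at this
    linarith
  have hpκ : ∀ i j, κ i = κ j → p i ≤ 2 * p j := fun i j h => by
    rcases hk : κ j with n | x
    · rw [(hκl (h.trans hk)).1, (hκl hk).1]
      linarith [hp0 n]
    · have h1 := (hl i).2
      have h2 := hpl j
      rw [(hκr (h.trans hk)).2.2] at h1
      rw [(hκr hk).2.2] at h2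
      linarith
  have hdκ : ∀ i j, κ i = κ j → |d i - d j| ≤ 1 := fun i j h => by
    rcases hk : κ j with n | x
    · rw [(hκl (h.trans hk)).1, (hκl hk).1, sub_self, abs_zero]
      exact zero_le_one
    · exact (Int.abs_sub_lt_one_of_floor_eq_floor
        ((hκr (h.trans hk)).2.1.trans (hκr hk).2.1.symm)).le
  obtain ⟨c, hc, hcs⟩ := exists_center_summable hκ (fun k => (hp0 k).le) hp hν hper hpκ hdκ
  -- Small jumps are replaced by 0, which is allowed because Σ p d² over |d| ≤ 1 converges.
  let c' : ℕ ⊕ (ℤ × ℕ) → ℝ := Sum.elim 0 fun x => c (Sum.inr x)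
  let P : ℕ ⊕ (ℤ × ℕ) → ℝ := Sum.elim (fun n => p n) fun x => (1 / 2) ^ x.2
  -- For a large jump |⌊d⌋| ≤ 2|d| and (1/2)^l ≤ 2p, hence (1/2)^l ⌊d⌋² ≤ 8 p d² ≤ 8C. Only such
  -- classes need a positive cost.
  let ε : ℕ ⊕ (ℤ × ℕ) → ENNReal := Sum.elim 0 fun x =>
    if x.1 ≠ 0 ∧ (1 / 2 : ℝ) ^ x.2 * x.1 ^ 2 ≤ 8 * C then
      ENNReal.ofReal (384 * (1 / 2) ^ x.2) else 0
  let E : ℕ ⊕ (ℤ × ℕ) ≃ ℕ := Denumerable.eqv _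
  have hcs' : Summable fun i => p i * (d i - c' (κ i)) ^ 2 := by
    refine Summable.of_nonneg_of_le (fun i => mul_nonneg (hp0 i).le (sq_nonneg _)) (fun i => ?_)
      (hcs.add (hsmall 1 one_pos))
    have h0 := mul_nonneg (hp0 i).le (sq_nonneg (d i - c (κ i)))
    rcases hk : κ i with n | x
    · rw [if_pos (hκl hk).2.le]
      rw [hk] at h0
      simp only [c', Sum.elim_inl, Pi.zero_apply, sub_zero]
      linarith
    · simp only [c', Sum.elim_inr]
      refine le_add_of_nonneg_right ?_
      split_ifs
      exacts [mul_nonneg (hp0 i).le (sq_nonneg _), le_rfl]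
  have hP : ∀ k, 0 < P k := by
    rintro (n | x)
    · exact hp0 n
    · simp only [P, Sum.elim_inr]
      positivity
  have hpP : ∀ i, P (κ i) / 2 ≤ p i ∧ p i ≤ P (κ i) := by
    intro i
    rcases hk : κ i with n | x
    · simp only [P, Sum.elim_inl, ← (hκl hk).1]
      exact ⟨by linarith [hp0 i], le_rfl⟩
    · simp only [P, Sum.elim_inr, ← (hκr hk).2.2]
      exact ⟨hpl i, (hl i).2⟩
  have hε : ∀ i, c' (κ i) ≠ 0 → ENNReal.ofReal (384 * P (κ i)) ≤ ε (κ i) := by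
    intro i hci
    rcases hk : κ i with n | x
    · rw [hk] at hci
      exact absurd rfl hci
    · obtain ⟨h1, h2, h3⟩ := hκr hk
      simp only [P, ε, Sum.elim_inr]
      rw [if_pos]
      rw [← h2, ← h3]
      constructor
      · intro h0
        rw [Int.floor_eq_zero_iff] at h0
        rw [abs_of_nonneg h0.1] at h1
        exact absurd h0.2 h1.not_gt
      · have h4 : (⌊d i⌋ : ℝ) ^ 2 ≤ 4 * d i ^ 2 := by
          rw [← sq_abs, ← sq_abs (d i)]
          nlinarith [(hfl i).2, abs_nonneg (⌊d i⌋ : ℝ)]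
        calc (1 / 2 : ℝ) ^ l i * (⌊d i⌋ : ℝ) ^ 2 ≤ (2 * p i) * (4 * d i ^ 2) := by
              have := hp0 i
              exact mul_le_mul (by linarith [hpl i]) h4 (sq_nonneg _) (by positivity)
          _ ≤ 8 * C := by linarith [hC i]
  have hεs : ∑' k, ε k ≠ ⊤ := by
    rw [← Sum.inr_injective.tsum_eq]
    · exact tsum_geometric_ite_ne_top (8 * C)
    · rintro (n | x) hx
      · exact absurd rfl hx
      · exact ⟨x, rfl⟩
  obtain ⟨r, hr, h⟩ := conjugate_poissonStep_of_key (c := c') (P := P) (ε := ε) E hκ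
    (fun k => (hp0 k).le) hp hν hcs' hP hpP hε hεs
  refine ⟨r, _, hr, fun hd k => ?_, h⟩
  rcases E.symm k with n | x
  · exact le_rfl
  · rcases hc (Sum.inr x) with h | ⟨i, -, h⟩
    · exact h.ge
    · exact (hd i).trans h.ge

/-- The periods form a subgroup of ℝ that is dense, trivial or infinite cyclic; in each case the
jumps found are nonnegative when all `d k` are. -/
theorem exists_poissonStep_conjugate (hp0 : ∀ k, 0 < p k) (hp : ∀ k, p k ≤ 1 / 2)
    (hν : ∀ k, (ν k : Measure ℝ) = twoPoint (p k) (a k) (a k + d k)) {C : ℝ}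
    (hC : ∀ k, p k * d k ^ 2 ≤ C) :
    ∃ r c : ℕ → ℝ, (∀ k, 0 ≤ r k) ∧ ((∀ k, 0 ≤ d k) → ∀ k, 0 ≤ c k) ∧
      Conjugate (tailAct ν) (tailAct fun k => poissonStep (r k) (c k)) := by
  rcases AddSubgroup.dense_or_cyclic (periods ν) with h | ⟨d₀, h⟩
  · exact ⟨fun _ => 1, fun k => 1 / √((k : ℝ) + 1), fun _ => zero_le_one,
      fun _ k => by positivity, exists_poissonStep_conjugate_of_dense hν h⟩
  rw [← AddSubgroup.zmultiples_eq_closure] at h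
  rcases eq_or_ne d₀ 0 with rfl | h0
  · rw [AddSubgroup.zmultiples_zero_eq_bot] at h
    exact exists_poissonStep_conjugate_of_periods_eq_bot hp0 hp hν hC h
  · refine ⟨fun _ => 1, fun _ => |d₀|, fun _ => zero_le_one, fun _ _ => abs_nonneg _,
      exists_poissonStep_conjugate_of_zmultiples (fun k => (hp0 k).le) hp hν (abs_pos.2 h0) ?_⟩
    rcases abs_choice d₀ with h1 | h1
    · rw [h1, h]
    · rw [h1, h, AddSubgroup.zmultiples_neg]

end

end TailFlow

/-! ### From support conditions to parameters, and conclusion -/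

namespace TailFlow

/-- With `b` the lighter atom, p ≤ 1/2, so p d² ≤ 2 p(1-p) d² is at most twice the variance bound.
-/
theorem exists_poissonStep_conjugate_of_support {ν : ℕ → ProbabilityMeasure ℝ} {a b : ℕ → ℝ}
    (hab : ∀ n, a n ≠ b n) (hs : ∀ n, (ν n : Measure ℝ).support = {a n, b n})
    (hle : ∀ n, (ν n : Measure ℝ).real {b n} ≤ (ν n : Measure ℝ).real {a n})
    (hvar : BddAbove (Set.range fun n => variance id (ν n : Measure ℝ))) :
    ∃ r c : ℕ → ℝ, (∀ k, 0 ≤ r k) ∧ ((∀ k, a k ≤ b k) → ∀ k, 0 ≤ c k) ∧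
      Conjugate (tailAct ν) (tailAct fun k => poissonStep (r k) (c k)) := by
  obtain ⟨V, hV⟩ := hvar
  have hp := fun n => eq_twoPoint_of_support (hab n) (hs n)
  have hp' : ∀ n, (ν n : Measure ℝ).real {b n} ≤ 1 / 2 := fun n => by
    have h1 : (ν n : Measure ℝ).real ({a n} ∪ {b n}) ≤ 1 := measureReal_le_one
    rw [measureReal_union (by simpa using hab n) (measurableSet_singleton _)] at h1
    linarith [hle n]
  obtain ⟨r, c, hr, hc, h⟩ := exists_poissonStep_conjugate (a := a) (d := fun n => b n - a n)
    (C := 2 * V) (fun n => (hp n).1) hp' (fun n => by rw [add_sub_cancel]; exact (hp n).2.2)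
    fun n => by
      have h1 : variance id (ν n : Measure ℝ) ≤ V := hV ⟨n, rfl⟩
      have h2 := variance_twoPoint (a := a n) (b := b n) (hp n).1.le (hp n).2.1.le
      rw [← (hp n).2.2] at h2
      rw [h2] at h1
      have h3 := mul_nonneg (hp n).1.le (sq_nonneg (b n - a n))
      nlinarith [hp' n]
  exact ⟨r, c, hr, fun h => hc fun k => sub_nonneg.2 (h k), h⟩

theorem exists_isCompoundPoisson_conjugate {ν : ℕ → ProbabilityMeasure ℝ}
    (hν : IsTwoPointSequence ν) : ∃ μ : ℕ → ProbabilityMeasure ℝ, (∀ n, IsCompoundPoisson (μ n)) ∧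
      Conjugate (tailAct ν) (tailAct μ) := by
  have h : ∀ n, ∃ a b : ℝ, a ≠ b ∧ (ν n : Measure ℝ).support = {a, b} ∧
      (ν n : Measure ℝ).real {b} ≤ (ν n : Measure ℝ).real {a} := fun n => by
    obtain ⟨a, b, hab, hs⟩ := hν.1 n
    -- The atoms are renamed so that the jump goes to the lighter one. The jump may then be
    -- negative, which is harmless here but not for the positive type.
    rcases le_total ((ν n : Measure ℝ).real {b}) ((ν n : Measure ℝ).real {a}) with h | h
    · exact ⟨a, b, hab.ne, hs, h⟩
    · exact ⟨b, a, hab.ne', hs.trans (Set.pair_comm a b), h⟩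
  choose a b hab hs hle using h
  obtain ⟨r, c, -, -, h⟩ := exists_poissonStep_conjugate_of_support hab hs hle hν.2
  exact ⟨_, fun n => isCompoundPoisson_poissonStep (r n) (c n), h⟩

theorem exists_isCompoundPoisson_support_subset_conjugate {ν : ℕ → ProbabilityMeasure ℝ}
    (hν : IsLeftHeavyTwoPointSequence ν) : ∃ μ : ℕ → ProbabilityMeasure ℝ,
      (∀ n, IsCompoundPoisson (μ n) ∧ (μ n : Measure ℝ).support ⊆ Set.Ici 0) ∧
      Conjugate (tailAct ν) (tailAct μ) := by
  choose a b hab hs hle using hν.1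
  obtain ⟨r, c, hr, hc, h⟩ := exists_poissonStep_conjugate_of_support (fun n => (hab n).ne) hs
    (fun n => ENNReal.toReal_mono (measure_ne_top _ _) (hle n)) hν.2
  exact ⟨_, fun n => ⟨isCompoundPoisson_poissonStep (r n) (c n),
    support_poissonStep_subset (hr n) (hc (fun k => (hab k).le) n)⟩, h⟩

end TailFlow

theorem mainTheorem11 :
    -- flows on standard measure spaces
    (∀ (Z : Type*) [MeasurableSpace Z] [StandardBorelSpace Z] (η : Measure Z) [SigmaFinite η]
      (α : TailFlow.Flow η),
      (TailFlow.IsPoissonFlow α ↔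
        ∃ μ : ℕ → ProbabilityMeasure ℝ,
          TailFlow.IsTwoPointSequence μ ∧ TailFlow.IsTailBoundaryFlow α μ) ∧
      (TailFlow.IsPoissonFlowOfPositiveType α ↔
        ∃ μ : ℕ → ProbabilityMeasure ℝ,
          TailFlow.IsLeftHeavyTwoPointSequence μ ∧ TailFlow.IsTailBoundaryFlow α μ)) ∧
    -- the same for the actions on the tail boundary algebras themselves
    (∀ μ : ℕ → ProbabilityMeasure ℝ, (∀ n, TailFlow.IsCompoundPoisson (μ n)) →
      ∃ ν : ℕ → ProbabilityMeasure ℝ, TailFlow.IsTwoPointSequence ν ∧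
        TailFlow.Conjugate (TailFlow.tailAct μ) (TailFlow.tailAct ν)) ∧
    (∀ ν : ℕ → ProbabilityMeasure ℝ, TailFlow.IsTwoPointSequence ν →
      ∃ μ : ℕ → ProbabilityMeasure ℝ, (∀ n, TailFlow.IsCompoundPoisson (μ n)) ∧
        TailFlow.Conjugate (TailFlow.tailAct ν) (TailFlow.tailAct μ)) ∧
    (∀ μ : ℕ → ProbabilityMeasure ℝ,
      (∀ n, TailFlow.IsCompoundPoisson (μ n) ∧ (μ n : Measure ℝ).support ⊆ Set.Ici 0) →
      ∃ ν : ℕ → ProbabilityMeasure ℝ, TailFlow.IsLeftHeavyTwoPointSequence ν ∧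
        TailFlow.Conjugate (TailFlow.tailAct μ) (TailFlow.tailAct ν)) ∧
    (∀ ν : ℕ → ProbabilityMeasure ℝ, TailFlow.IsLeftHeavyTwoPointSequence ν →
      ∃ μ : ℕ → ProbabilityMeasure ℝ,
        (∀ n, TailFlow.IsCompoundPoisson (μ n) ∧ (μ n : Measure ℝ).support ⊆ Set.Ici 0) ∧
        TailFlow.Conjugate (TailFlow.tailAct ν) (TailFlow.tailAct μ)) := by
  refine ⟨fun Z _ _ η _ α => ⟨⟨?_, ?_⟩, ⟨?_, ?_⟩⟩,
    fun μ => TailFlow.exists_isTwoPointSequence_conjugate,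
    fun ν => TailFlow.exists_isCompoundPoisson_conjugate,
    fun μ => TailFlow.exists_isLeftHeavyTwoPointSequence_conjugate,
    fun ν => TailFlow.exists_isCompoundPoisson_support_subset_conjugate⟩
  · rintro ⟨-, μ, hμ, h⟩
    obtain ⟨ν, hν, hc⟩ := TailFlow.exists_isTwoPointSequence_conjugate hμ
    exact ⟨ν, hν, TailFlow.Conjugate.trans h hc⟩
  · rintro ⟨ν, hν, h⟩
    obtain ⟨μ, hμ, hc⟩ := TailFlow.exists_isCompoundPoisson_conjugate hν
    exact ⟨α.isErgodic_of_conjugate h, μ, hμ, TailFlow.Conjugate.trans h hc⟩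
  · rintro ⟨-, μ, hμ, h⟩
    obtain ⟨ν, hν, hc⟩ := TailFlow.exists_isLeftHeavyTwoPointSequence_conjugate hμ
    exact ⟨ν, hν, TailFlow.Conjugate.trans h hc⟩
  · rintro ⟨ν, hν, h⟩
    obtain ⟨μ, hμ, hc⟩ := TailFlow.exists_isCompoundPoisson_support_subset_conjugate hν
    exact ⟨α.isErgodic_of_conjugate h, μ, hμ, TailFlow.Conjugate.trans h hc⟩
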